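/- Let $d\in\{2,3\}$, let $\Omega\subset\mathbb R^d$ be a bounded polygonal (polyhedral) domain, i.e. a connected open set that is the interior of a finite union of closed nondegenerate $d$-simplices, and let $m\ge 1$ be an integer and $\sigma>0$. Then there is a constant $C>0$, depending only on $d,\Omega,m,\sigma$, such that the following holds for every conforming partition $\mathcal T_h$ of $\Omega$ into closed triangles (tetrahedra) with $h_K/\rho_K\le\sigma$ for all $K\in\mathcal T_h$, where $h_K$ is the diameter of $K$ and $\rho_K$ the diameter of the largest ball contained in $K$. Notation. For $d=3$, $\times$ and $\nabla\times$ are the usual cross product and curl. For $d=2$, for vectors $\boldsymbol a\times\boldsymbol b=a_1b_2-a_2b_1$ and $\nabla\times\boldsymbol u=\partial_1u_2-\partial_2u_1$; for a scalar $q$, $\boldsymbol a\times q=(a_2q,-a_1q)$ and $\nabla\times q=(\partial_2q,-\partial_1q)$. $H(\mathrm{curl})$ is the space of $L^2(\Omega)$ fields (with values in $\mathbb R^d$, or in $\mathbb R^{2d-3}$) whose weak curl is in $L^2(\Omega)$; $H_0(\mathrm{curl})$ is the space of $\mathbb R^d$-valued $\boldsymbol v\in H(\mathrm{curl})$ with vanishing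 tangential trace $\mathbf n\times\boldsymbol v=0$ on $\partial\Omega$, in the weak sense that $\int_\Omega(\nabla\times\boldsymbol v)\cdot\boldsymbol\varphi-\int_\Omega\boldsymbol v\cdot(\nabla\times\boldsymbol\varphi)=0$ for all smooth compactly supported $\boldsymbol\varphi:\mathbb R^d\to\mathbb R^{2d-3}$. $V_h^m$ is the space of $v\in L^2(\Omega)$ with $v|_K$ a polynomial of degree at most $m$ for each $K\in\mathcal T_h$, and $\mathbf V_h^m=(V_h^m)^d$, $\mathbf\Sigma_h^m=(V_h^m)^{2d-3}$. $\mathcal F_h$ is the set of all $(d-1)$-dimensional faces of elements, $\mathcal F_h^i$ the subset of those shared by two elements, and $h_f$ is the diameter of $f$. On $f\in\mathcal F_h^i$ shared by $K^\pm$ with outward unit normals $\mathbf n^\pm$, $[\![\mathbf n\times\boldsymbol q]\!]=\mathbf n^+\times\boldsymbol q|_{K^+}+\mathbf n^-\times\boldsymbol q|_{K^-}$; on $f\in\mathcal F_h\setminus\mathcal F_h^i$ contained in $K$, $[\![\mathbf n\times\boldsymbol q]\!]=\mathbf n\times\boldsymbol q|_K$. Finally $$\|\boldsymbol u\|_{\boldsymbol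 u}^2=\sum_{K\in\mathcal T_h}\big(\|\boldsymbol u\|_{L^2(K)}^2+\|\nabla\times\boldsymbol u\|_{L^2(K)}^2\big)+\sum_{f\in\mathcal F_h}\frac1{h_f}\|[\![\mathbf n\times\boldsymbol u]\!]\|_{L^2(f)}^2,$$ $$\|\boldsymbol p\|_{\boldsymbol p}^2=\sum_{K\in\mathcal T_h}\big(\|\boldsymbol p\|_{L^2(K)}^2+\|\nabla\times\boldsymbol p\|_{L^2(K)}^2\big)+\sum_{f\in\mathcal F_h^i}\frac1{h_f}\|[\![\mathbf n\times\boldsymbol p]\!]\|_{L^2(f)}^2.$$ Claim. For every $\boldsymbol u_h\in\mathbf V_h^m$ there exists $\boldsymbol v_h\in\mathbf V_h^m\cap H_0(\mathrm{curl})$ with $$\|\boldsymbol u_h-\boldsymbol v_h\|_{L^2(\Omega)}^2\le C\sum_{f\in\mathcal F_h}h_f\|[\![\mathbf n\times\boldsymbol u_h]\!]\|_{L^2(f)}^2,\qquad \|\boldsymbol u_h-\boldsymbol v_h\|_{\boldsymbol u}^2\le C\sum_{f\in\mathcal F_h}\frac1{h_f}\|[\![\mathbf n\times\boldsymbol u_h]\!]\|_{L^2(f)}^2,$$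 and for every $\boldsymbol p_h\in\mathbf\Sigma_h^m$ there exists $\boldsymbol w_h\in\mathbf\Sigma_h^m\cap H(\mathrm{curl})$ with $$\|\boldsymbol p_h-\boldsymbol w_h\|_{L^2(\Omega)}^2\le C\sum_{f\in\mathcal F_h^i}h_f\|[\![\mathbf n\times\boldsymbol p_h]\!]\|_{L^2(f)}^2,\qquad \|\boldsymbol p_h-\boldsymbol w_h\|_{\boldsymbol p}^2\le C\sum_{f\in\mathcal F_h^i}\frac1{h_f}\|[\![\mathbf n\times\boldsymbol p_h]\!]\|_{L^2(f)}^2.$$ -/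

import Mathlib

open MeasureTheory Set
open scoped ContDiff

noncomputable section

namespace DLSMaxwell

/-- Euclidean space `ℝⁿ` with its Euclidean norm. -/
abbrev E (n : ℕ) : Type := EuclideanSpace ℝ (Fin n)

/-! ### Cross products and curls in dimensions two and three

Vector fields on `ℝᵈ` take values in `E d`; the "dual" fields (scalar fields for `d = 2`, vector
fields for `d = 3`) take values in `E (2 * d - 3)`, which is `E 1` for `d = 2` and `E 3` for
`d = 3`. The values for other `d` are irrelevant. -/

/-- The product `a × b` of two vectors: the scalar `a₁ b₂ - a₂ b₁` for `d = 2`, the usual cross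
product for `d = 3`. -/
def crossVec : (d : ℕ) → E d → E d → E (2 * d - 3)
  | 2, a, b => (!₂[a 0 * b 1 - a 1 * b 0] : E 1)
  | 3, a, b =>
    (!₂[a 1 * b 2 - a 2 * b 1, a 2 * b 0 - a 0 * b 2, a 0 * b 1 - a 1 * b 0] : E 3)
  | _, _, _ => 0

/-- The product `a × q` of a vector and a dual quantity: `(a₂ q, - a₁ q)` for a scalar `q` if
`d = 2`, the usual cross product for `d = 3`. -/
def crossDual : (d : ℕ) → E d → E (2 * d - 3) → E d
  | 2, a, q => (!₂[a 1 * (q : E 1) 0, -(a 0 * (q : E 1) 0)] : E 2)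
  | 3, a, q => crossVec 3 a (q : E 3)
  | _, _, _ => 0

/-- The (classical) curl `∇ × φ = ∑ⱼ eⱼ × ∂ⱼ φ` with respect to a given product `×`. For
`crossVec 2` it is `∂₁ φ₂ - ∂₂ φ₁`, for `crossDual 2` it is `(∂₂ φ, -∂₁ φ)`, and for `crossVec 3`
and `crossDual 3` it is the curl of a vector field on `ℝ³`. -/
def curl {d k l : ℕ} (cross : E d → E k → E l) (φ : E d → E k) (x : E d) : E l :=
  ∑ j : Fin d, cross (EuclideanSpace.single j 1) (fderiv ℝ φ x (EuclideanSpace.single j 1))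

/-! ### The spaces `H(curl)` and `H₀(curl)`

In this part `crossT` is the product for which `curl crossT` is the formal adjoint of
`curl cross`. The pair `(cross, crossT)` is `(crossVec d, crossDual d)` for vector fields, and
`(crossDual d, crossVec d)` for dual fields. -/

/-- `w` is the weak (distributional) curl of `v` in `Ω`. -/
def IsWeakCurl {d k l : ℕ} (crossT : E d → E l → E k) (Ω : Set (E d))
    (v : E d → E k) (w : E d → E l) : Prop :=
  ∀ φ : E d → E l, ContDiff ℝ ∞ φ → HasCompactSupport φ → tsupport φ ⊆ Ω →
    ∫ x in Ω, inner ℝ (v x) (curl crossT φ x) = ∫ x in Ω, inner ℝ (w x) (φ x)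

/-- `v ∈ L²(Ω)`. -/
def MemL2 {d k : ℕ} (Ω : Set (E d)) (v : E d → E k) : Prop :=
  MemLp v 2 (volume.restrict Ω)

/-- `v ∈ H(curl)`: `v ∈ L²(Ω)` has a weak curl in `L²(Ω)`. -/
def MemHCurl {d k l : ℕ} (crossT : E d → E l → E k) (Ω : Set (E d)) (v : E d → E k) : Prop :=
  MemL2 Ω v ∧ ∃ w : E d → E l, MemL2 Ω w ∧ IsWeakCurl crossT Ω v w

/-- `v ∈ H₀(curl)`: `v ∈ H(curl)` has vanishing tangential trace `n × v` on `∂Ω`. The tangential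
trace of `v ∈ H(curl)` is the functional
`φ ↦ ∫_Ω (∇ × v) · φ - ∫_Ω v · (∇ × φ)` on smooth fields `φ` on the closure of `Ω` (the
restrictions of compactly supported smooth fields on `ℝᵈ`); for smooth `v` it is
`∫_∂Ω (n × v) · φ` by Green's formula. -/
def MemH0Curl {d k l : ℕ} (crossT : E d → E l → E k) (Ω : Set (E d)) (v : E d → E k) : Prop :=
  MemL2 Ω v ∧ ∃ w : E d → E l, MemL2 Ω w ∧ IsWeakCurl crossT Ω v w ∧
    ∀ φ : E d → E l, ContDiff ℝ ∞ φ → HasCompactSupport φ →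
      (∫ x in Ω, inner ℝ (w x) (φ x)) - ∫ x in Ω, inner ℝ (v x) (curl crossT φ x) = 0

/-! ### Polyhedral domains and simplicial meshes -/

/-- The closed simplex (convex hull) spanned by a finite set of points. -/
def hull {d : ℕ} (K : Finset (E d)) : Set (E d) := convexHull ℝ (K : Set (E d))

/-- `K` is the vertex set of a nondegenerate `d`-simplex in `ℝᵈ`. -/
def IsSimplex {d : ℕ} (K : Finset (E d)) : Prop :=
  K.card = d + 1 ∧ AffineIndependent ℝ ((↑) : K → E d)

/-- A bounded polygonal (polyhedral) domain: a connected open set that is the interior of a finite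
union of closed `d`-simplices. -/
def IsPolyhedralDomain {d : ℕ} (Ω : Set (E d)) : Prop :=
  IsConnected Ω ∧ ∃ S : Finset (Finset (E d)), (∀ K ∈ S, IsSimplex K) ∧
    Ω = interior (⋃ K ∈ S, hull K)

/-- A regular (conforming, no hanging nodes) partition of `Ω` into triangles / tetrahedra; an
element is given by its set of vertices. -/
structure Mesh {d : ℕ} (Ω : Set (E d)) where
  /-- the elements of the partition -/
  cells : Finset (Finset (E d))
  isSimplex : ∀ K ∈ cells, IsSimplex K
  cover : ⋃ K ∈ cells, hull K = closure Ω
  /-- two elements meet in the simplex spanned by their common vertices (possibly empty) -/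
  conforming : ∀ K ∈ cells, ∀ L ∈ cells,
    hull K ∩ hull L = convexHull ℝ ((K : Set (E d)) ∩ (L : Set (E d)))

/-- The diameter `h_K`, `h_f` of an element or face. -/
def size {d : ℕ} (K : Finset (E d)) : ℝ := Metric.diam (hull K)

/-- `ρ_K`: the diameter of the largest ball inscribed in the element `K`. -/
def inscribedDiam {d : ℕ} (K : Finset (E d)) : ℝ :=
  2 * sSup {r : ℝ | 0 ≤ r ∧ ∃ c : E d, Metric.closedBall c r ⊆ hull K}

/-- The unit normal on the face `f` of the simplex `K`, pointing out of `K`: the normalized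
component orthogonal to `f` of the vector from the barycenter of `K` to the barycenter of `f`. -/
def outwardNormal {d : ℕ} (K f : Finset (E d)) : E d :=
  let w : E d := (vectorSpan ℝ (f : Set (E d)))ᗮ.starProjection
    (f.centroid ℝ id - K.centroid ℝ id)
  ‖w‖⁻¹ • w

/-- The vector-valued function with polynomial components `p i`. -/
def polyFun {d k : ℕ} (p : Fin k → MvPolynomial (Fin d) ℝ) (x : E d) : E k :=
  WithLp.toLp 2 fun i => MvPolynomial.eval (fun j => x j) (p i)

open Classical in
/-- The polynomial(s) with which `u` agrees (almost everywhere) on the element `K`, if `u|_K` is a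
polynomial (it is then unique), and `0` otherwise. -/
def piece {d k : ℕ} (u : E d → E k) (K : Finset (E d)) : Fin k → MvPolynomial (Fin d) ℝ :=
  if h : ∃ p : Fin k → MvPolynomial (Fin d) ℝ, ∀ᵐ x ∂volume.restrict (hull K), u x = polyFun p x
  then h.choose else 0

namespace Mesh

variable {d : ℕ} {Ω : Set (E d)} (T : Mesh Ω)

/-- `h_K / ρ_K ≤ σ` for all elements `K`. -/
def ShapeRegular (σ : ℝ) : Prop := ∀ K ∈ T.cells, size K / inscribedDiam K ≤ σ

open Classical in
/-- All `(d-1)`-dimensional faces of the elements, as vertex sets. -/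
def faces : Finset (Finset (E d)) := T.cells.biUnion fun K => K.powersetCard d

open Classical in
/-- The elements having `f` as a face. -/
def cellsAt (f : Finset (E d)) : Finset (Finset (E d)) := T.cells.filter fun K => f ⊆ K

open Classical in
/-- The interior faces: those shared by two different elements. -/
def interiorFaces : Finset (Finset (E d)) :=
  T.faces.filter fun f => ∃ K ∈ T.cellsAt f, ∃ L ∈ T.cellsAt f, K ≠ L

/-- The space `(V_h^m)ᵏ` of (discontinuous) piecewise polynomials of degree at most `m` with `k`
components. -/
def brokenPoly (m k : ℕ) : Set (E d → E k) :=
  {u | MemL2 Ω u ∧ ∀ K ∈ T.cells, ∃ p : Fin k → MvPolynomial (Fin d) ℝ,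
    (∀ i, (p i).totalDegree ≤ m) ∧ ∀ᵐ x ∂volume.restrict (hull K), u x = polyFun p x}

/-- The tangential jump `⟦n × u⟧` at the point `x` of the face `f`. For an interior face shared by
`K⁺` and `K⁻` this is `n⁺ × u|_{K⁺} + n⁻ × u|_{K⁻}`, for a boundary face it is `n × u|_K`; here
`u|_K` on `f` is the trace from inside of `K`. -/
def jump {k l : ℕ} (cross : E d → E k → E l) (u : E d → E k) (f : Finset (E d)) (x : E d) : E l :=
  ∑ K ∈ T.cellsAt f, cross (outwardNormal K f) (polyFun (piece u K) x)

/-- `‖⟦n × u⟧‖²_{L²(f)}`, with respect to the `(d-1)`-dimensional surface measure. -/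
def jumpSq {k l : ℕ} (cross : E d → E k → E l) (u : E d → E k) (f : Finset (E d)) : ℝ :=
  ∫ x in hull f, ‖T.jump cross u f x‖ ^ 2 ∂(Measure.euclideanHausdorffMeasure (d - 1))

/-- The square of the energy norm of a piecewise polynomial `u`, with the jumps over the faces
in `F`:
`∑_K (‖u‖²_{L²(K)} + ‖∇ × u‖²_{L²(K)}) + ∑_{f ∈ F} h_f⁻¹ ‖⟦n × u⟧‖²_{L²(f)}`. -/
def energySq {k l : ℕ} (cross : E d → E k → E l) (F : Finset (Finset (E d)))
    (u : E d → E k) : ℝ :=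
  (∑ K ∈ T.cells, ((∫ x in hull K, ‖u x‖ ^ 2) +
      ∫ x in hull K, ‖curl cross (polyFun (piece u K)) x‖ ^ 2)) +
    ∑ f ∈ F, (1 / size f) * T.jumpSq cross u f

end Mesh

end DLSMaxwell

end

/-!
The conforming approximation is constructed by making the tangential degrees of freedom of a
piecewise polynomial single-valued.

On an element `K` a polynomial of degree at most `m` is written in Bernstein form
`∑ λ^α c_K(α)`, where `λ` are the barycentric coordinates of `K` and `α` runs through the
multi-indices of degree `m` on the vertices of `K` (`isBern_polyFun`). On a face `F` only the `α`
supported on `F` survive, and the barycentric coordinates of the two adjacent elements agree there,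
so the tangential jump over `F` is again in Bernstein form, with coefficients
`J_F(α) = ∑_K n_K × c_K(α)` (`Mesh.sum_cross_bern`). Hence tangential continuity is a condition on
each `α` separately. With a vertex `r` in the support of `α`, the coefficient `c_K(α)` is determined
by its components along the edges from `r` to the vertices `b` of `K`, and `J_F(α) = 0` means that
the components belonging to the vertices `b` of `F` have the same value on both sides of `F` (value
zero for the tangential trace on the boundary). For dual fields in dimension two, which are scalar,
the coefficient itself takes the role of these components. The two cases are treated together by the
structure `IsFrame`.

The component of index `(α, b)` is therefore shared by the elements around `supp α ∪ {b}` that are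
connected through faces containing this set. On each such connected component it is replaced by the
value on one of the elements, or by zero if a boundary face with the boundary condition occurs. The
difference to the old value is a sum of coefficients `J_F(α)` along a chain of faces
(`Mesh.exists_conforming_coef`). By shape regularity the number of elements around a vertex is
bounded (`exists_card_cellsAt_le`), hence so is the length of the chain, and the sizes of the
elements in it are comparable (`Mesh.size_le_of_reachable`).

It remains to scale. Bernstein polynomials and their curls are bounded on `K` by their coefficients
and by `1 / ρ_K` (`norm_bern_le`, `norm_curl_bern_le`). Conversely, the `J_F(α)` are bounded by the
`L²` norm of the jump with respect to the surface measure: the barycentric coordinates map `F` onto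
the reference simplex with Lipschitz constant of order `1 / ρ_K`, and on the reference simplex the
Bernstein form is injective on a finite-dimensional space (`exists_face_lower`). Volumes against
areas give the powers of `h_f` (`Mesh.exists_cell_bounds`).

The weak curl of the new field is its elementwise curl by Green's formula (`Mesh.green`). It is
derived from the fundamental theorem of calculus and Fubini's theorem on the reference simplex. This
expresses the boundary terms by integrals over the reference simplex of dimension `d - 1` instead of
surface integrals, which suffices because the jumps vanish pointwise; only the independence of these
integrals from the order of the vertices (`integral_simplexPt_perm`), and of the surface factor from
the adjacent element (`volRatio_mul_norm_grad`), is needed. Boundary faces without boundary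
condition do not contribute since they do not meet `Ω` (`Mesh.disjoint_boundaryFace`).
-/

open MeasureTheory Set
open scoped ContDiff

noncomputable section

namespace DLSMaxwell

variable {d : ℕ} {K L F : Finset (E d)}

/-! ### Barycentric coordinates of a simplex -/

/-- The vertices of a nondegenerate simplex as an affine basis. -/
def IsSimplex.basis (h : IsSimplex K) : AffineBasis K ℝ (E d) :=
  ⟨((↑) : K → E d), h.2, by
    rw [h.2.affineSpan_eq_top_iff_card_eq_finrank_add_one]
    simp [h.1]⟩

open Classical in
/-- The barycentric coordinate of the vertex `a` of the simplex `K`, as an affine function on the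
whole space; it is `0` if `a` is not a vertex. -/
def bary (K : Finset (E d)) (a : E d) : E d →ᵃ[ℝ] ℝ :=
  if h : IsSimplex K ∧ a ∈ K then h.1.basis.coord ⟨a, h.2⟩ else 0

lemma bary_eq_coord (h : IsSimplex K) (a : K) : bary K a = h.basis.coord a := by
  simp [bary, h]

lemma bary_of_notMem {a : E d} (ha : a ∉ K) : bary K a = 0 := by
  simp [bary, ha]

lemma bary_self (h : IsSimplex K) {a : E d} (ha : a ∈ K) : bary K a a = 1 := by
  rw [bary_eq_coord h ⟨a, ha⟩]
  exact h.basis.coord_apply_eq ⟨a, ha⟩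

lemma bary_ne {a b : E d} (hb : b ∈ K) (hab : a ≠ b) :
    bary K a b = 0 := by
  by_cases h : IsSimplex K
  · by_cases ha : a ∈ K
    · rw [bary_eq_coord h ⟨a, ha⟩]
      exact h.basis.coord_apply_ne (i := ⟨a, ha⟩) (j := ⟨b, hb⟩) (by simpa using hab)
    · simp [bary_of_notMem ha]
  · simp [bary, h]

lemma sum_bary (h : IsSimplex K) (x : E d) : ∑ a ∈ K, bary K a x = 1 := by
  rw [← Finset.sum_coe_sort, ← h.basis.sum_coord_apply_eq_one x]
  simp only [bary_eq_coord h]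

lemma sum_bary_smul (h : IsSimplex K) (x : E d) : ∑ a ∈ K, bary K a x • a = x := by
  conv_rhs => rw [← h.basis.linear_combination_coord_eq_self x]
  rw [← Finset.sum_coe_sort]
  simp only [bary_eq_coord h]
  rfl

/-- Barycentric coordinates of an affine combination of some of the vertices. -/
lemma bary_combination (h : IsSimplex K) (hF : F ⊆ K) {w : E d → ℝ} (hw : ∑ a ∈ F, w a = 1)
    {a : E d} : bary K a (∑ b ∈ F, w b • b) = if a ∈ F then w a else 0 := by
  have h1 : ∑ b ∈ F, w b • b = Finset.affineCombination ℝ F id w := by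
    rw [Finset.affineCombination_eq_linear_combination _ _ _ hw]; rfl
  rw [h1, Finset.map_affineCombination _ _ _ hw,
    Finset.affineCombination_eq_linear_combination _ _ _ hw]
  have : ∀ b ∈ F, w b • (bary K a ∘ id) b = if a = b then w b else 0 := by
    intro b hb
    split_ifs with hab
    · subst hab; simp [bary_self h (hF hb)]
    · simp [bary_ne (hF hb) hab]
  rw [Finset.sum_congr rfl this, Finset.sum_ite_eq]

lemma mem_hull_iff_exists {x : E d} : x ∈ hull F ↔
    ∃ w : E d → ℝ, (∀ a ∈ F, 0 ≤ w a) ∧ ∑ a ∈ F, w a = 1 ∧ ∑ a ∈ F, w a • a = x := by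
  rw [hull, Finset.convexHull_eq]
  constructor
  · rintro ⟨w, h0, h1, h2⟩
    exact ⟨w, h0, h1, by rwa [Finset.centerMass_eq_of_sum_1 _ _ h1] at h2⟩
  · rintro ⟨w, h0, h1, h2⟩
    exact ⟨w, h0, h1, by rwa [Finset.centerMass_eq_of_sum_1 _ _ h1]⟩

/-- A point belongs to the face `F` of the simplex `K` iff its barycentric coordinates are
nonnegative, and zero off `F`. -/
lemma mem_hull_face_iff (h : IsSimplex K) (hF : F ⊆ K) {x : E d} :
    x ∈ hull F ↔ (∀ a ∈ F, 0 ≤ bary K a x) ∧ ∀ a ∈ K, a ∉ F → bary K a x = 0 := by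
  rw [mem_hull_iff_exists]
  constructor
  · rintro ⟨w, h0, h1, rfl⟩
    constructor
    · intro a ha
      rw [bary_combination h hF h1, if_pos ha]
      exact h0 a ha
    · intro a _ ha
      rw [bary_combination h hF h1, if_neg ha]
  · rintro ⟨h0, h1⟩
    refine ⟨fun a => bary K a x, h0, ?_, ?_⟩
    · rw [← sum_bary h x]
      exact Finset.sum_subset hF h1
    · conv_rhs => rw [← sum_bary_smul h x]
      exact Finset.sum_subset hF fun a ha hb => by simp [h1 a ha hb]

lemma mem_hull_iff (h : IsSimplex K) {x : E d} : x ∈ hull K ↔ ∀ a ∈ K, 0 ≤ bary K a x := by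
  rw [mem_hull_face_iff h (Finset.Subset.refl _)]
  exact ⟨fun hx => hx.1, fun hx => ⟨hx, fun a ha hb => absurd ha hb⟩⟩

lemma hull_mono (hF : F ⊆ K) : hull F ⊆ hull K :=
  convexHull_mono (by simpa using hF)

lemma mem_hull_of_mem {a : E d} (ha : a ∈ K) : a ∈ hull K :=
  subset_convexHull _ _ (by simpa using ha)

lemma bary_mem_Icc (h : IsSimplex K) {x : E d} (hx : x ∈ hull K) (a : E d) :
    0 ≤ bary K a x ∧ bary K a x ≤ 1 := by
  by_cases ha : a ∈ K
  · have h0 := (mem_hull_iff h).1 hx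
    refine ⟨h0 a ha, ?_⟩
    rw [← sum_bary h x]
    exact Finset.single_le_sum (f := fun a => bary K a x) h0 ha
  · simp [bary_of_notMem ha]

/-- On a common face, the barycentric coordinates of two simplices agree. -/
lemma bary_eq_of_mem_face (hK : IsSimplex K) (hL : IsSimplex L) (hFK : F ⊆ K) (hFL : F ⊆ L)
    {x : E d} (hx : x ∈ hull F) (a : E d) : bary K a x = bary L a x := by
  obtain ⟨w, -, h1, rfl⟩ := mem_hull_iff_exists.1 hx
  rw [bary_combination hK hFK h1, bary_combination hL hFL h1]

/-- The gradient of a barycentric coordinate. -/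
def grad (K : Finset (E d)) (a : E d) : E d :=
  (InnerProductSpace.toDual ℝ (E d)).symm (LinearMap.toContinuousLinearMap (bary K a).linear)

lemma inner_grad (a v : E d) : inner ℝ (grad K a) v = (bary K a).linear v := by
  simp [grad]

lemma bary_sub (a x y : E d) : bary K a x - bary K a y = inner ℝ (grad K a) (x - y) := by
  rw [inner_grad, ← vsub_eq_sub x y, AffineMap.linearMap_vsub]; rfl

lemma bary_eq_add (a x y : E d) : bary K a x = bary K a y + inner ℝ (grad K a) (x - y) := by
  rw [← bary_sub]; ring

lemma inner_grad_sub (h : IsSimplex K) {a b c : E d} (ha : a ∈ K) (hb : b ∈ K) (hc : c ∈ K)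
    (hab : b ≠ a) : inner ℝ (grad K a) (c - b) = if c = a then 1 else 0 := by
  rw [← bary_sub, bary_ne hb hab.symm]
  split_ifs with hca
  · subst hca; simp [bary_self h ha]
  · simp [bary_ne hc (Ne.symm hca)]

/-- A vector in terms of the barycentric frame. -/
lemma sum_inner_grad_smul (h : IsSimplex K) (v : E d) (r : E d) :
    ∑ a ∈ K, inner ℝ (grad K a) v • (a - r) = v := by
  have h1 : ∑ a ∈ K, inner ℝ (grad K a) v = 0 := by
    have h2 : ∀ a, inner ℝ (grad K a) v = bary K a v - bary K a 0 := fun a => by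
      rw [bary_sub, sub_zero]
    simp only [h2, Finset.sum_sub_distrib, sum_bary h, sub_self]
  have h3 : ∑ a ∈ K, inner ℝ (grad K a) v • a = v := by
    have h2 : ∀ a, inner ℝ (grad K a) v • a = bary K a v • a - bary K a 0 • a := fun a => by
      rw [← sub_smul, bary_sub, sub_zero]
    simp only [h2, Finset.sum_sub_distrib, sum_bary_smul h, sub_zero]
  simp only [smul_sub, Finset.sum_sub_distrib, h3, ← Finset.sum_smul, h1, zero_smul, sub_zero]

/-- A vector in terms of the gradients of the barycentric coordinates. -/
lemma sum_inner_smul_grad (h : IsSimplex K) (v : E d) (r : E d) :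
    ∑ a ∈ K, inner ℝ v (a - r) • grad K a = v := by
  refine ext_inner_right ℝ fun u => ?_
  conv_rhs => rw [← sum_inner_grad_smul h u r]
  rw [sum_inner, inner_sum]
  refine Finset.sum_congr rfl fun a _ => ?_
  rw [inner_smul_left, inner_smul_right]
  simp [mul_comm]

/-! ### Size of a simplex and of its inscribed balls -/

lemma isCompact_hull (K : Finset (E d)) : IsCompact (hull K) :=
  K.finite_toSet.isCompact_convexHull ℝ

lemma isClosed_hull (K : Finset (E d)) : IsClosed (hull K) := (isCompact_hull K).isClosed

lemma measurableSet_hull (K : Finset (E d)) : MeasurableSet (hull K) :=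
  (isClosed_hull K).measurableSet

lemma convex_hull (K : Finset (E d)) : Convex ℝ (hull K) := convex_convexHull _ _

lemma IsSimplex.nonempty_interior (h : IsSimplex K) : (interior (hull K)).Nonempty := by
  rw [hull, interior_convexHull_nonempty_iff_affineSpan_eq_top]
  have h1 := h.basis.tot
  have h2 : range (h.basis : K → E d) = (K : Set (E d)) := Subtype.range_coe
  rwa [h2] at h1

lemma dist_le_size {x y : E d} (hx : x ∈ hull K) (hy : y ∈ hull K) : ‖x - y‖ ≤ size K := by
  rw [← dist_eq_norm]
  exact Metric.dist_le_diam_of_mem (isCompact_hull K).isBounded hx hy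

lemma size_mono (hF : F ⊆ K) : size F ≤ size K :=
  Metric.diam_mono (hull_mono hF) (isCompact_hull K).isBounded

lemma size_nonneg (K : Finset (E d)) : 0 ≤ size K := Metric.diam_nonneg

/-- The radii of balls inside a simplex `K` are at most half of any height of `K`. -/
lemma radius_mul_norm_grad_le (h : IsSimplex K) {a c : E d} {r : ℝ} (hr : 0 ≤ r)
    (hc : Metric.closedBall c r ⊆ hull K) : 2 * r * ‖grad K a‖ ≤ 1 := by
  by_cases hg : grad K a = 0
  · simp [hg]
  have hg' : ‖grad K a‖ ≠ 0 := norm_ne_zero_iff.2 hg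
  set e : E d := (r * ‖grad K a‖⁻¹) • grad K a with he
  have hn : ‖e‖ = r := by
    rw [he, norm_smul, norm_mul, norm_inv, norm_norm, Real.norm_of_nonneg hr, mul_assoc,
      inv_mul_cancel₀ hg', mul_one]
  have h1 : c + e ∈ hull K := hc (by simp [hn])
  have h2 : c - e ∈ hull K := hc (by simp [hn])
  have h3 := bary_sub (K := K) a (c + e) (c - e)
  have h4 : (c + e) - (c - e) = (2 * (r * ‖grad K a‖⁻¹)) • grad K a := by
    rw [he]; module
  rw [h4, inner_smul_right, real_inner_self_eq_norm_sq] at h3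
  have h5 := (bary_mem_Icc h h1 a).2
  have h6 := (bary_mem_Icc h h2 a).1
  have h7 : 2 * (r * ‖grad K a‖⁻¹) * ‖grad K a‖ ^ 2 = 2 * r * ‖grad K a‖ := by
    field_simp
  linarith

lemma IsSimplex.nontrivial (h : IsSimplex K) (hd : 1 ≤ d) : ∃ a ∈ K, ∃ b ∈ K, a ≠ b :=
  Finset.one_lt_card.1 (by rw [h.1]; omega)

/-- `‖grad K a‖⁻¹` is the height of `a` over the opposite face, so at most the length of an edge. -/
lemma one_le_norm_grad_mul (h : IsSimplex K) {a b : E d} (ha : a ∈ K) (hb : b ∈ K)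
    (hab : b ≠ a) : 1 ≤ ‖grad K a‖ * ‖a - b‖ := by
  have := inner_grad_sub h ha hb ha hab
  rw [if_pos rfl] at this
  rw [← this]
  exact real_inner_le_norm _ _

lemma bddAbove_radii (h : IsSimplex K) (hd : 1 ≤ d) :
    BddAbove {r : ℝ | 0 ≤ r ∧ ∃ c : E d, Metric.closedBall c r ⊆ hull K} := by
  obtain ⟨a, ha, b, hb, hab⟩ := h.nontrivial hd
  refine ⟨‖a - b‖, ?_⟩
  rintro r ⟨hr, c, hc⟩
  have h1 := radius_mul_norm_grad_le (a := a) h hr hc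
  have h2 := one_le_norm_grad_mul h ha hb hab.symm
  have h3 : 0 < ‖grad K a‖ := by
    rcases (norm_nonneg (grad K a)).eq_or_lt with h0 | h0
    · rw [← h0] at h2; linarith
    · exact h0
  have h4 : r * ‖grad K a‖ ≤ ‖a - b‖ * ‖grad K a‖ := by nlinarith
  exact le_of_mul_le_mul_right h4 h3

lemma inscribedDiam_pos (h : IsSimplex K) (hd : 1 ≤ d) : 0 < inscribedDiam K := by
  obtain ⟨c, hc⟩ := h.nonempty_interior
  obtain ⟨r, hr, hb⟩ := Metric.isOpen_iff.1 isOpen_interior c hc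
  have h1 : r / 2 ≤ sSup {r : ℝ | 0 ≤ r ∧ ∃ c : E d, Metric.closedBall c r ⊆ hull K} := by
    refine le_csSup (bddAbove_radii h hd) ⟨by positivity, c, ?_⟩
    exact (Metric.closedBall_subset_ball (by linarith)).trans (hb.trans interior_subset)
  rw [inscribedDiam]
  linarith

lemma norm_grad_mul_inscribedDiam_le (h : IsSimplex K) (a : E d) :
    ‖grad K a‖ * inscribedDiam K ≤ 1 := by
  have h0 : inscribedDiam K * ‖grad K a‖ ≤ 1 := by
    by_cases hg : ‖grad K a‖ = 0
    · simp [hg]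
    have hg' : 0 < ‖grad K a‖ := lt_of_le_of_ne (norm_nonneg _) (Ne.symm hg)
    rw [← le_div_iff₀ hg', inscribedDiam]
    have : sSup {r : ℝ | 0 ≤ r ∧ ∃ c : E d, Metric.closedBall c r ⊆ hull K} ≤
        1 / ‖grad K a‖ / 2 := by
      refine Real.sSup_le ?_ (by positivity)
      rintro r ⟨hr, c, hc⟩
      have := radius_mul_norm_grad_le (a := a) h hr hc
      rw [div_div, le_div_iff₀ (by positivity)]
      linarith
    linarith
  linarith

/-- A simplex contains a ball with half of its inscribed radius; whether the supremum defining
`inscribedDiam` is attained does not matter. -/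
lemma exists_closedBall_subset (h : IsSimplex K) (hd : 1 ≤ d) :
    ∃ c : E d, Metric.closedBall c (inscribedDiam K / 4) ⊆ hull K := by
  have h0 := inscribedDiam_pos h hd
  have h1 : inscribedDiam K / 4 <
      sSup {r : ℝ | 0 ≤ r ∧ ∃ c : E d, Metric.closedBall c r ⊆ hull K} := by
    have : inscribedDiam K =
      2 * sSup {r : ℝ | 0 ≤ r ∧ ∃ c : E d, Metric.closedBall c r ⊆ hull K} := rfl
    linarith
  have h2 : {r : ℝ | 0 ≤ r ∧ ∃ c : E d, Metric.closedBall c r ⊆ hull K}.Nonempty :=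
    ⟨0, le_rfl, h.nonempty_interior.some,
      by simpa using interior_subset h.nonempty_interior.some_mem⟩
  obtain ⟨r, ⟨hr, c, hc⟩, hlt⟩ := exists_lt_of_lt_csSup h2 h1
  exact ⟨c, (Metric.closedBall_subset_closedBall hlt.le).trans hc⟩

lemma inscribedDiam_le_norm_sub (h : IsSimplex K) {a b : E d} (ha : a ∈ K)
    (hb : b ∈ K) (hab : a ≠ b) : inscribedDiam K ≤ ‖a - b‖ := by
  have h1 := norm_grad_mul_inscribedDiam_le h a
  have h2 := one_le_norm_grad_mul h ha hb hab.symm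
  have h3 : 0 < ‖grad K a‖ := by
    rcases (norm_nonneg (grad K a)).eq_or_lt with h0 | h0
    · rw [← h0] at h2; linarith
    · exact h0
  exact le_of_mul_le_mul_left (h1.trans h2) h3

/-- A face with at least two vertices is not smaller than the inscribed balls. -/
lemma inscribedDiam_le_size (h : IsSimplex K) (hF : F ⊆ K) (h2 : 2 ≤ F.card) :
    inscribedDiam K ≤ size F := by
  obtain ⟨a, ha, b, hb, hab⟩ := Finset.one_lt_card.1 h2
  exact (inscribedDiam_le_norm_sub h (hF ha) (hF hb) hab).trans
    (dist_le_size (mem_hull_of_mem ha) (mem_hull_of_mem hb))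

lemma size_pos (h : IsSimplex K) (hd : 1 ≤ d) (hF : F ⊆ K) (h2 : 2 ≤ F.card) : 0 < size F :=
  (inscribedDiam_pos h hd).trans_le (inscribedDiam_le_size h hF h2)

lemma grad_ne_zero (h : IsSimplex K) (hd : 1 ≤ d) {a : E d} (ha : a ∈ K) : grad K a ≠ 0 := by
  obtain ⟨b, hb, hab⟩ := Finset.exists_mem_ne (by rw [h.1]; omega) a
  intro h0
  have := one_le_norm_grad_mul h ha hb hab
  rw [h0] at this
  norm_num at this

/-! ### Faces of simplices and normal vectors -/

lemma mem_interior_hull_iff (h : IsSimplex K) {x : E d} :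
    x ∈ interior (hull K) ↔ ∀ a ∈ K, 0 < bary K a x := by
  have h2 : range (h.basis : K → E d) = (K : Set (E d)) := Subtype.range_coe
  rw [hull, ← h2, h.basis.interior_convexHull]
  constructor
  · intro hx a ha
    rw [bary_eq_coord h ⟨a, ha⟩]
    exact hx ⟨a, ha⟩
  · intro hx a
    rw [← bary_eq_coord h]
    exact hx a a.2

lemma affine_apply_eq_sum (h : IsSimplex L) (f : E d →ᵃ[ℝ] ℝ) (x : E d) :
    f x = ∑ c ∈ L, bary L c x * f c := by
  conv_lhs => rw [← sum_bary_smul h x]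
  have h1 : ∑ b ∈ L, bary L b x • b = Finset.affineCombination ℝ L id (fun b => bary L b x) := by
    rw [Finset.affineCombination_eq_linear_combination _ _ _ (sum_bary h x)]; rfl
  rw [h1, Finset.map_affineCombination _ _ _ (sum_bary h x),
    Finset.affineCombination_eq_linear_combination _ _ _ (sum_bary h x)]
  rfl

/-- A face with `d` vertices has exactly one opposite vertex. -/
lemma exists_insert_face (h : IsSimplex K) (hF : F ⊆ K) (hc : F.card = d) :
    ∃ a ∈ K, a ∉ F ∧ ∀ b ∈ K, b ∉ F → b = a := by
  classical
  have h1 : (K \ F).card = 1 := by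
    rw [Finset.card_sdiff_of_subset hF, h.1, hc]; omega
  obtain ⟨a, ha⟩ := Finset.card_eq_one.1 h1
  have ha' : a ∈ K \ F := by rw [ha]; exact Finset.mem_singleton_self a
  refine ⟨a, (Finset.mem_sdiff.1 ha').1, (Finset.mem_sdiff.1 ha').2, fun b hb hbF => ?_⟩
  have : b ∈ K \ F := Finset.mem_sdiff.2 ⟨hb, hbF⟩
  rw [ha] at this
  exact Finset.mem_singleton.1 this

lemma sum_eq_add_sum_face {M : Type*} [AddCommMonoid M] (h : IsSimplex K) (hF : F ⊆ K)
    (hc : F.card = d) {a : E d} (ha : a ∈ K) (haF : a ∉ F) (f : E d → M) :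
    ∑ b ∈ K, f b = f a + ∑ b ∈ F, f b := by
  classical
  have : K = insert a F := by
    refine (Finset.eq_of_subset_of_card_le ?_ ?_).symm
    · exact Finset.insert_subset ha hF
    · rw [h.1, Finset.card_insert_of_notMem haF, hc]
  rw [this, Finset.sum_insert haF]

/-- The barycentric coordinates of the vertices opposite to a common face are proportional. -/
lemma bary_opposite (hL : IsSimplex L) (hFK : F ⊆ K) (hFL : F ⊆ L)
    (hc : F.card = d) {a b : E d} (haF : a ∉ F) (hb : b ∈ L) (hbF : b ∉ F)
    (x : E d) : bary K a x = bary K a b * bary L b x := by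
  rw [affine_apply_eq_sum hL (bary K a) x, sum_eq_add_sum_face hL hFL hc hb hbF,
    Finset.sum_eq_zero, add_zero, mul_comm]
  intro c hcF
  rw [bary_ne (hFK hcF) (by rintro rfl; exact haF hcF), mul_zero]

lemma grad_opposite (hL : IsSimplex L) (hFK : F ⊆ K) (hFL : F ⊆ L)
    (hc : F.card = d) {a b : E d} (haF : a ∉ F) (hb : b ∈ L) (hbF : b ∉ F) :
    grad K a = bary K a b • grad L b := by
  refine ext_inner_right ℝ fun v => ?_
  have h1 := bary_sub (K := K) a v 0
  have h2 := bary_sub (K := L) b v 0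
  rw [sub_zero] at h1 h2
  rw [inner_smul_left, ← h1, ← h2, bary_opposite hL hFK hFL hc haF hb hbF v,
    bary_opposite hL hFK hFL hc haF hb hbF 0]
  simp
  ring

lemma bary_centroid (h : IsSimplex K) (hF : F ⊆ K) (hF0 : F.Nonempty) (a : E d) :
    bary K a (F.centroid ℝ id) = if a ∈ F then (F.card : ℝ)⁻¹ else 0 := by
  classical
  have h1 : ∑ a ∈ F, (fun _ : E d => (F.card : ℝ)⁻¹) a = 1 := by
    rw [Finset.sum_const, nsmul_eq_mul]
    exact mul_inv_cancel₀ (by exact_mod_cast hF0.card_pos.ne')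
  have h2 : F.centroid ℝ id = ∑ b ∈ F, (fun _ : E d => (F.card : ℝ)⁻¹) b • b := by
    rw [Finset.centroid_def, Finset.affineCombination_eq_linear_combination]
    · rfl
    · exact h1
  rw [h2, bary_combination h hF h1]

lemma grad_mem_orthogonal (hF : F ⊆ K) {a : E d} (haF : a ∉ F) :
    grad K a ∈ (vectorSpan ℝ (F : Set (E d)))ᗮ := by
  rw [Submodule.mem_orthogonal']
  intro v hv
  rw [vectorSpan_def] at hv
  induction hv using Submodule.span_induction with
  | mem x hx =>
    obtain ⟨b, hb, c, hc, rfl⟩ := hx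
    change inner ℝ (grad K a) (b - c) = 0
    rw [← bary_sub, bary_ne (hF hb) (by rintro rfl; exact haF hb),
      bary_ne (hF hc) (by rintro rfl; exact haF hc), sub_zero]
  | zero => simp
  | add x y _ _ hx hy => rw [inner_add_right, hx, hy, add_zero]
  | smul c x _ hx => rw [inner_smul_right, hx, mul_zero]

/-- A vector orthogonal to a face is parallel to the gradient of the barycentric coordinate of
the opposite vertex. -/
lemma eq_smul_grad_of_orthogonal (h : IsSimplex K) (hF : F ⊆ K) (hc : F.card = d)
    {a r v : E d} (ha : a ∈ K) (haF : a ∉ F)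
    (hv : ∀ b ∈ F, inner ℝ v (b - r) = 0) : v = inner ℝ v (a - r) • grad K a := by
  conv_lhs => rw [← sum_inner_smul_grad h v r]
  rw [sum_eq_add_sum_face h hF hc ha haF, Finset.sum_eq_zero, add_zero]
  intro b hb
  rw [hv b hb, zero_smul]

/-- The outward normal is the normalized negative gradient of the barycentric coordinate of the
opposite vertex. -/
lemma outwardNormal_eq (h : IsSimplex K) (hd : 1 ≤ d) (hF : F ⊆ K) (hc : F.card = d)
    {a : E d} (ha : a ∈ K) (haF : a ∉ F) :
    outwardNormal K F = -(‖grad K a‖⁻¹ • grad K a) := by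
  classical
  have hg := norm_pos_iff.2 (grad_ne_zero h hd ha)
  have hF0 : F.Nonempty := Finset.card_pos.1 (by omega)
  obtain ⟨r, hr⟩ := hF0
  have hw : (vectorSpan ℝ (F : Set (E d)))ᗮ.starProjection
      (F.centroid ℝ id - K.centroid ℝ id) =
      (-(((d : ℝ) + 1)⁻¹ * (‖grad K a‖ ^ 2)⁻¹)) • grad K a := by
    refine Submodule.eq_starProjection_of_mem_of_inner_eq_zero ?_ ?_
    · exact Submodule.smul_mem _ _ (grad_mem_orthogonal hF haF)
    · intro y hy
      have hy' : ∀ b ∈ F, inner ℝ y (b - r) = 0 := fun b hb =>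
        (Submodule.mem_orthogonal' _ _).1 hy _
          (vsub_mem_vectorSpan ℝ (Finset.mem_coe.2 hb) (Finset.mem_coe.2 hr))
      have h1 : inner ℝ (grad K a) (F.centroid ℝ id - K.centroid ℝ id) = -((d : ℝ) + 1)⁻¹ := by
        rw [← bary_sub, bary_centroid h hF ⟨r, hr⟩, bary_centroid h (Finset.Subset.refl _) ⟨a, ha⟩,
          if_neg haF, if_pos ha, h.1]
        push_cast
        ring
      rw [eq_smul_grad_of_orthogonal h hF hc ha haF hy', inner_smul_right, inner_sub_left,
        inner_smul_left, real_inner_comm (grad K a) (F.centroid ℝ id - K.centroid ℝ id), h1,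
        real_inner_self_eq_norm_sq]
      simp only [map_neg, map_mul, map_inv₀, map_add, map_pow, conj_trivial]
      field_simp
      ring
  rw [outwardNormal]
  simp only [hw]
  rw [norm_smul, norm_neg, Real.norm_of_nonneg (by positivity), smul_smul, ← neg_smul]
  congr 1
  field_simp

lemma norm_outwardNormal (h : IsSimplex K) (hd : 1 ≤ d) (hF : F ⊆ K) (hc : F.card = d) :
    ‖outwardNormal K F‖ = 1 := by
  obtain ⟨a, ha, haF, -⟩ := exists_insert_face h hF hc
  rw [outwardNormal_eq h hd hF hc ha haF, norm_neg, norm_smul, norm_inv, norm_norm]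
  exact inv_mul_cancel₀ (norm_ne_zero_iff.2 (grad_ne_zero h hd ha))

lemma inner_outwardNormal (h : IsSimplex K) (hd : 1 ≤ d) (hF : F ⊆ K) (hc : F.card = d)
    {b r : E d} (hb : b ∈ F) (hr : r ∈ F) : inner ℝ (outwardNormal K F) (b - r) = 0 := by
  obtain ⟨a, ha, haF, -⟩ := exists_insert_face h hF hc
  rw [outwardNormal_eq h hd hF hc ha haF, inner_neg_left, inner_smul_left, ← bary_sub,
    bary_ne (hF hb) (by rintro rfl; exact haF hb), bary_ne (hF hr) (by rintro rfl; exact haF hr)]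
  simp

/-- A vector orthogonal to a face is a multiple of the normal vector. -/
lemma eq_smul_outwardNormal (h : IsSimplex K) (hd : 1 ≤ d) (hF : F ⊆ K) (hc : F.card = d)
    {r v : E d} (hv : ∀ b ∈ F, inner ℝ v (b - r) = 0) :
    ∃ t : ℝ, v = t • outwardNormal K F := by
  obtain ⟨a, ha, haF, -⟩ := exists_insert_face h hF hc
  have hg := norm_ne_zero_iff.2 (grad_ne_zero h hd ha)
  refine ⟨-(inner ℝ v (a - r) * ‖grad K a‖), ?_⟩
  conv_lhs => rw [eq_smul_grad_of_orthogonal h hF hc ha haF hv]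
  rw [outwardNormal_eq h hd hF hc ha haF, neg_smul_neg, smul_smul, mul_assoc,
    mul_inv_cancel₀ hg, mul_one]

/-! ### Adjacent elements of a mesh -/

namespace Mesh

variable {Ω : Set (E d)} (T : Mesh Ω)

lemma mem_faces : F ∈ T.faces ↔ ∃ K ∈ T.cells, F ⊆ K ∧ F.card = d := by
  simp [faces, Finset.mem_powersetCard]

lemma mem_cellsAt : K ∈ T.cellsAt F ↔ K ∈ T.cells ∧ F ⊆ K := by
  simp [cellsAt]

lemma mem_interiorFaces : F ∈ T.interiorFaces ↔
    F.card = d ∧ ∃ K ∈ T.cellsAt F, ∃ L ∈ T.cellsAt F, K ≠ L := by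
  simp only [interiorFaces, Finset.mem_filter, mem_faces]
  constructor
  · rintro ⟨⟨K, hK, hF, hc⟩, h⟩
    exact ⟨hc, h⟩
  · rintro ⟨hc, K, hK, h⟩
    exact ⟨⟨K, (T.mem_cellsAt.1 hK).1, (T.mem_cellsAt.1 hK).2, hc⟩, K, hK, h⟩

lemma interiorFaces_subset : T.interiorFaces ⊆ T.faces := Finset.filter_subset _ _

lemma card_of_mem_faces (hF : F ∈ T.faces) : F.card = d := by
  obtain ⟨-, -, -, h⟩ := T.mem_faces.1 hF
  exact h

/-- The intersection of two elements is contained in every simplex having all their common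
vertices. -/
lemma mem_hull_of_mem_of_mem (hK : K ∈ T.cells) (hL : L ∈ T.cells)
    (hF : ∀ a ∈ K, a ∈ L → a ∈ F) {x : E d} (hxK : x ∈ hull K) (hxL : x ∈ hull L) :
    x ∈ hull F := by
  have h1 : x ∈ hull K ∩ hull L := ⟨hxK, hxL⟩
  rw [T.conforming K hK L hL] at h1
  exact convexHull_mono (fun a ha => hF a ha.1 ha.2) h1

lemma exists_mem_notMem (hK : K ∈ T.cells) (hL : L ∈ T.cells) (hKL : K ≠ L) :
    ∃ a ∈ K, a ∉ L := by
  by_contra! h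
  exact hKL (Finset.eq_of_subset_of_card_le h
    (by rw [(T.isSimplex K hK).1, (T.isSimplex L hL).1]))

/-- Different elements have disjoint interiors. -/
lemma disjoint_interior (hK : K ∈ T.cells) (hL : L ∈ T.cells) (hKL : K ≠ L) :
    Disjoint (interior (hull K)) (hull L) := by
  rw [Set.disjoint_left]
  intro x hxK hxL
  classical
  obtain ⟨a, ha, haL⟩ := T.exists_mem_notMem hK hL hKL
  have h1 : x ∈ hull (K.filter (· ∈ L)) :=
    T.mem_hull_of_mem_of_mem hK hL (fun a ha ha' => Finset.mem_filter.2 ⟨ha, ha'⟩)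
      (interior_subset hxK) hxL
  have h2 := ((mem_hull_face_iff (T.isSimplex K hK) (Finset.filter_subset _ _)).1 h1).2 a ha
    (by simp [haL])
  have h3 := (mem_interior_hull_iff (T.isSimplex K hK)).1 hxK a ha
  linarith

lemma volume_inter_eq_zero (hK : K ∈ T.cells) (hL : L ∈ T.cells) (hKL : K ≠ L) :
    volume (hull K ∩ hull L) = 0 := by
  refine measure_mono_null ?_ ((convex_hull K).addHaar_frontier volume)
  rintro x ⟨hxK, hxL⟩
  rw [(isClosed_hull K).frontier_eq]
  exact ⟨hxK, fun h => Set.disjoint_left.1 (T.disjoint_interior hK hL hKL) h hxL⟩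

/-- Two elements with a common face are on opposite sides of that face. -/
lemma bary_opposite_neg (hd : 1 ≤ d) (hK : K ∈ T.cells) (hL : L ∈ T.cells) (hKL : K ≠ L)
    (hFK : F ⊆ K) (hFL : F ⊆ L) (hc : F.card = d) {a b : E d} (ha : a ∈ K) (haF : a ∉ F)
    (hb : b ∈ L) (hbF : b ∉ F) : bary K a b < 0 := by
  have sK := T.isSimplex K hK
  have sL := T.isSimplex L hL
  by_contra! hneg
  have hF0 : F.Nonempty := Finset.card_pos.1 (by omega)
  -- points of `L` slightly off the centroid of `F` would be interior points of `K`
  set c := F.centroid ℝ id with hcdef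
  have hpos : 0 < bary K a b := by
    refine lt_of_le_of_ne hneg fun h0 => ?_
    have h1 := grad_opposite sL hFK hFL hc haF hb hbF
    rw [← h0, zero_smul] at h1
    exact grad_ne_zero sK hd ha h1
  have hlim : ∀ e ∈ K, ∀ᶠ t in nhdsWithin (0 : ℝ) (Ioi 0), 0 < bary K e (c + t • (b - c)) := by
    intro e he
    have hform : ∀ t : ℝ, bary K e (c + t • (b - c)) =
        bary K e c + t * (bary K e b - bary K e c) := fun t => by
      rw [bary_eq_add e _ c, bary_sub, add_sub_cancel_left, inner_smul_right]
    by_cases heF : e ∈ F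
    · have h1 : 0 < bary K e c := by
        rw [hcdef, bary_centroid sK hFK hF0, if_pos heF]
        have := hF0.card_pos
        positivity
      have h2 : Filter.Tendsto (fun t : ℝ => bary K e c + t * (bary K e b - bary K e c))
          (nhds 0) (nhds (bary K e c + 0 * (bary K e b - bary K e c))) :=
        Continuous.tendsto (by fun_prop) 0
      rw [zero_mul, add_zero] at h2
      filter_upwards [nhdsWithin_le_nhds (h2.eventually (lt_mem_nhds h1))] with t ht
      rwa [hform]
    · have hea : e = a := by
        obtain ⟨a', -, -, h⟩ := exists_insert_face sK hFK hc
        rw [h e he heF, h a ha haF]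
      subst hea
      filter_upwards [self_mem_nhdsWithin] with t ht
      rw [hform, hcdef, bary_centroid sK hFK hF0, if_neg heF]
      have : (0 : ℝ) < t := ht
      rw [sub_zero, zero_add]
      positivity
  have h3 : ∀ᶠ t in nhdsWithin (0 : ℝ) (Ioi 0), ∀ e ∈ K, 0 < bary K e (c + t • (b - c)) := by
    rw [Filter.eventually_all_finset]
    exact hlim
  have h4 : ∀ᶠ t in nhdsWithin (0 : ℝ) (Ioi 0), t < 1 :=
    nhdsWithin_le_nhds (gt_mem_nhds one_pos)
  obtain ⟨t, ⟨ht, ht1⟩, ht0⟩ := ((h3.and h4).and self_mem_nhdsWithin).exists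
  have ht0 : 0 < t := ht0
  have hcL : c ∈ hull L := by
    rw [mem_hull_iff sL]
    intro e _
    rw [hcdef, bary_centroid sL hFL hF0]
    split_ifs
    all_goals positivity
  have hx : c + t • (b - c) ∈ hull L :=
    (convex_hull L).add_smul_sub_mem hcL (mem_hull_of_mem hb) ⟨ht0.le, ht1.le⟩
  exact Set.disjoint_left.1 (T.disjoint_interior hK hL hKL)
    ((mem_interior_hull_iff sK).2 ht) hx

lemma outwardNormal_opposite (hd : 1 ≤ d) (hK : K ∈ T.cells) (hL : L ∈ T.cells) (hKL : K ≠ L)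
    (hFK : F ⊆ K) (hFL : F ⊆ L) (hc : F.card = d) :
    outwardNormal L F = -outwardNormal K F := by
  have sK := T.isSimplex K hK
  have sL := T.isSimplex L hL
  obtain ⟨a, ha, haF, -⟩ := exists_insert_face sK hFK hc
  obtain ⟨b, hb, hbF, -⟩ := exists_insert_face sL hFL hc
  have h1 := T.bary_opposite_neg hd hK hL hKL hFK hFL hc ha haF hb hbF
  have hg := norm_ne_zero_iff.2 (grad_ne_zero sL hd hb)
  rw [outwardNormal_eq sK hd hFK hc ha haF, outwardNormal_eq sL hd hFL hc hb hbF,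
    grad_opposite sL hFK hFL hc haF hb hbF, norm_smul, Real.norm_of_nonpos h1.le, smul_smul,
    ← neg_smul, ← neg_smul, ← neg_smul]
  congr 1
  have := h1.ne
  field_simp

/-- A face belongs to at most two elements. -/
lemma eq_or_eq_of_mem_cellsAt (hd : 1 ≤ d) (hc : F.card = d) {M : Finset (E d)}
    (hK : K ∈ T.cellsAt F) (hL : L ∈ T.cellsAt F) (hM : M ∈ T.cellsAt F) (hKL : K ≠ L) :
    M = K ∨ M = L := by
  by_contra! hne
  rw [mem_cellsAt] at hK hL hM
  have sK := T.isSimplex K hK.1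
  have sL := T.isSimplex L hL.1
  obtain ⟨a, ha, haF, -⟩ := exists_insert_face sK hK.2 hc
  obtain ⟨b, hb, hbF, -⟩ := exists_insert_face sL hL.2 hc
  obtain ⟨e, he, heF, -⟩ := exists_insert_face (T.isSimplex M hM.1) hM.2 hc
  have h1 := T.bary_opposite_neg hd hK.1 hL.1 hKL hK.2 hL.2 hc ha haF hb hbF
  have h2 := T.bary_opposite_neg hd hK.1 hM.1 hne.1.symm hK.2 hM.2 hc ha haF he heF
  have h3 := T.bary_opposite_neg hd hL.1 hM.1 hne.2.symm hL.2 hM.2 hc hb hbF he heF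
  rw [bary_opposite sL hK.2 hL.2 hc haF hb hbF e] at h2
  nlinarith

lemma cellsAt_eq_pair (hd : 1 ≤ d) (hc : F.card = d) [DecidableEq (Finset (E d))]
    (hK : K ∈ T.cellsAt F) (hL : L ∈ T.cellsAt F) (hKL : K ≠ L) : T.cellsAt F = {K, L} := by
  ext M
  rw [Finset.mem_insert, Finset.mem_singleton]
  constructor
  · exact fun hM => T.eq_or_eq_of_mem_cellsAt hd hc hK hL hM hKL
  · rintro (rfl | rfl)
    exacts [hK, hL]

lemma cellsAt_eq_singleton (hF : F ∈ T.faces) (hFi : F ∉ T.interiorFaces) (hK : K ∈ T.cellsAt F) :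
    T.cellsAt F = {K} := by
  ext M
  rw [Finset.mem_singleton]
  constructor
  · intro hM
    by_contra hne
    exact hFi (T.mem_interiorFaces.2 ⟨T.card_of_mem_faces hF, M, hM, K, hK, hne⟩)
  · rintro rfl
    exact hK

/-- A face of only one element does not meet the (open) domain. -/
lemma disjoint_boundaryFace (hd : 1 ≤ d) (hΩ : IsOpen Ω) (hF : F ∈ T.faces)
    (hFi : F ∉ T.interiorFaces) : Disjoint (hull F) Ω := by
  obtain ⟨K, hK, hFK, hc⟩ := T.mem_faces.1 hF
  have sK := T.isSimplex K hK
  have hF0 : F.Nonempty := Finset.card_pos.1 (by omega)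
  obtain ⟨a, ha, haF, -⟩ := exists_insert_face sK hFK hc
  rw [Set.disjoint_left]
  intro y hy hyΩ
  set c := F.centroid ℝ id with hcdef
  -- move to a point `x` of the relative interior of `F`
  obtain ⟨x, hxF, hxpos, hxΩ⟩ : ∃ x ∈ hull F, (∀ e ∈ F, 0 < bary K e x) ∧ x ∈ Ω := by
    have hcF : c ∈ hull F := by
      rw [mem_hull_face_iff sK hFK]
      constructor
      · intro e _
        rw [hcdef, bary_centroid sK hFK hF0]
        split_ifs
        all_goals positivity
      · intro e _ he
        rw [hcdef, bary_centroid sK hFK hF0, if_neg he]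
    have h2 : Filter.Tendsto (fun t : ℝ => y + t • (c - y)) (nhds 0)
        (nhds (y + (0 : ℝ) • (c - y))) := Continuous.tendsto (by fun_prop) 0
    rw [zero_smul, add_zero] at h2
    have h3 : ∀ᶠ t in nhdsWithin (0 : ℝ) (Ioi 0), y + t • (c - y) ∈ Ω :=
      nhdsWithin_le_nhds (h2.eventually (hΩ.mem_nhds hyΩ))
    have h4 : ∀ᶠ t in nhdsWithin (0 : ℝ) (Ioi 0), t < 1 :=
      nhdsWithin_le_nhds (gt_mem_nhds one_pos)
    obtain ⟨t, ⟨ht, ht1⟩, ht0⟩ := ((h3.and h4).and self_mem_nhdsWithin).exists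
    have ht0 : 0 < t := ht0
    refine ⟨_, (convex_hull F).add_smul_sub_mem hy hcF ⟨ht0.le, ht1.le⟩, ?_, ht⟩
    intro e he
    rw [bary_eq_add e _ y, add_sub_cancel_left, inner_smul_right, ← bary_sub, hcdef,
      bary_centroid sK hFK hF0, if_pos he]
    have h5 := ((mem_hull_face_iff sK hFK).1 hy).1 e he
    have h6 : (0 : ℝ) < (F.card : ℝ)⁻¹ := by
      have := hF0.card_pos
      positivity
    nlinarith
  -- points beyond `F` near `x` belong to other elements, and so does `x`
  have hxa : bary K a x = 0 := ((mem_hull_face_iff sK hFK).1 hxF).2 a ha haF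
  have hxC : x ∈ ⋃ L ∈ T.cells.erase K, hull L := by
    have hcl : IsClosed (⋃ L ∈ T.cells.erase K, hull L) :=
      Set.Finite.isClosed_biUnion (Finset.finite_toSet _) fun L _ => isClosed_hull L
    have h2 : Filter.Tendsto (fun t : ℝ => x - t • grad K a) (nhdsWithin 0 (Ioi 0)) (nhds x) := by
      have : Filter.Tendsto (fun t : ℝ => x - t • grad K a) (nhds 0)
          (nhds (x - (0 : ℝ) • grad K a)) := Continuous.tendsto (by fun_prop) 0
      rw [zero_smul, sub_zero] at this
      exact this.mono_left nhdsWithin_le_nhds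
    refine hcl.mem_of_tendsto h2 ?_
    filter_upwards [h2.eventually (hΩ.mem_nhds hxΩ), self_mem_nhdsWithin] with t htΩ ht0
    have h3 : x - t • grad K a ∈ ⋃ L ∈ T.cells, hull L := by
      rw [T.cover]; exact subset_closure htΩ
    obtain ⟨L, hL, hxL⟩ := Set.mem_iUnion₂.1 h3
    refine Set.mem_iUnion₂.2 ⟨L, Finset.mem_erase.2 ⟨?_, hL⟩, hxL⟩
    intro hLK
    rw [hLK] at hxL
    have h4 := (mem_hull_iff sK).1 hxL a ha
    rw [bary_eq_add a _ x, hxa, sub_sub_cancel_left, inner_neg_right, inner_smul_right,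
      real_inner_self_eq_norm_sq] at h4
    have h5 := norm_pos_iff.2 (grad_ne_zero sK hd ha)
    have h6 : (0 : ℝ) < t := ht0
    have : 0 < t * ‖grad K a‖ ^ 2 := by positivity
    linarith
  obtain ⟨L, hL, hxL⟩ := Set.mem_iUnion₂.1 hxC
  obtain ⟨hLK, hL⟩ := Finset.mem_erase.1 hL
  refine hFi (T.mem_interiorFaces.2 ⟨hc, K, T.mem_cellsAt.2 ⟨hK, hFK⟩, L,
    T.mem_cellsAt.2 ⟨hL, ?_⟩, hLK.symm⟩)
  intro e he
  by_contra heL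
  classical
  have h7 : x ∈ hull (K.filter (· ∈ L)) :=
    T.mem_hull_of_mem_of_mem hK hL (fun a ha ha' => Finset.mem_filter.2 ⟨ha, ha'⟩)
      (hull_mono hFK hxF) hxL
  have h8 := ((mem_hull_face_iff sK (Finset.filter_subset _ _)).1 h7).2 e (hFK he)
    (by simp [heL])
  have := hxpos e he
  linarith

end Mesh

/-! ### Integration over a mesh -/

lemma IsPolyhedralDomain.isOpen {Ω : Set (E d)} (h : IsPolyhedralDomain Ω) : IsOpen Ω := by
  obtain ⟨-, S, -, rfl⟩ := h
  exact isOpen_interior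

lemma IsPolyhedralDomain.volume_closure_diff {Ω : Set (E d)} (h : IsPolyhedralDomain Ω) :
    volume (closure Ω \ Ω) = 0 := by
  obtain ⟨-, S, -, rfl⟩ := h
  set U := ⋃ K ∈ S, hull K with hU
  have hcl : IsClosed U := Set.Finite.isClosed_biUnion (Finset.finite_toSet _)
    fun L _ => isClosed_hull L
  have h1 : closure (interior U) \ interior U ⊆ ⋃ K ∈ S, frontier (hull K) := by
    rintro x ⟨hx, hxi⟩
    have hxU : x ∈ U := closure_minimal interior_subset hcl hx
    obtain ⟨K, hK, hxK⟩ := Set.mem_iUnion₂.1 hxU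
    refine Set.mem_iUnion₂.2 ⟨K, hK, ?_⟩
    rw [(isClosed_hull K).frontier_eq]
    exact ⟨hxK, fun hi => hxi (interior_mono (Set.subset_biUnion_of_mem hK) hi)⟩
  refine measure_mono_null h1 ?_
  refine (measure_biUnion_null_iff (Finset.countable_toSet S)).2 ?_
  exact fun K _ => (convex_hull K).addHaar_frontier volume

lemma restrict_biUnion_finset_of_null {α ι : Type*} [MeasurableSpace α] {μ : Measure α}
    [DecidableEq ι] (s : Finset ι) (f : ι → Set α) (hm : ∀ i ∈ s, MeasurableSet (f i))
    (h0 : ∀ i ∈ s, ∀ j ∈ s, i ≠ j → μ (f i ∩ f j) = 0) :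
    μ.restrict (⋃ i ∈ s, f i) = ∑ i ∈ s, μ.restrict (f i) := by
  induction s using Finset.induction_on with
  | empty => simp
  | insert i s hi ih =>
    rw [Finset.set_biUnion_insert, Measure.restrict_union₀, Finset.sum_insert hi, ih]
    · exact fun j hj => hm j (Finset.mem_insert_of_mem hj)
    · exact fun j hj k hk => h0 j (Finset.mem_insert_of_mem hj) k (Finset.mem_insert_of_mem hk)
    · rw [AEDisjoint, Set.inter_iUnion₂]
      refine (measure_biUnion_null_iff (Finset.countable_toSet s)).2 ?_
      intro j hj
      exact h0 i (Finset.mem_insert_self _ _) j (Finset.mem_insert_of_mem hj)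
        (by rintro rfl; exact hi hj)
    · exact (Finset.measurableSet_biUnion s
        fun j hj => hm j (Finset.mem_insert_of_mem hj)).nullMeasurableSet

namespace Mesh

variable {Ω : Set (E d)} (T : Mesh Ω)

/-- Integrals over `Ω` are sums over the elements: these overlap in null sets, and `∂Ω` has
measure zero. -/
lemma restrict_domain (hΩ : IsPolyhedralDomain Ω) :
    volume.restrict Ω = ∑ K ∈ T.cells, volume.restrict (hull K) := by
  classical
  rw [← restrict_biUnion_finset_of_null T.cells hull (fun K _ => measurableSet_hull K)
    (fun K hK L hL hKL => T.volume_inter_eq_zero hK hL hKL), T.cover]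
  refine Measure.restrict_congr_set ?_
  refine (ae_eq_set (s := Ω) (t := closure Ω)).2 ⟨?_, hΩ.volume_closure_diff⟩
  rw [Set.sdiff_eq_empty.2 subset_closure, measure_empty]

lemma integral_domain (hΩ : IsPolyhedralDomain Ω) {M : Type*} [NormedAddCommGroup M]
    [NormedSpace ℝ M] {f : E d → M} (hf : ∀ K ∈ T.cells, IntegrableOn f (hull K)) :
    ∫ x in Ω, f x = ∑ K ∈ T.cells, ∫ x in hull K, f x := by
  rw [T.restrict_domain hΩ]
  exact integral_finsetSum_measure hf

lemma hull_subset_closure (hK : K ∈ T.cells) : hull K ⊆ closure Ω := by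
  rw [← T.cover]
  exact Set.subset_biUnion_of_mem (u := fun K => hull K) hK

lemma isBounded_domain (T : Mesh Ω) : Bornology.IsBounded (closure Ω) := by
  rw [← T.cover]
  exact (Bornology.isBounded_biUnion_finset T.cells).2 fun K _ => (isCompact_hull K).isBounded

lemma size_le_diam (hK : K ∈ T.cells) : size K ≤ Metric.diam (closure Ω) :=
  Metric.diam_mono (T.hull_subset_closure hK) T.isBounded_domain

/-! ### Shape-regular meshes -/

lemma size_le_mul_inscribedDiam (hd : 1 ≤ d) {σ : ℝ} (hσ : T.ShapeRegular σ)
    (hK : K ∈ T.cells) : size K ≤ σ * inscribedDiam K := by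
  have := hσ K hK
  rwa [div_le_iff₀ (inscribedDiam_pos (T.isSimplex K hK) hd)] at this

lemma inscribedDiam_le_size_cell (hd : 1 ≤ d) (hK : K ∈ T.cells) : inscribedDiam K ≤ size K :=
  inscribedDiam_le_size (T.isSimplex K hK) (Finset.Subset.refl _)
    (by rw [(T.isSimplex K hK).1]; omega)

lemma one_le_of_shapeRegular (hd : 1 ≤ d) {σ : ℝ} (hσ : T.ShapeRegular σ)
    (hK : K ∈ T.cells) : 1 ≤ σ := by
  have h1 := T.size_le_mul_inscribedDiam hd hσ hK
  have h2 := T.inscribedDiam_le_size_cell hd hK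
  have h3 := inscribedDiam_pos (T.isSimplex K hK) hd
  by_contra! h
  nlinarith

/-- In a shape-regular mesh an element is comparable to its edges and faces. -/
lemma size_le_mul_size (hd : 1 ≤ d) {σ : ℝ} (hσ : T.ShapeRegular σ)
    (hK : K ∈ T.cells) (hF : F ⊆ K) (h2 : 2 ≤ F.card) : size K ≤ σ * size F := by
  have h1 := T.size_le_mul_inscribedDiam hd hσ hK
  have h3 := T.one_le_of_shapeRegular hd hσ hK
  have h4 := inscribedDiam_le_size (T.isSimplex K hK) hF h2
  nlinarith

end Mesh

/-- The number of points of the unit ball with given mutual distance is bounded. -/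
lemma exists_card_le_of_separated (d : ℕ) (δ : ℝ) (hδ : 0 < δ) :
    ∃ N : ℕ, ∀ s : Finset (E d), (∀ x ∈ s, ‖x‖ ≤ 1) →
      (∀ x ∈ s, ∀ y ∈ s, x ≠ y → δ ≤ ‖x - y‖) → s.card ≤ N := by
  obtain ⟨t, -, ht, hcov⟩ := (isCompact_closedBall (0 : E d) 1).finite_cover_balls
    (e := δ / 2) (by positivity)
  refine ⟨ht.toFinset.card, fun s h1 h2 => ?_⟩
  have h3 : ∀ x ∈ s, ∃ y ∈ ht.toFinset, dist x y < δ / 2 := by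
    intro x hx
    obtain ⟨y, hy, hxy⟩ := Set.mem_iUnion₂.1 (hcov (show x ∈ Metric.closedBall (0 : E d) 1 by
      simpa using h1 x hx))
    exact ⟨y, by simpa using hy, hxy⟩
  choose! f hf hfd using h3
  refine Finset.card_le_card_of_injOn f hf fun x hx y hy hxy => ?_
  by_contra hne
  have h4 := h2 x hx y hy hne
  have h5 := hfd x hx
  have h6 := hfd y hy
  rw [← hxy] at h6
  have h7 := dist_triangle_right x y (f x)
  rw [← dist_eq_norm] at h4
  linarith

/-- In a shape-regular mesh the number of elements with a common vertex is bounded. -/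
lemma exists_card_cellsAt_le (hd : 1 ≤ d) (σ : ℝ) : ∃ N : ℕ, ∀ (Ω : Set (E d)) (T : Mesh Ω),
    T.ShapeRegular σ → ∀ F : Finset (E d), F.Nonempty → (T.cellsAt F).card ≤ N := by
  by_cases hσ1 : 1 ≤ σ
  swap
  · refine ⟨0, fun Ω T hσ F _ => ?_⟩
    rw [Nat.le_zero, Finset.card_eq_zero, Finset.eq_empty_iff_forall_notMem]
    intro K hK
    exact hσ1 (T.one_le_of_shapeRegular hd hσ (T.mem_cellsAt.1 hK).1)
  obtain ⟨N, hN⟩ := exists_card_le_of_separated d (1 / (4 * σ)) (by positivity)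
  refine ⟨N, fun Ω T hσ F ⟨p, hp⟩ => ?_⟩
  classical
  rcases (T.cellsAt F).eq_empty_or_nonempty with h0 | h0
  · simp [h0]
  obtain ⟨K₀, hK₀, hmin⟩ := Finset.exists_min_image (T.cellsAt F) size h0
  set r := size K₀ with hr
  have hpos : ∀ K ∈ T.cellsAt F, 0 < size K := fun K hK =>
    size_pos (T.isSimplex K (T.mem_cellsAt.1 hK).1) hd (Finset.Subset.refl _)
      (by rw [(T.isSimplex K (T.mem_cellsAt.1 hK).1).1]; omega)
  have hr0 : 0 < r := hpos K₀ hK₀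
  -- every element at `p` contains a ball of radius `r / (4 σ)` in the ball of radius `r` about `p`
  have hball : ∀ K ∈ T.cellsAt F, ∃ y : E d, ‖y‖ ≤ 1 ∧
      ∀ z : E d, ‖z - y‖ ≤ 1 / (4 * σ) → p + r • z ∈ hull K := by
    intro K hK
    have hKc := (T.mem_cellsAt.1 hK).1
    have hpK : p ∈ hull K := mem_hull_of_mem ((T.mem_cellsAt.1 hK).2 hp)
    obtain ⟨c, hc⟩ := exists_closedBall_subset (T.isSimplex K hKc) hd
    have hsz := hpos K hK
    have hi := inscribedDiam_pos (T.isSimplex K hKc) hd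
    have hcK : c ∈ hull K := hc (Metric.mem_closedBall_self (by positivity))
    refine ⟨(size K)⁻¹ • (c - p), ?_, fun z hz => ?_⟩
    · rw [norm_smul, norm_inv, Real.norm_of_nonneg hsz.le, inv_mul_le_iff₀ hsz, mul_one]
      exact dist_le_size hcK hpK
    · have h1 : p + size K • z ∈ hull K := by
        apply hc
        rw [Metric.mem_closedBall, dist_eq_norm]
        have h2 : p + size K • z - c = size K • (z - (size K)⁻¹ • (c - p)) := by
          rw [smul_sub, smul_inv_smul₀ hsz.ne']; abel
        rw [h2, norm_smul, Real.norm_of_nonneg hsz.le]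
        calc size K * ‖z - (size K)⁻¹ • (c - p)‖ ≤ (σ * inscribedDiam K) * (1 / (4 * σ)) :=
              mul_le_mul (T.size_le_mul_inscribedDiam hd hσ hKc) hz (norm_nonneg _) (by positivity)
          _ = inscribedDiam K / 4 := by field_simp
      have h3 : p + r • z = p + (r / size K) • ((p + size K • z) - p) := by
        rw [add_sub_cancel_left, smul_smul, div_mul_cancel₀ _ hsz.ne']
      rw [h3]
      exact (convex_hull K).add_smul_sub_mem hpK h1
        ⟨by positivity, (div_le_one hsz).2 (hmin K hK)⟩
  choose! y hy1 hy2 using hball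
  have hsep : ∀ K ∈ T.cellsAt F, ∀ L ∈ T.cellsAt F, K ≠ L → 1 / (4 * σ) ≤ ‖y K - y L‖ := by
    intro K hK L hL hKL
    by_contra! hlt
    -- otherwise the center of the ball in `K` would be an interior point of `K` and lie in `L`
    have hdis := Set.disjoint_left.1 (T.disjoint_interior (T.mem_cellsAt.1 hK).1
      (T.mem_cellsAt.1 hL).1 hKL)
    refine @hdis (p + r • y K) ?_ (hy2 L hL _ hlt.le)
    rw [mem_interior_iff_mem_nhds, Metric.mem_nhds_iff]
    refine ⟨r * (1 / (4 * σ)), by positivity, fun x hx => ?_⟩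
    have h1 : x = p + r • (r⁻¹ • (x - p)) := by
      rw [smul_inv_smul₀ hr0.ne']; abel
    rw [h1]
    refine hy2 K hK _ ?_
    have h2 : r⁻¹ • (x - p) - y K = r⁻¹ • (x - (p + r • y K)) := by
      rw [← sub_sub, smul_sub r⁻¹ (x - p), inv_smul_smul₀ hr0.ne']
    rw [h2, norm_smul, norm_inv, Real.norm_of_nonneg hr0.le, inv_mul_le_iff₀ hr0,
      ← dist_eq_norm]
    exact (Metric.mem_ball.1 hx).le
  have hinj : Set.InjOn y (T.cellsAt F) := by
    intro K hK L hL hKL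
    by_contra hne
    have := hsep K hK L hL hne
    rw [hKL, sub_self, norm_zero] at this
    have h0 : 0 < 1 / (4 * σ) := by positivity
    linarith
  rw [← Finset.card_image_of_injOn hinj]
  refine hN _ ?_ ?_
  · intro x hx
    obtain ⟨K, hK, rfl⟩ := Finset.mem_image.1 hx
    exact hy1 K hK
  · intro x hx x' hx' hne
    obtain ⟨K, hK, rfl⟩ := Finset.mem_image.1 hx
    obtain ⟨L, hL, rfl⟩ := Finset.mem_image.1 hx'
    exact hsep K hK L hL (by rintro rfl; exact hne rfl)

/-! ### The reference simplex -/

/-- The reference simplex `{s | 0 ≤ s, ∑ sᵢ ≤ 1}` in `ℝⁿ`. -/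
def refSimplex (n : ℕ) : Set (Fin n → ℝ) := {s | (∀ i, 0 ≤ s i) ∧ ∑ i, s i ≤ 1}

/-- The `n + 1` barycentric coordinates on the reference simplex, the first one belonging to the
origin. -/
def refBary {n : ℕ} (s : Fin n → ℝ) : Fin (n + 1) → ℝ := Fin.cons (1 - ∑ i, s i) s

/-- The affine map from the reference simplex to the simplex with vertices `b i`. -/
def simplexPt {n : ℕ} (b : Fin (n + 1) → E d) (s : Fin n → ℝ) : E d :=
  ∑ i, refBary s i • b i

lemma sum_refBary {n : ℕ} (s : Fin n → ℝ) : ∑ i, refBary s i = 1 := by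
  simp [refBary, Fin.sum_univ_succ]

lemma mem_refSimplex_iff {n : ℕ} {s : Fin n → ℝ} : s ∈ refSimplex n ↔ ∀ i, 0 ≤ refBary s i := by
  rw [Fin.forall_fin_succ]
  simp [refSimplex, refBary, and_comm]

lemma continuous_refBary {n : ℕ} (i : Fin (n + 1)) :
    Continuous fun s : Fin n → ℝ => refBary s i := by
  refine Fin.cases ?_ (fun j => ?_) i
  · simp only [refBary, Fin.cons_zero]
    fun_prop
  · simp only [refBary, Fin.cons_succ]
    fun_prop

lemma continuous_simplexPt {n : ℕ} (b : Fin (n + 1) → E d) : Continuous (simplexPt b) :=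
  continuous_finsetSum _ fun i _ => (continuous_refBary i).smul continuous_const

lemma isCompact_refSimplex (n : ℕ) : IsCompact (refSimplex n) := by
  have hcl : IsClosed (refSimplex n) := by
    have : refSimplex n = ⋂ i, {s | 0 ≤ refBary s i} := by
      ext s; simp [mem_refSimplex_iff]
    rw [this]
    exact isClosed_iInter fun i => isClosed_le continuous_const (continuous_refBary i)
  refine IsCompact.of_isClosed_subset
    (isCompact_univ_pi fun _ : Fin n => isCompact_Icc (a := (0 : ℝ)) (b := 1)) hcl ?_
  rintro s ⟨h0, h1⟩ i -
  exact ⟨h0 i, (Finset.single_le_sum (fun i _ => h0 i) (Finset.mem_univ i)).trans h1⟩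

lemma measurableSet_refSimplex (n : ℕ) : MeasurableSet (refSimplex n) :=
  (isCompact_refSimplex n).isClosed.measurableSet

/-- The interior of the reference simplex. -/
def refInterior (n : ℕ) : Set (Fin n → ℝ) := {s | ∀ i, 0 < refBary s i}

lemma isOpen_refInterior (n : ℕ) : IsOpen (refInterior n) := by
  have : refInterior n = ⋂ i, {s | 0 < refBary s i} := by
    ext s; simp [refInterior]
  rw [this]
  exact isOpen_iInter_of_finite fun i => isOpen_lt continuous_const (continuous_refBary i)

lemma refInterior_subset (n : ℕ) : refInterior n ⊆ refSimplex n :=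
  fun _ hs => mem_refSimplex_iff.2 fun i => (hs i).le

lemma refInterior_nonempty (n : ℕ) : (refInterior n).Nonempty := by
  refine ⟨fun _ => 1 / (n + 1), fun i => ?_⟩
  refine Fin.cases ?_ (fun j => ?_) i
  · simp only [refBary, Fin.cons_zero, Finset.sum_const, Finset.card_univ, Fintype.card_fin,
      nsmul_eq_mul]
    have : (n : ℝ) * (1 / (n + 1)) < 1 := by
      rw [mul_one_div, div_lt_one (by positivity)]; linarith
    linarith
  · simp only [refBary, Fin.cons_succ]
    positivity

lemma volume_refSimplex_pos (n : ℕ) : 0 < volume (refSimplex n) :=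
  lt_of_lt_of_le ((isOpen_refInterior n).measure_pos _ (refInterior_nonempty n))
    (measure_mono (refInterior_subset n))

lemma volume_refSimplex_ne_top (n : ℕ) : volume (refSimplex n) ≠ ⊤ :=
  (isCompact_refSimplex n).measure_ne_top

lemma measureReal_refSimplex_pos (n : ℕ) : 0 < volume.real (refSimplex n) :=
  ENNReal.toReal_pos (volume_refSimplex_pos n).ne' (volume_refSimplex_ne_top n)

lemma mem_hull_of_refSimplex {n : ℕ} {b : Fin (n + 1) → E d} (hb : ∀ i, b i ∈ F)
    {s : Fin n → ℝ} (hs : s ∈ refSimplex n) : simplexPt b s ∈ hull F :=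
  (convex_hull F).sum_mem (fun i _ => mem_refSimplex_iff.1 hs i) (sum_refBary s)
    fun i _ => mem_hull_of_mem (hb i)

lemma image_enum [DecidableEq (E d)] {n : ℕ} {b : Fin n → E d} (hb : ∀ i, b i ∈ F)
    (hinj : Function.Injective b) (hc : F.card = n) : Finset.univ.image b = F := by
  refine Finset.eq_of_subset_of_card_le ?_ ?_
  · intro x hx
    obtain ⟨i, -, rfl⟩ := Finset.mem_image.1 hx
    exact hb i
  · rw [Finset.card_image_of_injective _ hinj, hc]; simp

lemma image_simplexPt {n : ℕ} {b : Fin (n + 1) → E d} (hb : ∀ i, b i ∈ F)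
    (hinj : Function.Injective b) (hc : F.card = n + 1) :
    simplexPt b '' refSimplex n = hull F := by
  classical
  have himg := image_enum hb hinj hc
  apply Subset.antisymm
  · rintro _ ⟨s, hs, rfl⟩
    exact mem_hull_of_refSimplex hb hs
  · intro x hx
    obtain ⟨w, h0, h1, rfl⟩ := mem_hull_iff_exists.1 hx
    rw [← himg, Finset.sum_image hinj.injOn] at h1
    have h2 : refBary (fun i : Fin n => w (b i.succ)) = fun i => w (b i) := by
      ext i
      refine Fin.cases ?_ (fun j => ?_) i
      · simp only [refBary, Fin.cons_zero]
        rw [Fin.sum_univ_succ] at h1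
        linarith
      · simp [refBary]
    refine ⟨fun i => w (b i.succ), ?_, ?_⟩
    · rw [mem_refSimplex_iff, h2]
      exact fun i => h0 _ (hb i)
    · rw [simplexPt, h2, ← himg, Finset.sum_image hinj.injOn]

/-- Affine change of variables, up to a constant. -/
lemma exists_integral_affine_image {V W : Type*} [NormedAddCommGroup V] [NormedSpace ℝ V]
    [FiniteDimensional ℝ V] [MeasurableSpace V] [BorelSpace V] [NormedAddCommGroup W]
    [NormedSpace ℝ W] [FiniteDimensional ℝ W] [MeasurableSpace W] [BorelSpace W]
    (μ : Measure V) [μ.IsAddHaarMeasure] (ν : Measure W) [ν.IsAddHaarMeasure]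
    (A : V ≃L[ℝ] W) (w₀ : W) :
    ∃ c : ℝ, ∀ (S : Set V) (f : W → ℝ),
      ∫ x in (fun v => A v + w₀) '' S, f x ∂ν = c * ∫ v in S, f (A v + w₀) ∂μ := by
  have h1 : ν = (Measure.addHaarScalarFactor ν (μ.map A)) • μ.map A :=
    Measure.isAddLeftInvariant_eq_smul _ _
  set c := Measure.addHaarScalarFactor ν (μ.map A)
  have h2 : ν = c • μ.map (fun v => A v + w₀) := by
    have h3 : (μ.map A).map (fun w => w + w₀) = μ.map (fun v => A v + w₀) :=
      Measure.map_map (by fun_prop) (by fun_prop)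
    rw [← h3, map_add_right_eq_self]
    exact h1
  refine ⟨c, fun S f => ?_⟩
  have hemb : MeasurableEmbedding (fun v => A v + w₀) :=
    (A.toHomeomorph.trans (Homeomorph.addRight w₀)).measurableEmbedding
  rw [h2, Measure.restrict_smul, integral_smul_nnreal_measure, hemb.setIntegral_map,
    hemb.injective.preimage_image]
  rfl

/-! ### Integrals over faces -/

/-- The differential of `refBary`. -/
def refBaryLinear (n : ℕ) : (Fin n → ℝ) →ₗ[ℝ] (Fin (n + 1) → ℝ) where
  toFun s := Fin.cons (-∑ i, s i) s
  map_add' s t := by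
    ext i
    refine Fin.cases ?_ (fun j => ?_) i
    · simp [Finset.sum_add_distrib, add_comm]
    · simp
  map_smul' c s := by
    ext i
    refine Fin.cases ?_ (fun j => ?_) i
    · simp [Finset.mul_sum]
    · simp

lemma refBaryLinear_succ {n : ℕ} (s : Fin n → ℝ) (j : Fin n) :
    refBaryLinear n s j.succ = s j := rfl

lemma sum_refBaryLinear {n : ℕ} (s : Fin n → ℝ) : ∑ i, refBaryLinear n s i = 0 := by
  simp [refBaryLinear, Fin.sum_univ_succ]

lemma refBary_eq {n : ℕ} (s : Fin n → ℝ) : refBary s = refBaryLinear n s + Pi.single 0 1 := by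
  ext i
  refine Fin.cases ?_ (fun j => ?_) i
  · simp [refBary, refBaryLinear]; ring
  · simp [refBary, refBaryLinear]

lemma refBaryLinear_comp {n : ℕ} (f : Fin (n + 1) → ℝ) (hf : ∑ i, f i = 0) :
    refBaryLinear n (fun j => f j.succ) = f := by
  ext i
  refine Fin.cases ?_ (fun j => ?_) i
  · rw [Fin.sum_univ_succ] at hf
    simp only [refBaryLinear, LinearMap.coe_mk, AddHom.coe_mk, Fin.cons_zero]
    linarith
  · rfl

/-- The affine self-map of the reference simplex permuting its vertices (linear part). -/
def refPermLinear {n : ℕ} (τ : Equiv.Perm (Fin (n + 1))) : (Fin n → ℝ) ≃ₗ[ℝ] (Fin n → ℝ) where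
  toFun s j := refBaryLinear n s (τ j.succ)
  invFun s j := refBaryLinear n s (τ.symm j.succ)
  map_add' s t := by ext j; simp
  map_smul' c s := by ext j; simp
  left_inv s := by
    ext j
    have h := refBaryLinear_comp (fun i => refBaryLinear n s (τ i))
      (by rw [Equiv.sum_comp τ (refBaryLinear n s)]; exact sum_refBaryLinear s)
    simp only [h, Equiv.apply_symm_apply, refBaryLinear_succ]
  right_inv s := by
    ext j
    have h := refBaryLinear_comp (fun i => refBaryLinear n s (τ.symm i))
      (by rw [Equiv.sum_comp τ.symm (refBaryLinear n s)]; exact sum_refBaryLinear s)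
    simp only [h, Equiv.symm_apply_apply, refBaryLinear_succ]

/-- The integral over a simplex with respect to its parametrization over the reference simplex does
not depend on the order of the vertices: an affine self-map of the reference simplex preserves
its volume, hence every volume. -/
lemma integral_simplexPt_perm {n : ℕ} (b : Fin (n + 1) → E d) (τ : Equiv.Perm (Fin (n + 1)))
    (g : E d → ℝ) :
    ∫ s in refSimplex n, g (simplexPt (b ∘ τ.symm) s) = ∫ s in refSimplex n, g (simplexPt b s) := by
  set w₀ : Fin n → ℝ := fun j => (Pi.single 0 1 : Fin (n + 1) → ℝ) (τ j.succ)
  set T : (Fin n → ℝ) → (Fin n → ℝ) :=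
    fun s => (refPermLinear τ).toContinuousLinearEquiv s + w₀ with hT
  have hbary : ∀ s, refBary (T s) = fun i => refBary s (τ i) := by
    intro s
    have h1 : T s = fun j : Fin n => refBary s (τ j.succ) := by
      ext j
      rw [refBary_eq]
      rfl
    have h2 := Equiv.sum_comp τ (refBary s)
    rw [sum_refBary, Fin.sum_univ_succ] at h2
    rw [h1]
    ext i
    refine Fin.cases ?_ (fun j => ?_) i
    · simp only [refBary, Fin.cons_zero]
      change 1 - ∑ j : Fin n, refBary s (τ j.succ) = refBary s (τ 0)
      linarith
    · simp [refBary]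
  have hTinj : Function.Injective T := fun s t hst => by
    simpa [hT] using hst
  have himg : T '' refSimplex n = refSimplex n := by
    apply Subset.antisymm
    · rintro _ ⟨s, hs, rfl⟩
      rw [mem_refSimplex_iff, hbary]
      exact fun i => mem_refSimplex_iff.1 hs _
    · intro s hs
      obtain ⟨s', hs'⟩ : ∃ s', T s' = s := by
        refine ⟨(refPermLinear τ).symm (s - w₀), ?_⟩
        simp [hT]
      refine ⟨s', ?_, hs'⟩
      rw [mem_refSimplex_iff]
      intro i
      have h3 := mem_refSimplex_iff.1 hs (τ.symm i)
      rw [← hs', hbary] at h3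
      simpa using h3
  obtain ⟨c, hc⟩ := exists_integral_affine_image (volume : Measure (Fin n → ℝ))
    (volume : Measure (Fin n → ℝ)) (refPermLinear τ).toContinuousLinearEquiv w₀
  have hc1 : c = 1 := by
    have h1 := hc (refSimplex n) (fun _ => 1)
    change ∫ x in T '' refSimplex n, (1 : ℝ) = _ at h1
    rw [himg, setIntegral_const, smul_eq_mul, mul_one] at h1
    have h2 := measureReal_refSimplex_pos n
    exact mul_right_cancel₀ h2.ne' (by rw [← h1, one_mul])
  have h4 := hc (refSimplex n) (fun s => g (simplexPt b s))
  change ∫ s in T '' refSimplex n, g (simplexPt b s) = _ at h4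
  rw [himg, hc1, one_mul] at h4
  rw [h4]
  congr 1
  ext s
  congr 1
  change _ = simplexPt b (T s)
  rw [simplexPt, simplexPt, hbary, ← Equiv.sum_comp τ]
  simp

/-- The integral of `g` over the face `F` (with `n + 1` vertices) in the coordinates of the
reference simplex. -/
def faceInt (n : ℕ) (F : Finset (E d)) (g : E d → ℝ) : ℝ :=
  if h : F.card = n + 1 then
    ∫ s in refSimplex n, g (simplexPt (fun i => ((F.equivFinOfCardEq h).symm i : E d)) s)
  else 0

lemma faceInt_eq {n : ℕ} {b : Fin (n + 1) → E d} (hb : ∀ i, b i ∈ F)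
    (hinj : Function.Injective b) (hc : F.card = n + 1) (g : E d → ℝ) :
    faceInt n F g = ∫ s in refSimplex n, g (simplexPt b s) := by
  rw [faceInt, dif_pos hc]
  have hbij : Function.Bijective (fun i => (⟨b i, hb i⟩ : F)) := by
    rw [Fintype.bijective_iff_injective_and_card]
    exact ⟨fun i j h => hinj (congrArg Subtype.val h), by simp [hc]⟩
  set e := Equiv.ofBijective _ hbij
  set τ : Equiv.Perm (Fin (n + 1)) := e.trans (F.equivFinOfCardEq hc)
  rw [← integral_simplexPt_perm b τ]
  congr! 5 with s i
  simp only [Function.comp, τ, Equiv.symm_trans_apply]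
  exact congrArg Subtype.val (e.apply_symm_apply ((F.equivFinOfCardEq hc).symm i)).symm

lemma faceInt_congr {n : ℕ} {f g : E d → ℝ} (h : ∀ x ∈ hull F, f x = g x) :
    faceInt n F f = faceInt n F g := by
  rw [faceInt, faceInt]
  split_ifs with hc
  · refine setIntegral_congr_fun (measurableSet_refSimplex n) fun s hs => h _ ?_
    exact mem_hull_of_refSimplex (fun i => Subtype.coe_prop _) hs
  · rfl

lemma faceInt_sum {n : ℕ} {ι : Type*} (s : Finset ι) {f : ι → E d → ℝ}
    (hf : ∀ i ∈ s, Continuous (f i)) :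
    faceInt n F (fun x => ∑ i ∈ s, f i x) = ∑ i ∈ s, faceInt n F (f i) := by
  simp only [faceInt]
  split_ifs with hc
  · refine integral_finsetSum _ fun i hi => ?_
    exact (((hf i hi).comp (continuous_simplexPt _)).continuousOn.integrableOn_compact
      (isCompact_refSimplex n))
  · simp

lemma faceInt_const_mul {n : ℕ} (c : ℝ) (f : E d → ℝ) :
    faceInt n F (fun x => c * f x) = c * faceInt n F f := by
  simp only [faceInt]
  split_ifs with hc
  · exact integral_const_mul _ _
  · simp

/-! ### The fundamental theorem of calculus on the reference simplex -/

lemma insertNth_mem_refSimplex {n : ℕ} (j : Fin (n + 1)) (t : ℝ) (s : Fin n → ℝ) :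
    j.insertNth (α := fun _ => ℝ) t s ∈ refSimplex (n + 1) ↔
      s ∈ refSimplex n ∧ t ∈ Icc 0 (1 - ∑ i, s i) := by
  simp only [refSimplex, mem_ofPred_eq, Fin.forall_iff_succAbove j, Fin.insertNth_apply_same,
    Fin.insertNth_apply_succAbove, Fin.sum_univ_succAbove _ j, mem_Icc]
  constructor
  · rintro ⟨⟨h0, h1⟩, h2⟩
    exact ⟨⟨h1, by linarith⟩, h0, by linarith⟩
  · rintro ⟨⟨h1, h2⟩, h0, h3⟩
    exact ⟨⟨h0, h1⟩, by linarith⟩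

/-- Fubini's theorem in the direction of the coordinate `j` and the fundamental theorem of calculus
on the resulting intervals. -/
lemma integral_refSimplex_partial {n : ℕ} (j : Fin (n + 1)) {G : (Fin (n + 1) → ℝ) → ℝ}
    (hG : ContDiff ℝ 1 G) :
    ∫ s in refSimplex (n + 1), fderiv ℝ G s (Pi.single j 1) =
      ∫ s in refSimplex n, (G (j.insertNth (α := fun _ => ℝ) (1 - ∑ i, s i) s) -
        G (j.insertNth (α := fun _ => ℝ) 0 s)) := by
  have hcont : Continuous fun s => fderiv ℝ G s (Pi.single j 1) :=
    (hG.continuous_fderiv one_ne_zero).clm_apply continuous_const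
  set f := (refSimplex (n + 1)).indicator (fun s => fderiv ℝ G s (Pi.single j 1)) with hf
  have hfi : Integrable f := by
    rw [hf, integrable_indicator_iff (measurableSet_refSimplex _)]
    exact hcont.continuousOn.integrableOn_compact (isCompact_refSimplex _)
  have hmp := (volume_preserving_piFinSuccAbove (fun _ : Fin (n + 1) => ℝ) j).symm
  have hfi2 : Integrable (fun z => f ((MeasurableEquiv.piFinSuccAbove
      (fun _ : Fin (n + 1) => ℝ) j).symm z)) (volume.prod volume) :=
    hmp.integrable_comp_of_integrable hfi
  rw [← integral_indicator (measurableSet_refSimplex _), ← hf,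
    ← hmp.integral_comp (MeasurableEquiv.measurableEmbedding _), Measure.volume_eq_prod,
    integral_prod_symm _ hfi2,
    ← integral_indicator (measurableSet_refSimplex _)]
  congr 1
  ext s
  have hsymm : ∀ t : ℝ, (MeasurableEquiv.piFinSuccAbove (fun _ : Fin (n + 1) => ℝ) j).symm (t, s) =
      j.insertNth (α := fun _ => ℝ) t s := fun t => rfl
  simp only [hsymm]
  by_cases hs : s ∈ refSimplex n
  · rw [Set.indicator_of_mem hs]
    have h0 : 0 ≤ 1 - ∑ i, s i := by linarith [hs.2]
    have h1 : ∀ t : ℝ, f (j.insertNth (α := fun _ => ℝ) t s) = (Icc 0 (1 - ∑ i, s i)).indicator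
        (fun t => fderiv ℝ G (j.insertNth (α := fun _ => ℝ) t s) (Pi.single j 1)) t := by
      intro t
      by_cases ht : t ∈ Icc 0 (1 - ∑ i, s i)
      · rw [Set.indicator_of_mem ht, hf,
          Set.indicator_of_mem ((insertNth_mem_refSimplex j t s).2 ⟨hs, ht⟩)]
      · rw [Set.indicator_of_notMem ht, hf, Set.indicator_of_notMem
          (fun h => ht ((insertNth_mem_refSimplex j t s).1 h).2)]
    simp only [h1]
    rw [integral_indicator measurableSet_Icc, integral_Icc_eq_integral_Ioc,
      ← intervalIntegral.integral_of_le h0]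
    have hline : ∀ t : ℝ, j.insertNth (α := fun _ => ℝ) t s =
        j.insertNth (α := fun _ => ℝ) 0 s + t • (Pi.single j (1 : ℝ) : Fin (n + 1) → ℝ) := by
      intro t
      ext i
      refine Fin.succAboveCases j ?_ (fun i => ?_) i
      · simp
      · simp
    have hd : ∀ t : ℝ, HasDerivAt (fun t : ℝ => j.insertNth (α := fun _ => ℝ) t s)
        (Pi.single j (1 : ℝ) : Fin (n + 1) → ℝ) t := by
      intro t
      have h2 : (fun t : ℝ => j.insertNth (α := fun _ => ℝ) t s) = fun t : ℝ =>
          j.insertNth (α := fun _ => ℝ) 0 s + t • (Pi.single j (1 : ℝ) : Fin (n + 1) → ℝ) :=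
        funext hline
      rw [h2]
      simpa using ((hasDerivAt_id t).smul_const
        (Pi.single j (1 : ℝ) : Fin (n + 1) → ℝ)).const_add (j.insertNth (α := fun _ => ℝ) 0 s)
    have hderiv : ∀ t : ℝ, HasDerivAt (fun t : ℝ => G (j.insertNth (α := fun _ => ℝ) t s))
        (fderiv ℝ G (j.insertNth (α := fun _ => ℝ) t s) (Pi.single j 1)) t := fun t =>
      ((hG.differentiable one_ne_zero).differentiableAt.hasFDerivAt).comp_hasDerivAt t (hd t)
    refine intervalIntegral.integral_eq_sub_of_hasDerivAt (fun t _ => hderiv t) ?_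
    refine Continuous.intervalIntegrable ?_ _ _
    refine hcont.comp ?_
    exact continuous_iff_continuousAt.2 fun t => (hd t).continuousAt
  · rw [Set.indicator_of_notMem hs]
    have h1 : ∀ t : ℝ, f (j.insertNth (α := fun _ => ℝ) t s) = 0 := fun t => by
      rw [hf, Set.indicator_of_notMem (fun h => hs ((insertNth_mem_refSimplex j t s).1 h).1)]
    simp only [h1, integral_zero]

/-! ### The divergence theorem on a simplex -/

lemma sum_enum {n : ℕ} {M : Type*} [AddCommMonoid M] {b : Fin n → E d} (hb : ∀ i, b i ∈ F)
    (hinj : Function.Injective b) (hc : F.card = n) (f : E d → M) :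
    ∑ i, f (b i) = ∑ x ∈ F, f x := by
  classical
  have himg := image_enum hb hinj hc
  rw [← himg, Finset.sum_image hinj.injOn]

lemma exists_enum {n : ℕ} (hc : F.card = n) :
    ∃ b : Fin n → E d, (∀ i, b i ∈ F) ∧ Function.Injective b :=
  ⟨fun i => ((F.equivFinOfCardEq hc).symm i : E d), fun _ => Subtype.coe_prop _,
    fun _ _ h => (F.equivFinOfCardEq hc).symm.injective (Subtype.ext h)⟩

/-- The linear part of the parametrization of a simplex over the reference simplex. -/
def simplexLinear (h : IsSimplex K) (b : Fin (d + 1) → E d) (hb : ∀ i, b i ∈ K)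
    (hinj : Function.Injective b) : (Fin d → ℝ) ≃ₗ[ℝ] E d where
  toFun s := ∑ j, s j • (b j.succ - b 0)
  invFun v j := inner ℝ (grad K (b j.succ)) v
  map_add' s t := by simp [add_smul, Finset.sum_add_distrib]
  map_smul' c s := by simp [Finset.smul_sum, mul_smul]
  left_inv s := by
    ext j
    have h1 : ∀ i : Fin d, inner ℝ (grad K (b j.succ)) (s i • (b i.succ - b 0)) =
        if i = j then s i else 0 := by
      intro i
      rw [inner_smul_right, inner_grad_sub h (hb _) (hb _) (hb _)
        (fun h0 => Fin.succ_ne_zero j (hinj h0).symm)]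
      simp [hinj.eq_iff]
    simp only [inner_sum, h1]
    simp
  right_inv v := by
    have h1 := sum_inner_grad_smul h v (b 0)
    rw [← sum_enum hb hinj h.1, Fin.sum_univ_succ, sub_self, smul_zero, zero_add] at h1
    exact h1

lemma simplexPt_eq_add {n : ℕ} (b : Fin (n + 1) → E d) (s : Fin n → ℝ) :
    simplexPt b s = ∑ j, s j • (b j.succ - b 0) + b 0 := by
  simp only [simplexPt, refBary, Fin.sum_univ_succ, Fin.cons_zero, Fin.cons_succ, smul_sub,
    Finset.sum_sub_distrib, ← Finset.sum_smul, sub_smul, one_smul]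
  abel

/-- The ratio of the volume of a simplex to that of the reference simplex. -/
def volRatio (K : Finset (E d)) : ℝ := volume.real (hull K) / volume.real (refSimplex d)

lemma integral_hull (h : IsSimplex K) {b : Fin (d + 1) → E d} (hb : ∀ i, b i ∈ K)
    (hinj : Function.Injective b) (f : E d → ℝ) :
    ∫ x in hull K, f x = volRatio K * ∫ s in refSimplex d, f (simplexPt b s) := by
  obtain ⟨c, hc⟩ := exists_integral_affine_image (volume : Measure (Fin d → ℝ))
    (volume : Measure (E d)) (simplexLinear h b hb hinj).toContinuousLinearEquiv (b 0)
  have hpt : ∀ s, (simplexLinear h b hb hinj).toContinuousLinearEquiv s + b 0 =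
      simplexPt b s := fun s => (simplexPt_eq_add b s).symm
  simp only [hpt] at hc
  have h1 : ∀ f : E d → ℝ, ∫ x in hull K, f x = c * ∫ s in refSimplex d, f (simplexPt b s) := by
    intro f
    rw [← hc, image_simplexPt hb hinj h.1]
  have h2 : c = volRatio K := by
    have := h1 (fun _ => 1)
    rw [setIntegral_const, setIntegral_const, smul_eq_mul, smul_eq_mul, mul_one, mul_one] at this
    rw [volRatio, this, mul_div_cancel_right₀ _ (measureReal_refSimplex_pos d).ne']
  rw [h1, h2]

open Classical in
/-- The fundamental theorem of calculus on a simplex, in the direction of an edge. -/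
lemma integral_refSimplex_edge {n : ℕ} {K : Finset (E (n + 1))} (h : IsSimplex K)
    {b : Fin (n + 2) → E (n + 1)} (hb : ∀ i, b i ∈ K) (hinj : Function.Injective b)
    {g : E (n + 1) → ℝ} (hg : ContDiff ℝ 1 g) (j : Fin (n + 1)) :
    ∫ s in refSimplex (n + 1), fderiv ℝ g (simplexPt b s) (b j.succ - b 0) =
      faceInt n (K.erase (b 0)) g - faceInt n (K.erase (b j.succ)) g := by
  set A := (simplexLinear h b hb hinj).toContinuousLinearEquiv
  have hpt : simplexPt b = fun s => A s + b 0 := funext fun s => simplexPt_eq_add b s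
  have hAj : A (Pi.single j 1) = b j.succ - b 0 := by
    change ∑ i, (Pi.single j 1 : Fin (n + 1) → ℝ) i • (b i.succ - b 0) = _
    rw [Finset.sum_eq_single j]
    · simp
    · intro i _ hi
      simp [hi]
    · simp
  have hsm : ContDiff ℝ 1 (simplexPt b) := by
    rw [hpt]
    exact A.contDiff.add contDiff_const
  have hder : ∀ s, fderiv ℝ (g ∘ simplexPt b) s (Pi.single j 1) =
      fderiv ℝ g (simplexPt b s) (b j.succ - b 0) := by
    intro s
    have h1 : HasFDerivAt (simplexPt b) (A : (Fin (n + 1) → ℝ) →L[ℝ] E (n + 1)) s := by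
      rw [hpt]
      exact A.hasFDerivAt.add_const _
    have h2 := ((hg.differentiable one_ne_zero) (simplexPt b s)).hasFDerivAt.comp s h1
    rw [h2.fderiv]
    simp [hAj]
  have h1 := integral_refSimplex_partial j (hg.comp hsm)
  simp only [hder] at h1
  rw [h1, integral_sub]
  · congr 1
    · have hcard : (K.erase (b 0)).card = n + 1 := by
        rw [Finset.card_erase_of_mem (hb 0), h.1]; rfl
      rw [faceInt_eq (b := Fin.cons (b j.succ) (fun k => b (j.succAbove k).succ)) _ _ hcard]
      · congr 1
        ext s
        simp only [Function.comp]
        congr 1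
        rw [simplexPt, Fin.sum_univ_succ, Fin.sum_univ_succAbove _ j, simplexPt, Fin.sum_univ_succ]
        simp only [refBary, Fin.cons_zero, Fin.cons_succ, Fin.insertNth_apply_same,
          Fin.insertNth_apply_succAbove, Fin.sum_univ_succAbove _ j]
        simp
      · intro i
        rw [Finset.mem_erase]
        refine Fin.cases ?_ (fun k => ?_) i
        · exact ⟨fun h0 => Fin.succ_ne_zero j (hinj h0), hb _⟩
        · exact ⟨fun h0 => Fin.succ_ne_zero _ (hinj h0), hb _⟩
      · rw [Fin.cons_injective_iff]
        refine ⟨?_, fun k l hkl => ?_⟩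
        · rintro ⟨k, hk⟩
          exact Fin.succAbove_ne j k (Fin.succ_injective _ (hinj hk))
        · exact Fin.succAbove_right_injective (Fin.succ_injective _ (hinj hkl))
    · have hcard : (K.erase (b j.succ)).card = n + 1 := by
        rw [Finset.card_erase_of_mem (hb _), h.1]; rfl
      rw [faceInt_eq (b := fun k => b (j.succ.succAbove k)) _ _ hcard]
      · congr 1
        ext s
        simp only [Function.comp]
        congr 1
        rw [simplexPt, Fin.sum_univ_succAbove _ j.succ, simplexPt, Fin.sum_univ_succ,
          Fin.sum_univ_succ]
        simp only [refBary, Fin.cons_zero, Fin.cons_succ, Fin.insertNth_apply_same,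
          Fin.insertNth_apply_succAbove, Fin.sum_univ_succAbove _ j, Fin.succ_succAbove_zero,
          Fin.succ_succAbove_succ]
        simp
      · intro i
        rw [Finset.mem_erase]
        exact ⟨fun h0 => Fin.succAbove_ne j.succ i (hinj h0), hb _⟩
      · intro k l hkl
        exact Fin.succAbove_right_injective (hinj hkl)
  · refine ContinuousOn.integrableOn_compact (isCompact_refSimplex n) (Continuous.continuousOn ?_)
    refine (hg.continuous.comp (continuous_simplexPt b)).comp ?_
    exact Continuous.finInsertNth j (by fun_prop) continuous_id
  · refine ContinuousOn.integrableOn_compact (isCompact_refSimplex n) (Continuous.continuousOn ?_)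
    refine (hg.continuous.comp (continuous_simplexPt b)).comp ?_
    exact Continuous.finInsertNth j continuous_const continuous_id

open Classical in
/-- The divergence theorem on a simplex. -/
lemma integral_hull_fderiv {n : ℕ} {K : Finset (E (n + 1))} (h : IsSimplex K)
    {g : E (n + 1) → ℝ} (hg : ContDiff ℝ 1 g) (v : E (n + 1)) :
    ∫ x in hull K, fderiv ℝ g x v =
      -(volRatio K * ∑ q ∈ K, inner ℝ (grad K q) v * faceInt n (K.erase q) g) := by
  obtain ⟨b, hb, hinj⟩ := exists_enum h.1
  have h1 : ∑ q ∈ K, inner ℝ (grad K q) v • (q - b 0) = v := sum_inner_grad_smul h v (b 0)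
  rw [← sum_enum hb hinj h.1, Fin.sum_univ_succ, sub_self, smul_zero, zero_add] at h1
  have h2 : ∑ q ∈ K, inner ℝ (grad K q) v = 0 := by
    have h2 : ∀ a, inner ℝ (grad K a) v = bary K a v - bary K a 0 := fun a => by
      rw [bary_sub, sub_zero]
    simp only [h2, Finset.sum_sub_distrib, sum_bary h, sub_self]
  rw [← sum_enum hb hinj h.1, Fin.sum_univ_succ] at h2
  rw [integral_hull h hb hinj, ← mul_neg]
  congr 1
  have h3 : ∀ s, fderiv ℝ g (simplexPt b s) v = ∑ j : Fin (n + 1),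
      inner ℝ (grad K (b j.succ)) v * fderiv ℝ g (simplexPt b s) (b j.succ - b 0) := by
    intro s
    conv_lhs => rw [← h1]
    rw [map_sum]
    simp only [map_smul, smul_eq_mul]
  simp only [h3]
  rw [integral_finsetSum]
  · simp only [integral_const_mul, integral_refSimplex_edge h hb hinj hg]
    rw [← sum_enum hb hinj h.1, Fin.sum_univ_succ (n := n + 1)]
    simp only [mul_sub, Finset.sum_sub_distrib, ← Finset.sum_mul]
    linear_combination faceInt n (K.erase (b 0)) g * h2
  · intro j _
    refine ContinuousOn.integrableOn_compact (isCompact_refSimplex _) (Continuous.continuousOn ?_)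
    exact continuous_const.mul (((hg.continuous_fderiv one_ne_zero).comp
      (continuous_simplexPt b)).clm_apply continuous_const)

/-! ### Areas of common faces -/

/-- The affine map fixing a common face of two simplices and mapping one opposite vertex to the
other gives the ratio of the volumes. -/
lemma volume_opposite (hK : IsSimplex K) (hL : IsSimplex L) (hFK : F ⊆ K) (hFL : F ⊆ L)
    (hc : F.card = d) {a b : E d} (ha : a ∈ K) (haF : a ∉ F) (hb : b ∈ L) (hbF : b ∉ F) :
    volume.real (hull L) = |bary K a b| * volume.real (hull K) := by
  classical
  set f : E d →ₗ[ℝ] E d := LinearMap.transvection (bary K a).linear (b - a) with hf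
  set w₀ : E d := bary K a 0 • (b - a)
  set Φ : E d →ᵃ[ℝ] E d := f.toAffineMap + AffineMap.const ℝ (E d) w₀ with hΦ
  have hΦx : ∀ x, Φ x = x + bary K a x • (b - a) := by
    intro x
    have : bary K a x = (bary K a).linear x + bary K a 0 := by
      rw [← inner_grad, bary_eq_add a x 0, sub_zero]; ring
    rw [this]
    simp only [hΦ, hf, w₀, AffineMap.coe_add, Pi.add_apply, LinearMap.coe_toAffineMap,
      LinearMap.transvection.apply, AffineMap.coe_const, Function.const_apply, add_smul]
    abel
  have himg : Φ '' (K : Set (E d)) = L := by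
    have hKi : K = insert a F := (Finset.eq_of_subset_of_card_le (Finset.insert_subset ha hFK)
      (by rw [hK.1, Finset.card_insert_of_notMem haF, hc])).symm
    have hLi : L = insert b F := (Finset.eq_of_subset_of_card_le (Finset.insert_subset hb hFL)
      (by rw [hL.1, Finset.card_insert_of_notMem hbF, hc])).symm
    have h1 : Φ a = b := by rw [hΦx, bary_self hK ha, one_smul]; abel
    have h2 : ∀ c ∈ F, Φ c = c := fun c hcF => by
      rw [hΦx, bary_ne (hFK hcF) (by rintro rfl; exact haF hcF), zero_smul, add_zero]
    conv_lhs => rw [hKi]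
    conv_rhs => rw [hLi]
    rw [Finset.coe_insert, Finset.coe_insert, Set.image_insert_eq, h1]
    congr 1
    exact (Set.image_congr h2).trans (Set.image_id' _)
  have hhull : hull L = (fun x => x + w₀) '' (f '' hull K) := by
    rw [hull, ← himg, ← AffineMap.image_convexHull, Set.image_image]
    rfl
  have hdet : LinearMap.det f = bary K a b := by
    rw [hf, LinearMap.transvection.det, ← inner_grad, ← bary_sub, bary_self hK ha]
    ring
  rw [measureReal_def, measureReal_def, hhull, Set.image_add_right, measure_preimage_add_right,
    Measure.addHaar_image_linearMap, hdet, ENNReal.toReal_mul,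
    ENNReal.toReal_ofReal (abs_nonneg _)]

/-- The surface factor `volRatio K * ‖grad K a‖` of the face opposite to `a` (up to a constant its
area) depends on this face only. -/
lemma volRatio_mul_norm_grad (hK : IsSimplex K) (hL : IsSimplex L) (hFK : F ⊆ K)
    (hFL : F ⊆ L) (hc : F.card = d) {a b : E d} (ha : a ∈ K) (haF : a ∉ F) (hb : b ∈ L)
    (hbF : b ∉ F) : volRatio K * ‖grad K a‖ = volRatio L * ‖grad L b‖ := by
  rw [volRatio, volRatio, volume_opposite hK hL hFK hFL hc ha haF hb hbF,
    grad_opposite hL hFK hFL hc haF hb hbF, norm_smul, Real.norm_eq_abs]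
  ring

/-! ### Green's formula on a mesh -/

/-- The properties of the pair of products entering Green's formula: `cross` is bilinear, and
`crossT a` is the negative adjoint of `cross a`. -/
structure IsCrossPair {d k l : ℕ} (cross : E d → E k → E l) (crossT : E d → E l → E k) : Prop where
  add_left : ∀ a b v, cross (a + b) v = cross a v + cross b v
  smul_left : ∀ (c : ℝ) a v, cross (c • a) v = c • cross a v
  add_right : ∀ a v w, cross a (v + w) = cross a v + cross a w
  smul_right : ∀ (c : ℝ) a v, cross a (c • v) = c • cross a v
  adjoint : ∀ a v w, inner ℝ (cross a v) w = -inner ℝ v (crossT a w)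

namespace IsCrossPair

variable {k l : ℕ} {cross : E d → E k → E l} {crossT : E d → E l → E k}

/-- The product with a fixed left factor, as a linear map. -/
def right (hx : IsCrossPair cross crossT) (a : E d) : E k →ₗ[ℝ] E l where
  toFun := cross a
  map_add' := hx.add_right a
  map_smul' c := hx.smul_right c a

/-- The product with a fixed right factor, as a linear map. -/
def left (hx : IsCrossPair cross crossT) (v : E k) : E d →ₗ[ℝ] E l where
  toFun a := cross a v
  map_add' a b := hx.add_left a b v
  map_smul' c a := hx.smul_left c a v

lemma continuous_right (hx : IsCrossPair cross crossT) (a : E d) : Continuous (cross a) :=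
  (hx.right a).continuous_of_finiteDimensional

lemma neg_left (hx : IsCrossPair cross crossT) (a : E d) (v : E k) :
    cross (-a) v = -cross a v := (hx.left v).map_neg a

lemma sub_right (hx : IsCrossPair cross crossT) (a : E d) (v w : E k) :
    cross a (v - w) = cross a v - cross a w := (hx.right a).map_sub v w

lemma sum_left (hx : IsCrossPair cross crossT) {ι : Type*} (s : Finset ι) (f : ι → E d) (v : E k) :
    cross (∑ i ∈ s, f i) v = ∑ i ∈ s, cross (f i) v := map_sum (hx.left v) f s

lemma sum_right (hx : IsCrossPair cross crossT) {ι : Type*} (s : Finset ι) (a : E d)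
    (f : ι → E k) : cross a (∑ i ∈ s, f i) = ∑ i ∈ s, cross a (f i) := map_sum (hx.right a) f s

lemma contDiff_right (hx : IsCrossPair cross crossT) (a : E d) {n : WithTop ℕ∞} :
    ContDiff ℝ n (cross a) :=
  (LinearMap.toContinuousLinearMap (hx.right a)).contDiff

/-- The integrand of Green's formula is a divergence. -/
lemma curl_sub_curl (hx : IsCrossPair cross crossT) {p : E d → E k} {φ : E d → E l}
    (hp : ContDiff ℝ 1 p) (hφ : ContDiff ℝ 1 φ) (x : E d) :
    inner ℝ (curl cross p x) (φ x) - inner ℝ (p x) (curl crossT φ x) =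
      ∑ j : Fin d, fderiv ℝ (fun y => inner ℝ (cross (EuclideanSpace.single j 1) (p y)) (φ y)) x
        (EuclideanSpace.single j 1) := by
  rw [curl, curl, sum_inner, inner_sum, ← Finset.sum_sub_distrib]
  refine Finset.sum_congr rfl fun j _ => ?_
  set e : E d := EuclideanSpace.single j 1
  have h1 : HasFDerivAt (fun y => cross e (p y))
      ((LinearMap.toContinuousLinearMap (hx.right e)).comp (fderiv ℝ p x)) x :=
    (LinearMap.toContinuousLinearMap (hx.right e)).hasFDerivAt.comp x
      ((hp.differentiable one_ne_zero) x).hasFDerivAt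
  have h2 := ((hφ.differentiable one_ne_zero) x).hasFDerivAt
  rw [(h1.inner ℝ h2).fderiv]
  simp only [ContinuousLinearMap.comp_apply, ContinuousLinearMap.prod_apply, fderivInnerCLM_apply,
    LinearMap.coe_toContinuousLinearMap']
  rw [hx.adjoint e (p x)]
  change _ = _ + inner ℝ (cross e (fderiv ℝ p x e)) (φ x)
  ring

end IsCrossPair

lemma sum_inner_single_smul (v : E d) :
    ∑ j : Fin d, inner ℝ v (EuclideanSpace.single j 1) • (EuclideanSpace.single j 1 : E d) = v := by
  ext i
  simp [EuclideanSpace.inner_single_right, Finset.sum_apply, Pi.single_apply]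

open Classical in
/-- Green's formula on a simplex. -/
lemma green_hull {n k l : ℕ} {cross : E (n + 1) → E k → E l} {crossT : E (n + 1) → E l → E k}
    (hx : IsCrossPair cross crossT) {K : Finset (E (n + 1))} (h : IsSimplex K)
    {p : E (n + 1) → E k} {φ : E (n + 1) → E l} (hp : ContDiff ℝ 1 p) (hφ : ContDiff ℝ 1 φ) :
    ∫ x in hull K, (inner ℝ (curl cross p x) (φ x) - inner ℝ (p x) (curl crossT φ x)) =
      ∑ q ∈ K, volRatio K * ‖grad K q‖ * faceInt n (K.erase q)
        (fun x => inner ℝ (cross (outwardNormal K (K.erase q)) (p x)) (φ x)) := by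
  have hsm : ∀ a : E (n + 1), ContDiff ℝ 1 fun y => inner ℝ (cross a (p y)) (φ y) := fun a =>
    ((hx.contDiff_right a).comp hp).inner ℝ hφ
  simp only [hx.curl_sub_curl hp hφ]
  rw [integral_finsetSum]
  · simp only [fun j : Fin (n + 1) => integral_hull_fderiv h
      (hsm (EuclideanSpace.single j 1)) (EuclideanSpace.single j 1)]
    rw [Finset.sum_neg_distrib, ← Finset.mul_sum, Finset.sum_comm, Finset.mul_sum,
      ← Finset.sum_neg_distrib]
    refine Finset.sum_congr rfl fun q hq => ?_
    have hqc : (K.erase q).card = n + 1 := by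
      rw [Finset.card_erase_of_mem hq, h.1]; rfl
    have hg : ‖grad K q‖ • outwardNormal K (K.erase q) = -grad K q := by
      rw [outwardNormal_eq h (by omega) (Finset.erase_subset _ _) hqc hq (Finset.notMem_erase _ _),
        smul_neg, smul_inv_smul₀ (norm_ne_zero_iff.2 (grad_ne_zero h (by omega) hq))]
    rw [mul_assoc, ← mul_neg]
    congr 1
    simp only [← faceInt_const_mul]
    have hsum := faceInt_sum (F := K.erase q) (n := n) (Finset.univ : Finset (Fin (n + 1)))
      (f := fun j x => inner ℝ (grad K q) (EuclideanSpace.single j 1) *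
        inner ℝ (cross (EuclideanSpace.single j 1) (p x)) (φ x))
      fun j _ => (continuous_const.mul (hsm (EuclideanSpace.single j 1)).continuous)
    rw [← hsum, ← neg_one_mul, ← faceInt_const_mul]
    congr 1
    ext x
    simp only [← real_inner_smul_left, ← sum_inner, ← hx.smul_left, ← hx.sum_left]
    rw [sum_inner_single_smul, hg, neg_one_smul]
  · intro j _
    refine ContinuousOn.integrableOn_compact (isCompact_hull K) (Continuous.continuousOn ?_)
    exact ((hsm _).continuous_fderiv one_ne_zero).clm_apply continuous_const

namespace Mesh

/-- The surface factors of the faces, chosen independently of the adjacent elements. -/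
lemma exists_faceWeight {Ω : Set (E d)} (T : Mesh Ω) :
    ∃ A : Finset (E d) → ℝ, ∀ K ∈ T.cells, ∀ F ⊆ K, F.card = d → ∀ a ∈ K, a ∉ F →
      volRatio K * ‖grad K a‖ = A F := by
  classical
  refine ⟨fun F => if h : ∃ t : ℝ, ∃ K ∈ T.cells, F ⊆ K ∧ ∃ a ∈ K, a ∉ F ∧
    t = volRatio K * ‖grad K a‖ then h.choose else 0, fun K hK F hF hc a ha haF => ?_⟩
  have h : ∃ t : ℝ, ∃ K ∈ T.cells, F ⊆ K ∧ ∃ a ∈ K, a ∉ F ∧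
    t = volRatio K * ‖grad K a‖ := ⟨_, K, hK, hF, a, ha, haF, rfl⟩
  beta_reduce
  rw [dif_pos h]
  obtain ⟨L, hL, hFL, b, hb, hbF, he⟩ := h.choose_spec
  rw [he]
  exact volRatio_mul_norm_grad (T.isSimplex K hK) (T.isSimplex L hL) hF hFL hc ha haF hb hbF

open Classical in
lemma sum_cells_eq_sum_faces {n : ℕ} {Ω : Set (E (n + 1))} (T : Mesh Ω)
    (H : Finset (E (n + 1)) → Finset (E (n + 1)) → ℝ) :
    ∑ K ∈ T.cells, ∑ q ∈ K, H K (K.erase q) = ∑ F ∈ T.faces, ∑ K ∈ T.cellsAt F, H K F := by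
  rw [← Finset.sum_comm' (s := T.cells) (t := fun K => K.powersetCard (n + 1))]
  · refine Finset.sum_congr rfl fun K hK => ?_
    have sK := T.isSimplex K hK
    refine Finset.sum_bij (fun q _ => K.erase q) ?_ ?_ ?_ ?_
    · intro q hq
      rw [Finset.mem_powersetCard]
      exact ⟨Finset.erase_subset _ _, by rw [Finset.card_erase_of_mem hq, sK.1]; rfl⟩
    · exact fun q hq r hr hqr => Finset.erase_injOn K hq hr hqr
    · intro F hF
      obtain ⟨hFK, hc⟩ := Finset.mem_powersetCard.1 hF
      obtain ⟨a, ha, haF, -⟩ := exists_insert_face sK hFK hc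
      refine ⟨a, ha, ?_⟩
      refine (Finset.eq_of_subset_of_card_le (fun x hx => Finset.mem_erase.2
        ⟨by rintro rfl; exact haF hx, hFK hx⟩) ?_).symm
      rw [Finset.card_erase_of_mem ha, sK.1, hc]; rfl
    · intros; rfl
  · intro K F
    rw [T.mem_cellsAt, Finset.mem_powersetCard, T.mem_faces]
    constructor
    · rintro ⟨hK, hF, hc⟩
      exact ⟨⟨hK, hF⟩, K, hK, hF, hc⟩
    · rintro ⟨⟨hK, hF⟩, -, -, -, hc⟩
      exact ⟨hK, hF, hc⟩

/-- Green's formula on a mesh, for a piecewise smooth field whose tangential jumps over all faces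
(with the tangential traces as jumps on the boundary) are pointwise orthogonal to `φ`. -/
lemma green {n k l : ℕ} {cross : E (n + 1) → E k → E l} {crossT : E (n + 1) → E l → E k}
    (hx : IsCrossPair cross crossT) {Ω : Set (E (n + 1))} (T : Mesh Ω)
    (p : Finset (E (n + 1)) → E (n + 1) → E k) {φ : E (n + 1) → E l}
    (hp : ∀ K ∈ T.cells, ContDiff ℝ 1 (p K)) (hφ : ContDiff ℝ 1 φ)
    (hjump : ∀ F ∈ T.faces, ∀ x ∈ hull F,
      inner ℝ (∑ K ∈ T.cellsAt F, cross (outwardNormal K F) (p K x)) (φ x) = 0) :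
    ∑ K ∈ T.cells, ∫ x in hull K,
      (inner ℝ (curl cross (p K) x) (φ x) - inner ℝ (p K x) (curl crossT φ x)) = 0 := by
  classical
  obtain ⟨A, hA⟩ := T.exists_faceWeight
  have h1 : ∀ K ∈ T.cells, ∫ x in hull K,
      (inner ℝ (curl cross (p K) x) (φ x) - inner ℝ (p K x) (curl crossT φ x)) =
      ∑ q ∈ K, A (K.erase q) * faceInt n (K.erase q)
        (fun x => inner ℝ (cross (outwardNormal K (K.erase q)) (p K x)) (φ x)) := by
    intro K hK
    have sK := T.isSimplex K hK
    rw [green_hull hx sK (hp K hK) hφ]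
    refine Finset.sum_congr rfl fun q hq => ?_
    rw [hA K hK (K.erase q) (Finset.erase_subset _ _)
      (by rw [Finset.card_erase_of_mem hq, sK.1]; rfl) q hq (Finset.notMem_erase _ _)]
  rw [Finset.sum_congr rfl h1, T.sum_cells_eq_sum_faces fun K F => A F * faceInt n F
        (fun x => inner ℝ (cross (outwardNormal K F) (p K x)) (φ x))]
  refine Finset.sum_eq_zero fun F hF => ?_
  rw [← Finset.mul_sum, ← faceInt_sum]
  · simp only [← sum_inner]
    rw [faceInt_congr (g := fun x => 0 * 0) (fun x hxF => by rw [hjump F hF x hxF, mul_zero]),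
      faceInt_const_mul, zero_mul, mul_zero]
  · intro K hK
    exact ((hx.contDiff_right _).comp (hp K (T.mem_cellsAt.1 hK).1)).continuous.inner
      hφ.continuous

end Mesh

/-! ### Bernstein form of polynomials on a simplex -/

open Classical in
/-- The multi-indices of degree `m` supported on the vertices of `K`. A multi-index is a function
on the whole space, so that different simplices share the multi-indices of a common face. -/
def bernIdx (m : ℕ) (K : Finset (E d)) : Finset (E d →₀ ℕ) := K.finsuppAntidiag m

/-- The Bernstein monomial `λ^α` (without the multinomial coefficient). -/
def bernMono (K : Finset (E d)) (α : E d →₀ ℕ) (x : E d) : ℝ := ∏ a ∈ K, bary K a x ^ α a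

/-- The polynomial function on `K` with Bernstein coefficients `c`. -/
def bern {k : ℕ} (m : ℕ) (K : Finset (E d)) (c : (E d →₀ ℕ) → E k) (x : E d) : E k :=
  ∑ α ∈ bernIdx m K, bernMono K α x • c α

lemma mem_bernIdx {m : ℕ} {α : E d →₀ ℕ} :
    α ∈ bernIdx m K ↔ ∑ a ∈ K, α a = m ∧ α.support ⊆ K := by
  classical
  simp [bernIdx, Finset.mem_finsuppAntidiag]

lemma bernIdx_mono {m : ℕ} (hF : F ⊆ K) : bernIdx m F ⊆ bernIdx m K := by
  classical
  exact Finset.finsuppAntidiag_mono hF m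

lemma mem_bernIdx_of_support {m : ℕ} {α : E d →₀ ℕ} (hα : α ∈ bernIdx m K)
    (hF : α.support ⊆ F) : α ∈ bernIdx m F := by
  rw [mem_bernIdx] at hα ⊢
  refine ⟨?_, hF⟩
  rw [← hα.1, ← Finset.sum_subset hF, ← Finset.sum_subset hα.2]
  · intro a _ ha; simpa using ha
  · intro a _ ha; simpa using ha

lemma support_nonempty {m : ℕ} (hm : 1 ≤ m) {α : E d →₀ ℕ} (hα : α ∈ bernIdx m K) :
    α.support.Nonempty := by
  rw [Finset.nonempty_iff_ne_empty]
  intro h0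
  rw [Finsupp.support_eq_empty] at h0
  have := (mem_bernIdx.1 hα).1
  simp [h0] at this
  omega

lemma bern_add {k m : ℕ} (c c' : (E d →₀ ℕ) → E k) (x : E d) :
    bern m K (c + c') x = bern m K c x + bern m K c' x := by
  simp [bern, smul_add, Finset.sum_add_distrib]

lemma bern_sub {k m : ℕ} (c c' : (E d →₀ ℕ) → E k) (x : E d) :
    bern m K (c - c') x = bern m K c x - bern m K c' x := by
  simp [bern, smul_sub, Finset.sum_sub_distrib]

lemma bernMono_single_add {a : E d} (ha : a ∈ K) (α : E d →₀ ℕ) (x : E d) :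
    bernMono K (α + Finsupp.single a 1) x = bary K a x * bernMono K α x := by
  classical
  simp only [bernMono, Finsupp.add_apply, pow_add, Finset.prod_mul_distrib]
  rw [mul_comm]
  congr 1
  rw [Finset.prod_eq_single a]
  · simp
  · intro b _ hb
    simp [hb.symm]
  · exact fun h => absurd ha h

/-- `f` is a homogeneous polynomial of degree `m` in the barycentric coordinates. -/
def IsBern {k : ℕ} (m : ℕ) (K : Finset (E d)) (f : E d → E k) : Prop :=
  ∃ c : (E d →₀ ℕ) → E k, ∀ x, f x = bern m K c x

lemma IsBern.add {k m : ℕ} {f g : E d → E k} (hf : IsBern m K f) (hg : IsBern m K g) :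
    IsBern m K fun x => f x + g x := by
  obtain ⟨c, hc⟩ := hf
  obtain ⟨c', hc'⟩ := hg
  exact ⟨c + c', fun x => by rw [bern_add, ← hc, ← hc']⟩

lemma IsBern.zero {k m : ℕ} : IsBern m K fun _ => (0 : E k) := ⟨0, fun x => by simp [bern]⟩

lemma IsBern.smul {k m : ℕ} {f : E d → E k} (r : ℝ) (hf : IsBern m K f) :
    IsBern m K fun x => r • f x := by
  obtain ⟨c, hc⟩ := hf
  exact ⟨fun α => r • c α, fun x => by simp [bern, hc, Finset.smul_sum, smul_comm r]⟩

lemma IsBern.sum {k m : ℕ} {ι : Type*} (s : Finset ι) {f : ι → E d → E k}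
    (hf : ∀ i ∈ s, IsBern m K (f i)) : IsBern m K fun x => ∑ i ∈ s, f i x := by
  classical
  induction s using Finset.induction_on with
  | empty => simpa using IsBern.zero
  | insert i s hi ih =>
    simp only [Finset.sum_insert hi]
    exact (hf i (Finset.mem_insert_self _ _)).add
      (ih fun j hj => hf j (Finset.mem_insert_of_mem hj))

lemma IsBern.bary_smul {k m : ℕ} {f : E d → E k} (hf : IsBern m K f) {a : E d}
    (ha : a ∈ K) : IsBern (m + 1) K fun x => bary K a x • f x := by
  classical
  obtain ⟨c, hc⟩ := hf
  have hinj : Set.InjOn (fun α : E d →₀ ℕ => α + Finsupp.single a 1) (bernIdx m K) :=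
    fun α _ β _ hab => add_right_cancel hab
  have hsub : (bernIdx m K).image (fun α => α + Finsupp.single a 1) ⊆ bernIdx (m + 1) K := by
    intro β hβ
    obtain ⟨α, hα, rfl⟩ := Finset.mem_image.1 hβ
    rw [mem_bernIdx] at hα ⊢
    constructor
    · simp only [Finsupp.add_apply, Finset.sum_add_distrib, hα.1, Finsupp.single_apply]
      simp [ha]
    · refine Finsupp.support_add.trans (Finset.union_subset hα.2 ?_)
      exact Finsupp.support_single_subset.trans (by simpa using ha)
  refine ⟨fun β => if β ∈ (bernIdx m K).image (fun α => α + Finsupp.single a 1) then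
    c (β - Finsupp.single a 1) else 0, fun x => ?_⟩
  beta_reduce
  rw [hc, bern, bern, ← Finset.sum_subset hsub, Finset.sum_image hinj, Finset.smul_sum]
  · refine Finset.sum_congr rfl fun α hα => ?_
    rw [if_pos (Finset.mem_image_of_mem _ hα), add_tsub_cancel_right,
      bernMono_single_add ha, smul_smul]
  · intro β _ hβ
    rw [if_neg hβ, smul_zero]

/-- Degree elevation: multiply by `1 = ∑ a ∈ K, bary K a`. -/
lemma IsBern.succ {k m : ℕ} (h : IsSimplex K) {f : E d → E k} (hf : IsBern m K f) :
    IsBern (m + 1) K f := by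
  have h1 := IsBern.sum (m := m + 1) K (f := fun a x => bary K a x • f x)
    fun a ha => hf.bary_smul ha
  simpa only [← Finset.sum_smul, sum_bary h, one_smul] using h1

lemma IsBern.mono {k m m' : ℕ} (h : IsSimplex K) (hmm : m ≤ m') {f : E d → E k}
    (hf : IsBern m K f) : IsBern m' K f := by
  induction m', hmm using Nat.le_induction with
  | base => exact hf
  | succ n _ ih => exact ih.succ h

lemma IsBern.coord_smul {k m : ℕ} (h : IsSimplex K) {f : E d → E k} (hf : IsBern m K f)
    (i : Fin d) : IsBern (m + 1) K fun x => x i • f x := by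
  have h1 := IsBern.sum (m := m + 1) K (f := fun a x => a i • (bary K a x • f x))
    fun a ha => (hf.bary_smul ha).smul (a i)
  have h2 : ∀ x : E d, ∑ a ∈ K, a i • (bary K a x • f x) = x i • f x := by
    intro x
    have h3 : x i = ∑ a ∈ K, a i * bary K a x := by
      conv_lhs => rw [← sum_bary_smul h x]
      simp [mul_comm]
    rw [h3]
    simp only [smul_smul, ← Finset.sum_smul]
  simpa only [h2] using h1

lemma IsBern.const {k : ℕ} (h : IsSimplex K) (m : ℕ) (v : E k) : IsBern m K fun _ => v := by
  refine IsBern.mono h (Nat.zero_le m) ⟨fun _ => v, fun x => ?_⟩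
  classical
  have h0 : bernIdx 0 K = {0} := by
    simp [bernIdx]
  simp [bern, h0, bernMono]

/-- Vector-valued polynomials of degree at most `m` have a Bernstein form of degree `m`. -/
lemma isBern_polyFun (h : IsSimplex K) {k m : ℕ} (p : Fin k → MvPolynomial (Fin d) ℝ)
    (hp : ∀ i, (p i).totalDegree ≤ m) : IsBern m K (polyFun p) := by
  have hmono : ∀ (n : ℕ) (s : Fin d →₀ ℕ) (v : E k), (s.sum fun _ e => e) = n →
      IsBern n K fun x => (∏ j, x j ^ s j) • v := by
    intro n
    induction n with
    | zero =>
      intro s v hs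
      have h0 : s = 0 := by
        ext j
        by_contra hj
        have hj' : j ∈ s.support := Finsupp.mem_support_iff.2 hj
        have := Finset.single_le_sum (f := fun j => s j) (fun _ _ => Nat.zero_le _) hj'
        rw [Finsupp.sum] at hs
        rw [hs] at this
        exact hj (by simpa using this)
      simpa [h0] using IsBern.const h 0 v
    | succ n ih =>
      intro s v hs
      have hne : s ≠ 0 := by rintro rfl; simp at hs
      obtain ⟨j, hj⟩ := Finsupp.support_nonempty_iff.2 hne
      have hle : Finsupp.single j 1 ≤ s := by
        rw [Finsupp.single_le_iff]
        exact Nat.one_le_iff_ne_zero.2 (Finsupp.mem_support_iff.1 hj)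
      obtain ⟨t, rfl⟩ := exists_add_of_le hle
      have ht : (t.sum fun _ e => e) = n := by
        rw [Finsupp.sum_add_index' (by simp) (by simp), Finsupp.sum_single_index rfl] at hs
        omega
      have h1 := (ih t v ht).coord_smul h j
      have h2 : ∀ x : E d, ∏ i, x i ^ ((Finsupp.single j 1 + t : Fin d →₀ ℕ) i) =
          x j * ∏ i, x i ^ t i := by
        intro x
        simp only [Finsupp.add_apply, pow_add, Finset.prod_mul_distrib]
        congr 1
        rw [Finset.prod_eq_single j]
        · simp
        · intro b _ hb; simp [hb.symm]
        · simp
      simpa only [h2, smul_smul] using h1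
  have h3 : ∀ x, polyFun p x = ∑ i : Fin k, ∑ s ∈ (p i).support,
      (∏ j, x j ^ s j) • ((p i).coeff s • (EuclideanSpace.single i 1 : E k)) := by
    intro x
    ext i'
    simp only [polyFun, MvPolynomial.eval_eq']
    simp [Finset.sum_apply, Pi.single_apply, mul_comm]
  have h4 : IsBern m K fun x => ∑ i : Fin k, ∑ s ∈ (p i).support,
      (∏ j, x j ^ s j) • ((p i).coeff s • (EuclideanSpace.single i 1 : E k)) := by
    refine IsBern.sum _ fun i _ => IsBern.sum _ fun s hs => ?_
    exact (hmono _ s _ rfl).mono h ((MvPolynomial.le_totalDegree hs).trans (hp i))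
  obtain ⟨c, hc⟩ := h4
  exact ⟨c, fun x => (h3 x).trans (hc x)⟩

/-- A barycentric coordinate as a polynomial. -/
def baryPoly (K : Finset (E d)) (a : E d) : MvPolynomial (Fin d) ℝ :=
  MvPolynomial.C (bary K a 0) + ∑ j, MvPolynomial.C (grad K a j) * MvPolynomial.X j

lemma eval_baryPoly (a x : E d) :
    MvPolynomial.eval (fun j => x j) (baryPoly K a) = bary K a x := by
  rw [bary_eq_add a x 0, sub_zero]
  simp [baryPoly, PiLp.inner_apply, mul_comm]

lemma totalDegree_baryPoly (a : E d) : (baryPoly K a).totalDegree ≤ 1 := by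
  refine (MvPolynomial.totalDegree_add _ _).trans (max_le (by simp) ?_)
  refine MvPolynomial.totalDegree_finsetSum_le fun j _ => ?_
  refine (MvPolynomial.totalDegree_mul _ _).trans ?_
  simp

/-- The components of the polynomial with Bernstein coefficients `c`. -/
def bernPoly {k : ℕ} (m : ℕ) (K : Finset (E d)) (c : (E d →₀ ℕ) → E k) (i : Fin k) :
    MvPolynomial (Fin d) ℝ :=
  ∑ α ∈ bernIdx m K, MvPolynomial.C (c α i) * ∏ a ∈ K, baryPoly K a ^ α a

lemma polyFun_bernPoly {k m : ℕ} (c : (E d →₀ ℕ) → E k) (x : E d) :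
    polyFun (bernPoly m K c) x = bern m K c x := by
  ext i
  simp only [polyFun, bernPoly, bern, bernMono, map_sum, map_mul, MvPolynomial.eval_C, map_prod,
    map_pow, eval_baryPoly]
  simp [Finset.sum_apply, mul_comm]

lemma totalDegree_bernPoly {k m : ℕ} (c : (E d →₀ ℕ) → E k) (i : Fin k) :
    (bernPoly m K c i).totalDegree ≤ m := by
  refine MvPolynomial.totalDegree_finsetSum_le fun α hα => ?_
  refine (MvPolynomial.totalDegree_mul _ _).trans ?_
  rw [MvPolynomial.totalDegree_C, zero_add]
  refine (MvPolynomial.totalDegree_finsetProd _ _).trans ?_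
  rw [← (mem_bernIdx.1 hα).1]
  refine Finset.sum_le_sum fun a _ => (MvPolynomial.totalDegree_pow _ _).trans ?_
  calc α a * (baryPoly K a).totalDegree ≤ α a * 1 :=
        Nat.mul_le_mul_left _ (totalDegree_baryPoly a)
    _ = α a := mul_one _

/-! ### Restriction to faces, and bounds on a simplex -/

lemma bernMono_eq_of_face (hF : F ⊆ K) {m : ℕ} {α : E d →₀ ℕ}
    (hα : α ∈ bernIdx m F) (x : E d) : bernMono K α x = ∏ a ∈ F, bary K a x ^ α a := by
  rw [bernMono]
  refine (Finset.prod_subset hF fun a _ ha => ?_).symm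
  have : α a = 0 := by
    by_contra h0
    exact ha ((mem_bernIdx.1 hα).2 (Finsupp.mem_support_iff.2 h0))
  rw [this, pow_zero]

/-- On a face only the coefficients of that face matter. -/
lemma bern_face (h : IsSimplex K) (hF : F ⊆ K) {k m : ℕ} (c : (E d →₀ ℕ) → E k) {x : E d}
    (hx : x ∈ hull F) :
    bern m K c x = ∑ α ∈ bernIdx m F, (∏ a ∈ F, bary K a x ^ α a) • c α := by
  rw [bern, ← Finset.sum_subset (bernIdx_mono hF)]
  · exact Finset.sum_congr rfl fun α hα => by rw [bernMono_eq_of_face hF hα]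
  · intro α hα hαF
    have hns : ¬ α.support ⊆ F := fun hs => hαF (mem_bernIdx_of_support hα hs)
    obtain ⟨a, ha, haF⟩ := Finset.not_subset.1 hns
    have haK := (mem_bernIdx.1 hα).2 ha
    have h0 := ((mem_hull_face_iff h hF).1 hx).2 a haK haF
    rw [bernMono, Finset.prod_eq_zero haK, zero_smul]
    rw [h0, zero_pow (Finsupp.mem_support_iff.1 ha)]

lemma bernMono_mem_Icc (h : IsSimplex K) (α : E d →₀ ℕ) {x : E d} (hx : x ∈ hull K) :
    0 ≤ bernMono K α x ∧ bernMono K α x ≤ 1 :=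
  ⟨Finset.prod_nonneg fun a _ => pow_nonneg (bary_mem_Icc h hx a).1 _,
    Finset.prod_le_one (fun a _ => pow_nonneg (bary_mem_Icc h hx a).1 _)
      fun a _ => pow_le_one₀ (bary_mem_Icc h hx a).1 (bary_mem_Icc h hx a).2⟩

lemma norm_bern_le (h : IsSimplex K) {k m : ℕ} (c : (E d →₀ ℕ) → E k) {x : E d}
    (hx : x ∈ hull K) : ‖bern m K c x‖ ≤ ∑ α ∈ bernIdx m K, ‖c α‖ := by
  refine (norm_sum_le _ _).trans (Finset.sum_le_sum fun α _ => ?_)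
  obtain ⟨h0, h1⟩ := bernMono_mem_Icc h α hx
  rw [norm_smul, Real.norm_of_nonneg h0]
  exact mul_le_of_le_one_left (norm_nonneg _) h1

lemma hasFDerivAt_bary (a x : E d) : HasFDerivAt (bary K a) (innerSL ℝ (grad K a)) x := by
  have h1 : (bary K a : E d → ℝ) = fun y => bary K a 0 + innerSL ℝ (grad K a) y := by
    ext y
    rw [bary_eq_add a y 0, sub_zero]
    rfl
  rw [h1]
  exact (innerSL ℝ (grad K a)).hasFDerivAt.const_add _

lemma contDiff_bary (a : E d) {n : WithTop ℕ∞} : ContDiff ℝ n (bary K a) := by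
  have h1 : (bary K a : E d → ℝ) = fun y => bary K a 0 + innerSL ℝ (grad K a) y := by
    ext y
    rw [bary_eq_add a y 0, sub_zero]
    rfl
  rw [h1]
  exact contDiff_const.add (innerSL ℝ (grad K a)).contDiff

lemma contDiff_bern {k m : ℕ} (c : (E d →₀ ℕ) → E k) {n : WithTop ℕ∞} :
    ContDiff ℝ n (bern m K c) := by
  refine ContDiff.sum fun α _ => ContDiff.fun_smul ?_ contDiff_const
  exact contDiff_prod fun a _ => (contDiff_bary a).pow _

/-- A product of functions with values in `[-1, 1]` has at most the sum of their derivatives as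
derivative. -/
lemma exists_hasFDerivAt_prod {ι V : Type*} [NormedAddCommGroup V] [NormedSpace ℝ V]
    (s : Finset ι) {f : ι → V → ℝ} {x : V} {β : ι → ℝ}
    (hf : ∀ i ∈ s, |f i x| ≤ 1 ∧ ∃ D : V →L[ℝ] ℝ, HasFDerivAt (f i) D x ∧ ‖D‖ ≤ β i) :
    |∏ i ∈ s, f i x| ≤ 1 ∧ ∃ D : V →L[ℝ] ℝ, HasFDerivAt (fun y => ∏ i ∈ s, f i y) D x ∧
      ‖D‖ ≤ ∑ i ∈ s, β i := by
  classical
  induction s using Finset.induction_on with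
  | empty => exact ⟨by simp, 0, by simpa using hasFDerivAt_const (1 : ℝ) x, by simp⟩
  | insert i s hi ih =>
    obtain ⟨h1, D, hD, hDn⟩ := hf i (Finset.mem_insert_self _ _)
    obtain ⟨h2, D', hD', hDn'⟩ := ih fun j hj => hf j (Finset.mem_insert_of_mem hj)
    simp only [Finset.prod_insert hi, Finset.sum_insert hi]
    refine ⟨?_, _, hD.mul hD', ?_⟩
    · rw [abs_mul]
      exact mul_le_one₀ h1 (abs_nonneg _) h2
    · refine (norm_add_le _ _).trans ?_
      rw [norm_smul, norm_smul, Real.norm_eq_abs, Real.norm_eq_abs, add_comm]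
      exact add_le_add ((mul_le_of_le_one_left (norm_nonneg _) h2).trans hDn)
        ((mul_le_of_le_one_left (norm_nonneg _) h1).trans hDn')

lemma exists_hasFDerivAt_bernMono (h : IsSimplex K) (hd : 1 ≤ d) {m : ℕ} {α : E d →₀ ℕ}
    (hα : α ∈ bernIdx m K) {x : E d} (hx : x ∈ hull K) :
    ∃ D : E d →L[ℝ] ℝ, HasFDerivAt (bernMono K α) D x ∧ ‖D‖ ≤ m / inscribedDiam K := by
  have hi := inscribedDiam_pos h hd
  have h1 : ∀ a ∈ K, |bary K a x| ≤ 1 ∧ ∃ D : E d →L[ℝ] ℝ, HasFDerivAt (bary K a) D x ∧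
      ‖D‖ ≤ 1 / inscribedDiam K := fun a _ => by
    obtain ⟨h0, h1⟩ := bary_mem_Icc h hx a
    refine ⟨by rwa [abs_of_nonneg h0], _, hasFDerivAt_bary a x, ?_⟩
    rw [innerSL_apply_norm, le_div_iff₀ hi]
    exact norm_grad_mul_inscribedDiam_le h a
  have h2 := exists_hasFDerivAt_prod K (f := fun a y => bary K a y ^ α a) (x := x)
    (β := fun a => α a * (1 / inscribedDiam K)) fun a ha => by
      simpa using exists_hasFDerivAt_prod (Finset.range (α a)) (f := fun _ y => bary K a y)
        (x := x) (β := fun _ => 1 / inscribedDiam K) fun _ _ => h1 a ha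
  obtain ⟨-, D, hD, hDn⟩ := h2
  refine ⟨D, hD, hDn.trans_eq ?_⟩
  rw [← Finset.sum_mul, ← Nat.cast_sum, (mem_bernIdx.1 hα).1, mul_one_div]

/-- An inverse estimate, from `‖grad K a‖ ≤ 1 / ρ_K`. -/
lemma norm_curl_bern_le (h : IsSimplex K) (hd : 1 ≤ d) {k l m : ℕ} {cross : E d → E k → E l}
    (hcross : ∀ a v, ‖cross a v‖ ≤ ‖a‖ * ‖v‖) (c : (E d →₀ ℕ) → E k) {x : E d}
    (hx : x ∈ hull K) :
    ‖curl cross (bern m K c) x‖ ≤ d * (m / inscribedDiam K) * ∑ α ∈ bernIdx m K, ‖c α‖ := by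
  have h1 : ∀ v : E d, ‖fderiv ℝ (bern m K c) x v‖ ≤
      m / inscribedDiam K * ‖v‖ * ∑ α ∈ bernIdx m K, ‖c α‖ := by
    intro v
    choose! D hD hDn using fun α (hα : α ∈ bernIdx m K) => exists_hasFDerivAt_bernMono h hd hα hx
    have h2 : HasFDerivAt (bern m K c) (∑ α ∈ bernIdx m K, (D α).smulRight (c α)) x :=
      HasFDerivAt.fun_sum fun α hα => (hD α hα).smul_const (c α)
    rw [h2.fderiv]
    simp only [sum_apply, ContinuousLinearMap.smulRight_apply]
    refine (norm_sum_le _ _).trans ?_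
    rw [Finset.mul_sum]
    refine Finset.sum_le_sum fun α hα => ?_
    rw [norm_smul]
    refine mul_le_mul_of_nonneg_right ?_ (norm_nonneg _)
    exact ((D α).le_opNorm v).trans (mul_le_mul_of_nonneg_right (hDn α hα) (norm_nonneg _))
  rw [curl]
  refine (norm_sum_le _ _).trans ?_
  have h3 : ∀ j : Fin d, ‖cross (EuclideanSpace.single j 1)
      (fderiv ℝ (bern m K c) x (EuclideanSpace.single j 1))‖ ≤
      m / inscribedDiam K * ∑ α ∈ bernIdx m K, ‖c α‖ := by
    intro j
    have h4 : ‖(EuclideanSpace.single j (1 : ℝ) : E d)‖ = 1 := by simp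
    refine (hcross _ _).trans ?_
    rw [h4, one_mul]
    refine (h1 _).trans_eq ?_
    rw [h4, mul_one]
  refine (Finset.sum_le_sum fun j _ => h3 j).trans_eq ?_
  rw [Finset.sum_const, Finset.card_univ, Fintype.card_fin, nsmul_eq_mul]
  ring

/-! ### Uniqueness of the polynomial pieces -/

lemma continuous_polyFun {k : ℕ} (p : Fin k → MvPolynomial (Fin d) ℝ) : Continuous (polyFun p) := by
  refine (PiLp.continuous_toLp 2 _).comp (continuous_pi fun i => ?_)
  exact (MvPolynomial.continuous_eval (p i)).comp (by fun_prop)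

lemma polyFun_injective_of_ae (h : IsSimplex K) {k : ℕ} {p q : Fin k → MvPolynomial (Fin d) ℝ}
    (hpq : ∀ᵐ x ∂volume.restrict (hull K), polyFun p x = polyFun q x) : p = q := by
  have h1 : EqOn (polyFun p) (polyFun q) (interior (hull K)) :=
    Measure.eqOn_open_of_ae_eq (ae_restrict_of_ae_restrict_of_subset interior_subset hpq)
      isOpen_interior (continuous_polyFun p).continuousOn (continuous_polyFun q).continuousOn
  obtain ⟨z, hz⟩ := h.nonempty_interior
  have h2 : IsOpen ((WithLp.toLp 2 : (Fin d → ℝ) → E d) ⁻¹' interior (hull K)) :=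
    isOpen_interior.preimage (PiLp.continuous_toLp 2 _)
  obtain ⟨r, hr, hball⟩ := Metric.isOpen_iff.1 h2 (WithLp.ofLp z) hz
  ext1 i
  refine MvPolynomial.funext_set (fun j => Metric.ball (z j) r) (fun j => ?_) fun x hx => ?_
  · rw [Real.ball_eq_Ioo]
    exact Ioo_infinite (by linarith)
  · have h3 : x ∈ Metric.ball (WithLp.ofLp z) r := by
      rw [ball_pi _ hr]; exact hx
    have h4 := h1 (hball h3)
    exact congrArg (fun v : E k => v i) h4

lemma piece_eq (h : IsSimplex K) {k : ℕ} {u : E d → E k} {p : Fin k → MvPolynomial (Fin d) ℝ}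
    (hp : ∀ᵐ x ∂volume.restrict (hull K), u x = polyFun p x) : piece u K = p := by
  have hex : ∃ p : Fin k → MvPolynomial (Fin d) ℝ,
      ∀ᵐ x ∂volume.restrict (hull K), u x = polyFun p x := ⟨p, hp⟩
  rw [piece, dif_pos hex]
  refine polyFun_injective_of_ae h ?_
  filter_upwards [hp, hex.choose_spec] with x h1 h2
  rw [← h1, ← h2]

/-! ### Equivalence of norms on the reference simplex -/

lemma memLp_of_isCompact {α M : Type*} [TopologicalSpace α] [MeasurableSpace α]
    [OpensMeasurableSpace α] [NormedAddCommGroup M] [SecondCountableTopology M]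
    {μ : Measure α} {S : Set α} (hS : IsCompact S)
    (hSm : MeasurableSet S) (hμ : μ S ≠ ⊤) {f : α → M} (hf : Continuous f) (p : ENNReal) :
    MemLp f p (μ.restrict S) := by
  have : IsFiniteMeasure (μ.restrict S) := ⟨by rw [Measure.restrict_apply_univ]; exact hμ.lt_top⟩
  obtain ⟨C, hC⟩ := hS.exists_bound_of_continuousOn hf.continuousOn
  borelize M
  refine MemLp.of_bound hf.measurable.aestronglyMeasurable C ?_
  filter_upwards [ae_restrict_mem hSm] with x hx using hC x hx

/-- The multi-indices of degree `m` for the reference simplex. -/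
def refIdx (n m : ℕ) : Finset (Fin (n + 1) →₀ ℕ) :=
  (Finset.univ : Finset (Fin (n + 1))).finsuppAntidiag m

lemma mem_refIdx {n m : ℕ} {β : Fin (n + 1) →₀ ℕ} : β ∈ refIdx n m ↔ ∑ j, β j = m := by
  simp [refIdx, Finset.mem_finsuppAntidiag]

-- unfolding the antidiagonal in unification is expensive; `mem_refIdx` characterizes the set
attribute [irreducible] refIdx

/-- The polynomial with Bernstein coefficients `q` on the reference simplex. -/
def refBern {n l : ℕ} (m : ℕ) (q : (Fin (n + 1) →₀ ℕ) → E l) (s : Fin n → ℝ) : E l :=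
  ∑ β ∈ refIdx n m, (∏ i, refBary s i ^ β i) • q β

lemma continuous_refBern {n l m : ℕ} (q : (Fin (n + 1) →₀ ℕ) → E l) :
    Continuous (refBern m q) :=
  continuous_finsetSum _ fun _ _ => Continuous.smul
    (continuous_finsetProd _ fun i _ => (continuous_refBary i).pow _) continuous_const

/-- A homogeneous polynomial in the barycentric coordinates vanishing on the interior of the
reference simplex vanishes by homogeneity on an orthant, hence has zero coefficients. -/
lemma refBern_injective {n l m : ℕ} (q : (Fin (n + 1) →₀ ℕ) → E l)
    (h : ∀ s ∈ refInterior n, refBern m q s = 0) : ∀ β ∈ refIdx n m, q β = 0 := by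
  have hpoly : ∀ i : Fin l,
      (∑ β ∈ refIdx n m, MvPolynomial.monomial β (q β i) : MvPolynomial (Fin (n + 1)) ℝ) = 0 := by
    intro i
    refine MvPolynomial.funext_set (fun _ => Ioi (0 : ℝ)) (fun _ => Ioi_infinite 0) fun t ht => ?_
    have ht0 : ∀ j, 0 < t j := fun j => ht j (mem_univ j)
    set T := ∑ j, t j with hT
    have hT0 : 0 < T := Finset.sum_pos (fun j _ => ht0 j) Finset.univ_nonempty
    set s : Fin n → ℝ := fun j => t j.succ / T with hs
    have hbary : ∀ j, refBary s j = t j / T := by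
      intro j
      refine Fin.cases ?_ (fun j => ?_) j
      · simp only [refBary, Fin.cons_zero, hs, ← Finset.sum_div]
        rw [Fin.sum_univ_succ] at hT
        field_simp
        linarith
      · simp [refBary, hs]
    have hsi : s ∈ refInterior n := fun j => by
      rw [hbary]; exact div_pos (ht0 j) hT0
    have h1 := congrArg (fun v : E l => v i) (h s hsi)
    simp only [refBern, hbary] at h1
    have h2 : ∑ β ∈ refIdx n m, (∏ j, (t j / T) ^ β j) * q β i = 0 := by
      simpa [Finset.sum_apply] using h1
    rw [map_sum, map_zero]
    simp only [MvPolynomial.eval_monomial]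
    have h3 : ∀ β ∈ refIdx n m, q β i * β.prod (fun j e => t j ^ e) =
        T ^ m * ((∏ j, (t j / T) ^ β j) * q β i) := by
      intro β hβ
      have hβm : ∑ j, β j = m := mem_refIdx.1 hβ
      rw [Finsupp.prod_fintype _ _ (by simp)]
      simp only [div_pow]
      rw [Finset.prod_div_distrib, Finset.prod_pow_eq_pow_sum, hβm]
      have : T ^ m ≠ 0 := pow_ne_zero _ hT0.ne'
      field_simp
    rw [Finset.sum_congr rfl h3, ← Finset.mul_sum, h2, mul_zero]
  intro β hβ
  ext i
  have h1 := congrArg (MvPolynomial.coeff β) (hpoly i)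
  rw [MvPolynomial.coeff_sum, MvPolynomial.coeff_zero] at h1
  simp only [MvPolynomial.coeff_monomial] at h1
  rw [Finset.sum_ite_eq' (refIdx n m) β, if_pos hβ] at h1
  simpa using h1

/-- Equivalence of norms for the span of finitely many independent continuous functions on the
reference simplex. -/
lemma exists_lower_of_injective {n l : ℕ} {ι : Type} [Fintype ι] (f : ι → (Fin n → ℝ) → ℝ)
    (hf : ∀ i, Continuous (f i))
    (hinj : ∀ q : ι → E l, (∀ s ∈ refInterior n, ∑ i, f i s • q i = 0) → q = 0) :
    ∃ c : ℝ, 0 < c ∧ ∀ q : ι → E l,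
      c * ∑ i, ‖q i‖ ^ 2 ≤ ∫ s in refSimplex n, ‖∑ i, f i s • q i‖ ^ 2 := by
  set μ := (volume : Measure (Fin n → ℝ)).restrict (refSimplex n) with hμ
  have hcont : ∀ q : ι → E l, Continuous fun s => ∑ i, f i s • q i := fun q =>
    continuous_finsetSum _ fun i _ => (hf i).smul continuous_const
  have hmem : ∀ q : ι → E l, MemLp (fun s => ∑ i, f i s • q i) 2 μ := fun q =>
    memLp_of_isCompact (isCompact_refSimplex n) (measurableSet_refSimplex n)
      (volume_refSimplex_ne_top n) (hcont q) 2
  have hadd : ∀ q q' : ι → E l, (hmem (q + q')).toLp = (hmem q).toLp + (hmem q').toLp := by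
    intro q q'
    rw [← MemLp.toLp_add]
    congr 1
    funext s
    simp [smul_add, Finset.sum_add_distrib]
  have hsmul : ∀ (r : ℝ) (q : ι → E l), (hmem (r • q)).toLp = r • (hmem q).toLp := by
    intro r q
    rw [← MemLp.toLp_const_smul]
    congr 1
    funext s
    simp [Finset.smul_sum, smul_comm r]
  obtain ⟨Λ, hΛeq⟩ : ∃ Λ : (ι → E l) →ₗ[ℝ] Lp (E l) 2 μ, ∀ q, Λ q = (hmem q).toLp :=
    ⟨{ toFun := fun q => (hmem q).toLp, map_add' := hadd, map_smul' := hsmul }, fun _ => rfl⟩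
  have hker : LinearMap.ker Λ = ⊥ := by
    rw [LinearMap.ker_eq_bot']
    intro q hq
    rw [hΛeq] at hq
    refine hinj q ?_
    have h1 : (fun s => ∑ i, f i s • q i) =ᵐ[μ] 0 :=
      (hmem q).coeFn_toLp.symm.trans (by rw [hq]; exact Lp.coeFn_zero _ _ _)
    exact Measure.eqOn_open_of_ae_eq
      (ae_restrict_of_ae_restrict_of_subset (refInterior_subset n) h1)
      (isOpen_refInterior n) (hcont q).continuousOn continuousOn_const
  obtain ⟨κ, hκ, hΛ⟩ := Λ.exists_antilipschitzWith hker
  refine ⟨1 / ((Fintype.card ι + 1) * κ ^ 2), by positivity, fun q => ?_⟩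
  have h1 : ‖Λ q‖ ^ 2 = ∫ s in refSimplex n, ‖∑ i, f i s • q i‖ ^ 2 := by
    rw [← real_inner_self_eq_norm_sq, L2.inner_def, hΛeq]
    refine integral_congr_ae ?_
    filter_upwards [(hmem q).coeFn_toLp] with s hs
    rw [hs, real_inner_self_eq_norm_sq]
  have h2 : ‖q‖ ≤ κ * ‖Λ q‖ := by
    simpa using hΛ.le_mul_dist q 0
  rw [← h1, one_div, inv_mul_le_iff₀ (by positivity)]
  calc ∑ i, ‖q i‖ ^ 2 ≤ ∑ _i : ι, ‖q‖ ^ 2 := by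
        refine Finset.sum_le_sum fun i _ => ?_
        have := norm_le_pi_norm q i
        gcongr
    _ = Fintype.card ι * ‖q‖ ^ 2 := by
        rw [Finset.sum_const, nsmul_eq_mul, Finset.card_univ]
    _ ≤ (Fintype.card ι + 1) * (κ * ‖Λ q‖) ^ 2 := by gcongr; linarith
    _ = _ := by ring

/-- The Bernstein coefficients are bounded by the `L²` norm on the reference simplex. -/
lemma exists_refBern_lower (n l m : ℕ) : ∃ c : ℝ, 0 < c ∧ ∀ q : (Fin (n + 1) →₀ ℕ) → E l,
    c * ∑ β ∈ refIdx n m, ‖q β‖ ^ 2 ≤ ∫ s in refSimplex n, ‖refBern m q s‖ ^ 2 := by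
  classical
  obtain ⟨c, hc, h⟩ := exists_lower_of_injective (l := l)
    (fun (β : refIdx n m) (s : Fin n → ℝ) => ∏ i, refBary s i ^ (β : Fin (n + 1) →₀ ℕ) i)
    (fun β => continuous_finsetProd _ fun i _ => (continuous_refBary i).pow _) (by
      intro q hq
      have h4 := refBern_injective (m := m)
        (fun β => if h : β ∈ refIdx n m then q ⟨β, h⟩ else 0) (fun s hs => by
          rw [refBern, ← hq s hs, ← Finset.sum_coe_sort]
          simp)
      funext β
      have := h4 β β.2
      simpa using this)
  refine ⟨c, hc, fun q => ?_⟩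
  have h1 := h fun β => q β
  simp only [Finset.sum_coe_sort (refIdx n m) fun β => ‖q β‖ ^ 2] at h1
  refine h1.trans_eq ?_
  simp only [refBern]
  congr 1
  funext s
  exact congrArg (fun v => ‖v‖ ^ 2)
    (Finset.sum_coe_sort (refIdx n m) fun β => (∏ i, refBary s i ^ β i) • q β)

/-! ### Bernstein coefficients and the surface measure of a face -/

/-- An enumeration of the vertices of `F` identifies its multi-indices with those of the reference
simplex. -/
lemma sum_bernIdx_eq {n m : ℕ} {M : Type*} [AddCommMonoid M] {b : Fin (n + 1) → E d}
    (hb : ∀ i, b i ∈ F) (hinj : Function.Injective b) (hc : F.card = n + 1)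
    (H : (E d →₀ ℕ) → M) :
    ∑ α ∈ bernIdx m F, H α = ∑ β ∈ refIdx n m, H (β.embDomain ⟨b, hinj⟩) := by
  classical
  have hrange : ∀ x ∈ F, x ∈ Set.range b := by
    have himg := image_enum hb hinj hc
    intro x hx
    rw [← himg] at hx
    obtain ⟨i, -, rfl⟩ := Finset.mem_image.1 hx
    exact ⟨i, rfl⟩
  refine (Finset.sum_bij (fun β _ => Finsupp.embDomain ⟨b, hinj⟩ β) ?_ ?_ ?_ ?_).symm
  · intro β hβ
    have hβm := mem_refIdx.1 hβ
    rw [mem_bernIdx]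
    constructor
    · rw [← sum_enum hb hinj hc, ← hβm]
      exact Finset.sum_congr rfl fun i _ => Finsupp.embDomain_apply_self ⟨b, hinj⟩ β i
    · intro x hx
      rw [Finsupp.support_embDomain, Finset.mem_map] at hx
      obtain ⟨i, -, rfl⟩ := hx
      exact hb i
  · exact fun β _ β' _ h => Finsupp.embDomain_injective _ h
  · intro α hα
    rw [mem_bernIdx] at hα
    have hg : (α.support : Set (E d)) ⊆ Set.range (⟨b, hinj⟩ : Fin (n + 1) ↪ E d) :=
      fun x hx => hrange x (hα.2 hx)
    refine ⟨Finsupp.comapDomain b α hinj.injOn, ?_, Finsupp.embDomain_comapDomain hg⟩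
    rw [mem_refIdx, ← hα.1, ← sum_enum hb hinj hc]
    rfl
  · intros; rfl

lemma prod_embDomain {n : ℕ} {b : Fin (n + 1) → E d} (hb : ∀ i, b i ∈ F)
    (hinj : Function.Injective b) (hc : F.card = n + 1) (f : E d → ℝ) (β : Fin (n + 1) →₀ ℕ) :
    ∏ a ∈ F, f a ^ (β.embDomain ⟨b, hinj⟩) a = ∏ i, f (b i) ^ β i := by
  have h := sum_enum (M := Additive ℝ) hb hinj hc
    fun a => Additive.ofMul (f a ^ (β.embDomain ⟨b, hinj⟩) a)
  have h1 : ∏ i, f (b i) ^ (β.embDomain ⟨b, hinj⟩) (b i) =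
    ∏ a ∈ F, f a ^ (β.embDomain ⟨b, hinj⟩) a := h
  rw [← h1]
  exact Finset.prod_congr rfl fun i _ => by
    rw [show (β.embDomain ⟨b, hinj⟩) (b i) = β i from Finsupp.embDomain_apply_self ⟨b, hinj⟩ β i]

open Measure in
/-- A Lipschitz map increases the surface measure at most by a power of its constant. -/
lemma euclideanHausdorffMeasure_image_le {X Y : Type*} [EMetricSpace X] [MeasurableSpace X]
    [BorelSpace X] [EMetricSpace Y] [MeasurableSpace Y] [BorelSpace Y] {κ : NNReal} {f : X → Y}
    (hf : LipschitzWith κ f) (n : ℕ) (S : Set X) :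
    μHE[n] (f '' S) ≤ (κ : ENNReal) ^ n * μHE[n] S := by
  have h := hf.hausdorffMeasure_image_le (Nat.cast_nonneg (α := ℝ) n) S
  rw [euclideanHausdorffMeasure_def, euclideanHausdorffMeasure_def, Measure.smul_apply,
    Measure.smul_apply, ENNReal.smul_def, ENNReal.smul_def, smul_eq_mul, smul_eq_mul,
    mul_left_comm]
  rw [ENNReal.rpow_natCast] at h
  gcongr

lemma euclideanHausdorffMeasure_face_ne_top {n : ℕ} (hc : F.card = n + 1) :
    (μHE[n] : Measure (E d)) (hull F) ≠ ⊤ := by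
  obtain ⟨b, hb, hinj⟩ := exists_enum hc
  let A : E n →ₗ[ℝ] E d :=
    { toFun := fun s => ∑ j, s j • (b j.succ - b 0)
      map_add' := fun s t => by simp [add_smul, Finset.sum_add_distrib]
      map_smul' := fun r s => by simp [Finset.smul_sum, mul_smul] }
  have hlip : LipschitzWith ‖LinearMap.toContinuousLinearMap A‖₊ (fun s : E n => A s + b 0) := by
    have h1 := (LinearMap.toContinuousLinearMap A).lipschitz
    refine LipschitzWith.of_dist_le_mul fun x y => ?_
    rw [dist_add_right]
    exact h1.dist_le_mul x y
  have himg : hull F = (fun s : E n => A s + b 0) '' (WithLp.ofLp ⁻¹' refSimplex n) := by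
    rw [← image_simplexPt hb hinj hc]
    ext x
    constructor
    · rintro ⟨s, hs, rfl⟩
      exact ⟨WithLp.toLp 2 s, hs, (simplexPt_eq_add b s).symm⟩
    · rintro ⟨s, hs, rfl⟩
      exact ⟨WithLp.ofLp s, hs, simplexPt_eq_add b _⟩
  rw [himg]
  refine ne_top_of_le_ne_top ?_ (euclideanHausdorffMeasure_image_le hlip n _)
  rw [EuclideanSpace.euclideanHausdorffMeasure_eq_volume]
  refine ENNReal.mul_ne_top (by simp) ?_
  rw [(PiLp.volume_preserving_ofLp (Fin n)).measure_preimage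
    (measurableSet_refSimplex n).nullMeasurableSet]
  exact volume_refSimplex_ne_top n

lemma bary_simplexPt {n : ℕ} (hK : IsSimplex K) (hFK : F ⊆ K) {b : Fin (n + 1) → E d}
    (hb : ∀ i, b i ∈ F) (hinj : Function.Injective b) (hc : F.card = n + 1) (s : Fin n → ℝ)
    (i : Fin (n + 1)) : bary K (b i) (simplexPt b s) = refBary s i := by
  set w : E d → ℝ := Function.extend b (refBary s) 0
  have hw : ∀ i, w (b i) = refBary s i := fun i => hinj.extend_apply _ _ i
  have h1 : simplexPt b s = ∑ a ∈ F, w a • a := by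
    rw [← sum_enum hb hinj hc]
    simp only [hw]
    rfl
  rw [h1, bary_combination hK hFK, if_pos (hb i), hw]
  rw [← sum_enum hb hinj hc]
  simp only [hw, sum_refBary]

/-- On a face, the Bernstein coefficients are bounded by the `L²` norm, with the right scaling.
The barycentric coordinates map the face to the reference simplex with Lipschitz constant
`(n + 1) / ρ_K`. -/
lemma exists_face_lower (n l m : ℕ) : ∃ c : ℝ, 0 < c ∧ ∀ (K F : Finset (E (n + 1))),
    IsSimplex K → F ⊆ K → F.card = n + 1 → ∀ q : (E (n + 1) →₀ ℕ) → E l,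
    c * inscribedDiam K ^ n * ∑ α ∈ bernIdx m F, ‖q α‖ ^ 2 ≤
      ∫ x in hull F, ‖∑ α ∈ bernIdx m F, (∏ a ∈ F, bary K a x ^ α a) • q α‖ ^ 2
        ∂(Measure.euclideanHausdorffMeasure n) := by
  obtain ⟨c, hc0, hlow⟩ := exists_refBern_lower n l m
  refine ⟨c / (n + 1) ^ n, by positivity, fun K F hK hFK hc q => ?_⟩
  obtain ⟨b, hb, hinj⟩ := exists_enum hc
  have hρ := inscribedDiam_pos hK (by omega)
  set κ : NNReal := ⟨(n + 1) / inscribedDiam K, by positivity⟩ with hκ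
  set q' : (Fin (n + 1) →₀ ℕ) → E l := fun β => q (β.embDomain ⟨b, hinj⟩) with hq'
  set ψ : E (n + 1) → E n := fun x => WithLp.toLp 2 fun j => bary K (b j.succ) x with hψ
  have hψlip : LipschitzWith κ ψ := by
    refine LipschitzWith.of_dist_le_mul fun x y => ?_
    rw [dist_eq_norm, dist_eq_norm]
    have h1 : ψ x - ψ y = ∑ j : Fin n,
        inner ℝ (grad K (b j.succ)) (x - y) • (EuclideanSpace.single j (1 : ℝ) : E n) := by
      ext i
      simp [hψ, Finset.sum_apply, Pi.single_apply, ← bary_sub]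
    rw [h1]
    refine (norm_sum_le _ _).trans ?_
    have h2 : ∀ j : Fin n, ‖inner ℝ (grad K (b j.succ)) (x - y) •
        (EuclideanSpace.single j (1 : ℝ) : E n)‖ ≤ 1 / inscribedDiam K * ‖x - y‖ := by
      intro j
      rw [norm_smul, PiLp.norm_single, norm_one, mul_one]
      refine (norm_inner_le_norm _ _).trans (mul_le_mul_of_nonneg_right ?_ (norm_nonneg _))
      rw [le_div_iff₀ hρ]
      exact norm_grad_mul_inscribedDiam_le hK _
    refine (Finset.sum_le_sum fun j _ => h2 j).trans ?_
    rw [Finset.sum_const, Finset.card_univ, Fintype.card_fin, nsmul_eq_mul, ← mul_assoc]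
    refine mul_le_mul_of_nonneg_right ?_ (norm_nonneg _)
    change _ ≤ ((n : ℝ) + 1) / inscribedDiam K
    rw [mul_one_div]
    gcongr
    linarith
  have hψF : ∀ x ∈ hull F, ∀ i, refBary (WithLp.ofLp (ψ x)) i = bary K (b i) x := by
    intro x hx i
    have h1 : ∑ i, bary K (b i) x = 1 := by
      rw [sum_enum hb hinj hc (fun a => bary K a x), ← sum_bary hK x]
      exact Finset.sum_subset hFK ((mem_hull_face_iff hK hFK).1 hx).2
    rw [Fin.sum_univ_succ] at h1
    refine Fin.cases ?_ (fun j => ?_) i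
    · simp only [refBary, Fin.cons_zero, hψ]
      linarith
    · simp [refBary, hψ]
  have hψmem : ∀ x ∈ hull F, WithLp.ofLp (ψ x) ∈ refSimplex n := fun x hx => by
    rw [mem_refSimplex_iff]
    intro i
    rw [hψF x hx]
    exact ((mem_hull_face_iff hK hFK).1 hx).1 _ (hb i)
  have hψsurj : ∀ s : E n, WithLp.ofLp s ∈ refSimplex n → ∃ x ∈ hull F, ψ x = s := by
    intro s hs
    refine ⟨simplexPt b (WithLp.ofLp s), mem_hull_of_refSimplex hb hs, ?_⟩
    ext j
    change bary K (b j.succ) (simplexPt b (WithLp.ofLp s)) = s j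
    rw [bary_simplexPt hK hFK hb hinj hc]
    simp [refBary]
  set S : Set (E n) := WithLp.ofLp ⁻¹' refSimplex n with hS
  set ν : Measure (E n) := ((κ : ENNReal) ^ n) •
    ((Measure.euclideanHausdorffMeasure n).restrict (hull F)).map ψ with hν
  have hle : volume.restrict S ≤ ν := by
    rw [Measure.le_iff]
    intro B hB
    rw [Measure.restrict_apply hB, hν, Measure.smul_apply, smul_eq_mul,
      Measure.map_apply hψlip.continuous.measurable hB,
      Measure.restrict_apply (hψlip.continuous.measurable hB),
      ← EuclideanSpace.euclideanHausdorffMeasure_eq_volume]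
    refine (measure_mono ?_).trans (euclideanHausdorffMeasure_image_le hψlip n _)
    rintro s ⟨hsB, hsS⟩
    obtain ⟨x, hx, rfl⟩ := hψsurj s hsS
    exact ⟨x, ⟨hsB, hx⟩, rfl⟩
  set G : E n → ℝ := fun s => ‖refBern m q' (WithLp.ofLp s)‖ ^ 2 with hG
  have hGc : Continuous G :=
    ((continuous_refBern q').comp (PiLp.continuous_ofLp 2 _)).norm.pow 2
  have hGF : ∀ x ∈ hull F, G (ψ x) =
      ‖∑ α ∈ bernIdx m F, (∏ a ∈ F, bary K a x ^ α a) • q α‖ ^ 2 := by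
    intro x hx
    rw [sum_bernIdx_eq hb hinj hc, hG]
    simp only [refBern, hψF x hx, prod_embDomain hb hinj hc (fun a => bary K a x)]
    rfl
  have hGi : IntegrableOn (fun x => G (ψ x)) (hull F) (Measure.euclideanHausdorffMeasure n) := by
    rw [IntegrableOn, ← memLp_one_iff_integrable]
    exact memLp_of_isCompact (isCompact_hull F) (measurableSet_hull F)
      (euclideanHausdorffMeasure_face_ne_top hc) (hGc.comp hψlip.continuous) 1
  have hGν : Integrable G ν := by
    rw [hν]
    refine Integrable.smul_measure ?_ (by simp)
    rw [integrable_map_measure hGc.aestronglyMeasurable hψlip.continuous.measurable.aemeasurable]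
    exact hGi
  have h1 := integral_mono_measure hle (Filter.Eventually.of_forall fun s => by
    simp only [hG]; positivity) hGν
  have h2 : ∫ s, G s ∂(volume.restrict S) = ∫ s in refSimplex n, ‖refBern m q' s‖ ^ 2 :=
    (PiLp.volume_preserving_ofLp (Fin n)).setIntegral_preimage_emb
      (MeasurableEquiv.toLp 2 (Fin n → ℝ)).symm.measurableEmbedding
      (fun s => ‖refBern m q' s‖ ^ 2) (refSimplex n)
  rw [h2, hν, integral_smul_measure, integral_map hψlip.continuous.measurable.aemeasurable
    hGc.aestronglyMeasurable, setIntegral_congr_fun (measurableSet_hull F) hGF] at h1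
  have h3 := (hlow q').trans h1
  rw [sum_bernIdx_eq hb hinj hc]
  have h4 : ((κ : ENNReal) ^ n).toReal = ((n + 1) / inscribedDiam K) ^ n := by
    rw [ENNReal.toReal_pow]; rfl
  rw [h4, smul_eq_mul, div_pow, div_mul_eq_mul_div, le_div_iff₀ (by positivity)] at h3
  rw [div_mul_eq_mul_div, div_mul_eq_mul_div, div_le_iff₀ (by positivity)]
  calc _ = c * ∑ β ∈ refIdx n m, ‖q' β‖ ^ 2 * inscribedDiam K ^ n := by
        rw [Finset.mul_sum, Finset.mul_sum]
        exact Finset.sum_congr rfl fun β _ => by ring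
    _ = c * (∑ β ∈ refIdx n m, ‖q' β‖ ^ 2) * inscribedDiam K ^ n := by
        rw [← Finset.sum_mul, mul_assoc]
    _ ≤ _ := h3.trans_eq (mul_comm _ _)

/-! ### Tangential degrees of freedom of the Bernstein coefficients -/

/-- The functionals `ℓ r a`, for vertices `r` and `a`, are degrees of freedom for the tangential
part of vectors with respect to the product `cross`: on a simplex `K` with a chosen root `r`, the
values `ℓ r a v`, `a ∈ K`, can be prescribed and control `v`, and for a face of `K` with normal `n`
the values at the vertices `a` of this face are exactly the information contained in
`cross n v`. -/
structure IsFrame {d k l : ℕ} (cross : E d → E k → E l) (ℓ : E d → E d → E k →ₗ[ℝ] ℝ) : Prop where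
  exists_eq : ∀ {K : Finset (E d)}, IsSimplex K → ∀ {r}, r ∈ K → ∀ w : E d → E k,
    ∃ v, ∀ b ∈ K, ℓ r b v = ℓ r b (w b)
  norm_le : ∀ {K : Finset (E d)}, IsSimplex K → ∀ {r}, r ∈ K → ∀ {σ : ℝ}, 1 ≤ σ →
    size K ≤ σ * inscribedDiam K → ∀ v, ‖v‖ ≤ σ * ∑ a ∈ K, |ℓ r a v|
  le_norm_cross : ∀ {K F : Finset (E d)}, IsSimplex K → F ⊆ K → F.card = d →
    ∀ {r a}, r ∈ F → a ∈ F → ∀ v, |ℓ r a v| ≤ ‖cross (outwardNormal K F) v‖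
  cross_eq_zero : ∀ {K F : Finset (E d)}, IsSimplex K → F ⊆ K → F.card = d →
    ∀ {r}, r ∈ F → ∀ v, (∀ a ∈ F, ℓ r a v = 0) → cross (outwardNormal K F) v = 0

/-- The component of a vector along the edge from `r` to `a`. -/
def edgeDof {d : ℕ} (r a : E d) : E d →ₗ[ℝ] ℝ := (innerSL ℝ (‖a - r‖⁻¹ • (a - r))).toLinearMap

lemma edgeDof_apply (r a v : E d) : edgeDof r a v = ‖a - r‖⁻¹ * inner ℝ v (a - r) := by
  rw [← real_inner_comm v]
  exact real_inner_smul_left (a - r) v _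

lemma edgeDof_mul_norm (r a v : E d) : edgeDof r a v * ‖a - r‖ = inner ℝ v (a - r) := by
  rw [edgeDof_apply]
  by_cases h : a - r = 0
  · simp [h]
  · have := norm_ne_zero_iff.2 h
    field_simp

/-- A product satisfying Lagrange's identity has the edge components as degrees of freedom. -/
lemma isFrame_edgeDof (hd : 1 ≤ d) {l : ℕ} {cross : E d → E d → E l}
    (hcross : ∀ a v, ‖cross a v‖ ^ 2 = ‖a‖ ^ 2 * ‖v‖ ^ 2 - inner ℝ a v ^ 2) :
    IsFrame cross edgeDof where
  exists_eq := by
    intro K h r hr w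
    refine ⟨∑ b ∈ K, inner ℝ (w b) (b - r) • grad K b, fun c hc => ?_⟩
    rw [edgeDof_apply, edgeDof_apply]
    congr 1
    by_cases hcr : c = r
    · simp [hcr]
    rw [sum_inner, Finset.sum_eq_single c]
    · rw [inner_smul_left, inner_grad_sub h hc hr hc (Ne.symm hcr)]
      simp
    · intro b hb hbc
      rw [inner_smul_left]
      by_cases hbr : r = b
      · simp [hbr]
      · rw [inner_grad_sub h hb hr hc hbr, if_neg (Ne.symm hbc), mul_zero]
    · exact fun h => absurd hc h
  norm_le := by
    intro K h r hr σ hσ hs v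
    conv_lhs => rw [← sum_inner_smul_grad h v r]
    rw [Finset.mul_sum]
    refine (norm_sum_le _ _).trans (Finset.sum_le_sum fun a ha => ?_)
    rw [norm_smul, Real.norm_eq_abs, ← edgeDof_mul_norm, abs_mul, abs_norm, mul_comm σ, mul_assoc]
    refine mul_le_mul_of_nonneg_left ?_ (abs_nonneg _)
    have h1 : ‖a - r‖ ≤ size K := dist_le_size (mem_hull_of_mem ha) (mem_hull_of_mem hr)
    have h2 := norm_grad_mul_inscribedDiam_le h a
    calc ‖a - r‖ * ‖grad K a‖ ≤ σ * inscribedDiam K * ‖grad K a‖ :=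
          mul_le_mul_of_nonneg_right (h1.trans hs) (norm_nonneg _)
      _ = σ * (‖grad K a‖ * inscribedDiam K) := by ring
      _ ≤ σ * 1 := mul_le_mul_of_nonneg_left h2 (by linarith)
      _ = σ := mul_one σ
  le_norm_cross := by
    intro K F h hF hc r a hr ha v
    set n := outwardNormal K F with hn
    have hn1 : ‖n‖ = 1 := norm_outwardNormal h hd hF hc
    have hna : inner ℝ n (a - r) = 0 := inner_outwardNormal h hd hF hc ha hr
    have h1 : ‖v - inner ℝ n v • n‖ ^ 2 = ‖cross n v‖ ^ 2 := by
      rw [hcross, hn1, norm_sub_sq_real, inner_smul_right, norm_smul, hn1, Real.norm_eq_abs,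
        real_inner_comm, mul_one, sq_abs]
      ring
    have h2 : ‖v - inner ℝ n v • n‖ = ‖cross n v‖ :=
      (sq_eq_sq₀ (norm_nonneg _) (norm_nonneg _)).1 h1
    rw [← h2, edgeDof_apply]
    have h3 : inner ℝ v (a - r) = inner ℝ (v - inner ℝ n v • n) (a - r) := by
      rw [inner_sub_left, inner_smul_left, hna, mul_zero, sub_zero]
    rw [h3, abs_mul, abs_inv, abs_norm]
    by_cases hz : a - r = 0
    · simp [hz]
    · rw [inv_mul_le_iff₀ (norm_pos_iff.2 hz), mul_comm]
      exact abs_real_inner_le_norm _ _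
  cross_eq_zero := by
    intro K F h hF hc r hr v hv
    obtain ⟨t, ht⟩ := eq_smul_outwardNormal (r := r) (v := v) h hd hF hc (fun b hb => by
      rw [← edgeDof_mul_norm, hv b hb, zero_mul])
    have h1 := hcross (outwardNormal K F) v
    rw [ht, inner_smul_right, norm_smul, real_inner_self_eq_norm_sq,
      norm_outwardNormal h hd hF hc, Real.norm_eq_abs, mul_one, sq_abs] at h1
    rw [ht, ← norm_eq_zero, ← sq_eq_zero_iff, h1]
    ring

/-- The value of a scalar, attached to the root vertex only. -/
def rootDof {d : ℕ} (r a : E d) : E 1 →ₗ[ℝ] ℝ :=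
  open Classical in if a = r then (EuclideanSpace.proj (0 : Fin 1) : E 1 →L[ℝ] ℝ).toLinearMap else 0

lemma norm_eq_abs_coord (v : E 1) : ‖v‖ = |v 0| := by
  rw [EuclideanSpace.norm_eq]; simp [Real.sqrt_sq_eq_abs]

lemma isFrame_rootDof (hd : 1 ≤ d) {l : ℕ} {cross : E d → E 1 → E l}
    (hcross : ∀ a v, ‖cross a v‖ = ‖a‖ * ‖v‖) : IsFrame cross rootDof where
  exists_eq := by
    intro K h r hr w
    refine ⟨w r, fun b hb => ?_⟩
    by_cases hbr : b = r
    · rw [hbr]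
    · simp [rootDof, hbr]
  norm_le := by
    intro K h r hr σ hσ hs v
    have h1 : |rootDof r r v| ≤ ∑ a ∈ K, |rootDof r a v| :=
      Finset.single_le_sum (f := fun a => |rootDof r a v|) (fun a _ => abs_nonneg _) hr
    have h2 : ‖v‖ = |rootDof r r v| := by rw [norm_eq_abs_coord]; simp [rootDof]
    rw [h2]
    nlinarith [abs_nonneg (rootDof r r v)]
  le_norm_cross := by
    intro K F h hF hc r a hr ha v
    rw [hcross, norm_outwardNormal h hd hF hc, one_mul, norm_eq_abs_coord]
    by_cases har : a = r
    · simp [rootDof, har]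
    · simp [rootDof, har]
  cross_eq_zero := by
    intro K F h hF hc r hr v hv
    have h1 : |v 0| = 0 := by simpa [rootDof] using hv r hr
    rw [← norm_eq_zero, hcross, norm_eq_abs_coord, h1, mul_zero]

/-! ### Face-connected components of vertex stars -/

lemma abs_sub_le_of_reachable {V : Type*} (G : SimpleGraph V) {s : Finset V}
    (hs : ∀ a b, G.Adj a b → b ∈ s) {x y : V} (hx : x ∈ s) (h : G.Reachable x y) (f : V → ℝ)
    {δ : ℝ} (hδ : 0 ≤ δ)
    (hadj : ∀ a b, G.Reachable x a → G.Adj a b → |f a - f b| ≤ δ) :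
    |f x - f y| ≤ s.card * δ := by
  classical
  have key : ∀ {z y : V} (p : G.Walk z y), G.Reachable x z → |f z - f y| ≤ p.length * δ := by
    intro z y p
    induction p with
    | nil => intro _; simp
    | cons hab p ih =>
      intro hz
      have h1 := hadj _ _ hz hab
      have h2 := ih (hz.trans hab.reachable)
      rw [SimpleGraph.Walk.length_cons]
      push_cast
      calc _ ≤ _ := abs_sub_le _ _ _
        _ ≤ _ := add_le_add h1 h2
        _ = _ := by ring
  have hsupp : ∀ {z y : V} (p : G.Walk z y), z ∈ s → ∀ a ∈ p.support, a ∈ s := by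
    intro z y p
    induction p with
    | nil => intro hz a ha; simp at ha; rwa [ha]
    | cons hab p ih =>
      intro hz a ha
      rw [SimpleGraph.Walk.support_cons, List.mem_cons] at ha
      rcases ha with rfl | ha
      · exact hz
      · exact ih (hs _ _ hab) a ha
  obtain ⟨p, hp⟩ := h.exists_isPath
  refine (key p (SimpleGraph.Reachable.refl x)).trans (mul_le_mul_of_nonneg_right ?_ hδ)
  have h1 : p.support.toFinset.card = p.length + 1 := by
    rw [List.toFinset_card_of_nodup hp.support_nodup, SimpleGraph.Walk.length_support]
  have h2 : p.support.toFinset ⊆ s := fun a ha => hsupp p hx a (List.mem_toFinset.1 ha)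
  have h3 := Finset.card_le_card h2
  exact_mod_cast (by omega : p.length ≤ s.card)

/-- Values can be made constant on the connected components of a graph, keeping one of the values
on each component, except that components meeting `P` get the value `z`. -/
lemma exists_component_value {V X : Type*} (G : SimpleGraph V) (f : V → X) (z : X) (P : V → Prop) :
    ∃ w : V → X, (∀ x y, G.Reachable x y → w x = w y) ∧ ∀ x,
      ((∃ y, G.Reachable x y ∧ P y) ∧ w x = z) ∨
      ((∀ y, G.Reachable x y → ¬ P y) ∧ ∃ y, G.Reachable x y ∧ w x = f y) := by
  classical
  refine ⟨fun x => if ∃ y, G.Reachable x y ∧ P y then z else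
    f (G.connectedComponentMk x).out, fun x y h => ?_, fun x => ?_⟩
  · have h1 : (∃ t, G.Reachable x t ∧ P t) ↔ ∃ t, G.Reachable y t ∧ P t :=
      exists_congr fun t => and_congr_left fun _ => ⟨h.symm.trans, h.trans⟩
    simp only [h1, SimpleGraph.ConnectedComponent.eq.2 h]
  · by_cases hx : ∃ y, G.Reachable x y ∧ P y
    · exact Or.inl ⟨hx, if_pos hx⟩
    · refine Or.inr ⟨fun y hy hP => hx ⟨y, hy, hP⟩, (G.connectedComponentMk x).out, ?_, if_neg hx⟩
      exact SimpleGraph.ConnectedComponent.exact (Quot.out_eq (G.connectedComponentMk x)).symm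

namespace Mesh

variable {Ω : Set (E d)} (T : Mesh Ω)

/-- Two elements are adjacent in the star of `g` if they share a face containing `g`. -/
def starGraph (g : Finset (E d)) : SimpleGraph (Finset (E d)) where
  Adj K L := K ≠ L ∧ ∃ F, F.card = d ∧ g ⊆ F ∧ K ∈ T.cellsAt F ∧ L ∈ T.cellsAt F
  symm := ⟨by
    rintro K L ⟨h, F, hc, hg, hK, hL⟩
    exact ⟨h.symm, F, hc, hg, hL, hK⟩⟩
  loopless := ⟨fun _ h => h.1 rfl⟩

variable {T}

lemma mem_cellsAt_mono {g : Finset (E d)} (hg : g ⊆ F) (hK : K ∈ T.cellsAt F) :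
    K ∈ T.cellsAt g := by
  rw [mem_cellsAt] at hK ⊢
  exact ⟨hK.1, hg.trans hK.2⟩

lemma mem_cellsAt_of_adj {g : Finset (E d)} (h : (T.starGraph g).Adj K L) : L ∈ T.cellsAt g := by
  obtain ⟨-, F, -, hg, -, hL⟩ := h
  exact mem_cellsAt_mono hg hL

lemma mem_cellsAt_of_reachable {g : Finset (E d)} (hK : K ∈ T.cellsAt g)
    (h : (T.starGraph g).Reachable K L) : L ∈ T.cellsAt g := by
  obtain ⟨p⟩ := h
  induction p with
  | nil => exact hK
  | cons hab p ih => exact ih (mem_cellsAt_of_adj hab)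

/-- Elements that are face-connected in the star of a vertex have comparable sizes. -/
lemma size_le_of_reachable (hd : 2 ≤ d) {σ : ℝ} (hσ : T.ShapeRegular σ) {N : ℕ}
    (hN : ∀ F : Finset (E d), F.Nonempty → (T.cellsAt F).card ≤ N) {g : Finset (E d)}
    (hg : g.Nonempty) (hK : K ∈ T.cellsAt g) (h : (T.starGraph g).Reachable K L) :
    size L ≤ σ ^ N * size K ∧ size K ≤ σ ^ N * size L := by
  have hpos : ∀ M ∈ T.cells, 0 < size M := fun M hM =>
    size_pos (T.isSimplex M hM) (by omega) subset_rfl (by rw [(T.isSimplex M hM).1]; omega)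
  have hKc := (T.mem_cellsAt.1 hK).1
  have hLc := (T.mem_cellsAt.1 (mem_cellsAt_of_reachable hK h)).1
  have h1σ := T.one_le_of_shapeRegular (by omega) hσ hKc
  have hlog : 0 ≤ Real.log σ := Real.log_nonneg h1σ
  have hstep : ∀ A B, (T.starGraph g).Adj A B →
      Real.log (size A) - Real.log (size B) ≤ Real.log σ := by
    rintro A B ⟨-, F, hc, -, hA, hB⟩
    rw [mem_cellsAt] at hA hB
    have h1 := T.size_le_mul_size (by omega) hσ hA.1 hA.2 (by omega)
    have h2 : size F ≤ size B := size_mono hB.2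
    have h3 : size A ≤ σ * size B := h1.trans (mul_le_mul_of_nonneg_left h2 (by linarith))
    have h4 := Real.log_le_log (hpos A hA.1) h3
    rw [Real.log_mul (by linarith) (hpos B hB.1).ne'] at h4
    linarith
  have h1 := abs_sub_le_of_reachable (T.starGraph g) (fun _ _ => mem_cellsAt_of_adj) hK h
    (fun M => Real.log (size M)) hlog (fun A B _ hAB => abs_le.2 ⟨by
      have := hstep B A hAB.symm
      linarith, hstep A B hAB⟩)
  have h2 : |Real.log (size K) - Real.log (size L)| ≤ Real.log (σ ^ N) := by
    rw [Real.log_pow]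
    exact h1.trans (mul_le_mul_of_nonneg_right (by exact_mod_cast hN g hg) hlog)
  rw [abs_le] at h2
  have hσN : 0 < σ ^ N := by positivity
  constructor
  · rw [← Real.log_le_log_iff (hpos L hLc) (mul_pos hσN (hpos K hKc)),
      Real.log_mul hσN.ne' (hpos K hKc).ne']
    linarith
  · rw [← Real.log_le_log_iff (hpos K hKc) (mul_pos hσN (hpos L hLc)),
      Real.log_mul hσN.ne' (hpos L hLc).ne']
    linarith

end Mesh

/-! ### Averaging the degrees of freedom -/

namespace Mesh

variable {Ω : Set (E d)} (T : Mesh Ω)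

/-- The Bernstein coefficient with index `α` of the tangential jump over the face `F` of the
piecewise polynomial with Bernstein coefficients `c K` on the elements `K`. -/
def jumpCoef {k l : ℕ} (cross : E d → E k → E l) (c : Finset (E d) → (E d →₀ ℕ) → E k)
    (F : Finset (E d)) (α : E d →₀ ℕ) : E l :=
  ∑ K ∈ T.cellsAt F, cross (outwardNormal K F) (c K α)

open Classical in
/-- The faces in `𝓕` that meet the element `K` and have a size comparable to that of `K`. -/
def nearFaces (κ : ℝ) (𝓕 : Finset (Finset (E d))) (K : Finset (E d)) : Finset (Finset (E d)) :=
  𝓕.filter fun F => (∃ a ∈ F, a ∈ K) ∧ size F ≤ κ * size K ∧ size K ≤ κ * size F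

variable {T}

lemma mem_nearFaces {κ : ℝ} {𝓕 : Finset (Finset (E d))} :
    F ∈ nearFaces κ 𝓕 K ↔
      F ∈ 𝓕 ∧ (∃ a ∈ F, a ∈ K) ∧ size F ≤ κ * size K ∧ size K ≤ κ * size F := by
  simp [nearFaces]

lemma ShapeRegular.mono {σ τ : ℝ} (h : T.ShapeRegular σ) (hστ : σ ≤ τ) : T.ShapeRegular τ :=
  fun K hK => (h K hK).trans hστ

variable {k l : ℕ} {cross : E d → E k → E l} {crossT : E d → E l → E k}
  {ℓ : E d → E d → E k →ₗ[ℝ] ℝ}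

lemma jumpCoef_eq_of_ne (hd : 1 ≤ d) (hx : IsCrossPair cross crossT)
    (c : Finset (E d) → (E d →₀ ℕ) → E k) (hc : F.card = d) (hK : K ∈ T.cellsAt F)
    (hL : L ∈ T.cellsAt F) (hKL : K ≠ L) (α : E d →₀ ℕ) :
    T.jumpCoef cross c F α = cross (outwardNormal K F) (c K α - c L α) := by
  classical
  have hK' := T.mem_cellsAt.1 hK
  have hL' := T.mem_cellsAt.1 hL
  rw [jumpCoef, T.cellsAt_eq_pair hd hc hK hL hKL, Finset.sum_pair hKL,
    T.outwardNormal_opposite hd hK'.1 hL'.1 hKL hK'.2 hL'.2 hc, hx.neg_left, hx.sub_right,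
    sub_eq_add_neg]

lemma jumpCoef_eq_of_notMem (c : Finset (E d) → (E d →₀ ℕ) → E k) (hF : F ∈ T.faces)
    (hFi : F ∉ T.interiorFaces) (hK : K ∈ T.cellsAt F) (α : E d →₀ ℕ) :
    T.jumpCoef cross c F α = cross (outwardNormal K F) (c K α) := by
  rw [jumpCoef, T.cellsAt_eq_singleton hF hFi hK, Finset.sum_singleton]

/-- Bernstein coefficients can be changed to remove the tangential jumps over all interior faces
and over some of the boundary faces; the change is controlled by the removed jumps nearby.

A degree of freedom `ℓ r b` of the coefficient with index `α`, with `r` a fixed vertex in the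
support of `α`, enters the jumps over the faces that contain `supp α ∪ {b}`. It is changed to a
common value on each face-connected component of the star of `supp α ∪ {b}`. -/
theorem exists_conforming_coef (hd : 2 ≤ d) (hx : IsCrossPair cross crossT) (hℓ : IsFrame cross ℓ)
    {m : ℕ} (hm : 1 ≤ m) (σ : ℝ) :
    ∃ C κ : ℝ, 0 < C ∧ 0 < κ ∧ ∀ (Ω : Set (E d)) (T : Mesh Ω), T.ShapeRegular σ →
      ∀ 𝓕 : Finset (Finset (E d)), T.interiorFaces ⊆ 𝓕 → 𝓕 ⊆ T.faces →
      ∀ c : Finset (E d) → (E d →₀ ℕ) → E k, ∃ c' : Finset (E d) → (E d →₀ ℕ) → E k,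
        (∀ F ∈ 𝓕, ∀ α ∈ bernIdx m F, T.jumpCoef cross c' F α = 0) ∧
        ∀ K ∈ T.cells, ∀ α ∈ bernIdx m K, ‖c K α - c' K α‖ ^ 2 ≤
          C * ∑ F ∈ nearFaces κ 𝓕 K, ∑ β ∈ bernIdx m F, ‖T.jumpCoef cross c F β‖ ^ 2 := by
  classical
  obtain ⟨N, hN⟩ := exists_card_cellsAt_le (d := d) (by omega) (max σ 1)
  set S := max σ 1 with hS
  have hS1 : 1 ≤ S := le_max_right _ _
  have hS0 : 0 < S := by linarith
  refine ⟨(S * ((d + 1) * (N + 1))) ^ 2, S ^ (N + 1), by positivity, by positivity,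
    fun Ω T hσ 𝓕 hi𝓕 h𝓕 c => ?_⟩
  replace hσ : T.ShapeRegular S := hσ.mono (le_max_left _ _)
  replace hN := hN Ω T hσ
  have hroot : ∀ α : E d →₀ ℕ, ∃ r, α.support.Nonempty → r ∈ α.support := fun α => by
    by_cases h : α.support.Nonempty
    · exact ⟨h.choose, fun _ => h.choose_spec⟩
    · exact ⟨0, fun h' => absurd h' h⟩
  choose r hr using hroot
  have hrmem : ∀ {K α}, α ∈ bernIdx m K → r α ∈ K := fun {K α} hα =>
    (mem_bernIdx.1 hα).2 (hr α (support_nonempty hm hα))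
  have hw : ∀ (α : E d →₀ ℕ) (b : E d), _ := fun α b =>
    exists_component_value (T.starGraph (insert b α.support)) (fun K => c K α) 0
      (fun K => ∃ F ∈ 𝓕, F ∉ T.interiorFaces ∧ insert b α.support ⊆ F ∧ F ⊆ K)
  choose w hw1 hw2 using hw
  -- the degrees of freedom of the new coefficients are those of the common values `w`
  have hc' : ∀ (K : Finset (E d)) (α : E d →₀ ℕ), ∃ v, K ∈ T.cells → α ∈ bernIdx m K →
      ∀ b ∈ K, ℓ (r α) b v = ℓ (r α) b (w α b K) := fun K α => by
    by_cases h : K ∈ T.cells ∧ α ∈ bernIdx m K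
    · obtain ⟨v, hv⟩ := hℓ.exists_eq (T.isSimplex K h.1) (hrmem h.2) fun b => w α b K
      exact ⟨v, fun _ _ => hv⟩
    · exact ⟨0, fun h1 h2 => absurd ⟨h1, h2⟩ h⟩
  choose c' hc' using hc'
  refine ⟨c', fun F hF α hα => ?_, fun K hK α hα => ?_⟩
  · have hFc := T.card_of_mem_faces (h𝓕 hF)
    have hg : ∀ b ∈ F, insert b α.support ⊆ F := fun b hb =>
      Finset.insert_subset hb (mem_bernIdx.1 hα).2
    by_cases hFi : F ∈ T.interiorFaces
    · obtain ⟨-, K, hK, L, hL, hKL⟩ := T.mem_interiorFaces.1 hFi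
      have hK' := T.mem_cellsAt.1 hK
      have hL' := T.mem_cellsAt.1 hL
      rw [jumpCoef_eq_of_ne (by omega) hx c' hFc hK hL hKL]
      refine hℓ.cross_eq_zero (T.isSimplex K hK'.1) hK'.2 hFc (hrmem hα) _ fun b hb => ?_
      rw [map_sub, hc' K α hK'.1 (bernIdx_mono hK'.2 hα) b (hK'.2 hb),
        hc' L α hL'.1 (bernIdx_mono hL'.2 hα) b (hL'.2 hb),
        hw1 α b K L (SimpleGraph.Adj.reachable ⟨hKL, F, hFc, hg b hb, hK, hL⟩), sub_self]
    · obtain ⟨K, hK, hFK, -⟩ := T.mem_faces.1 (h𝓕 hF)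
      rw [jumpCoef_eq_of_notMem c' (h𝓕 hF) hFi (T.mem_cellsAt.2 ⟨hK, hFK⟩)]
      refine hℓ.cross_eq_zero (T.isSimplex K hK) hFK hFc (hrmem hα) _ fun b hb => ?_
      rw [hc' K α hK (bernIdx_mono hFK hα) b (hFK hb)]
      rcases hw2 α b K with ⟨-, h⟩ | ⟨h, -⟩
      · rw [h, map_zero]
      · exact absurd ⟨F, hF, hFi, hg b hb, hFK⟩ (h K (SimpleGraph.Reachable.refl K))
  · set Q := ∑ F ∈ nearFaces (S ^ (N + 1)) 𝓕 K, ∑ β ∈ bernIdx m F,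
      ‖T.jumpCoef cross c F β‖ ^ 2 with hQ
    have hQ0 : 0 ≤ Q := Finset.sum_nonneg fun _ _ => Finset.sum_nonneg fun _ _ => sq_nonneg _
    -- all faces used to compare the values on `K` and in its component are near `K`
    have hnear : ∀ b ∈ K, ∀ L, (T.starGraph (insert b α.support)).Reachable K L → ∀ F ∈ 𝓕,
        insert b α.support ⊆ F → F ⊆ L → ‖T.jumpCoef cross c F α‖ ≤ √Q := by
      intro b hb L hKL F hF hgF hFL
      have hKg : K ∈ T.cellsAt (insert b α.support) :=
        T.mem_cellsAt.2 ⟨hK, Finset.insert_subset hb (mem_bernIdx.1 hα).2⟩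
      have hLc := (T.mem_cellsAt.1 (mem_cellsAt_of_reachable hKg hKL)).1
      obtain ⟨h1, h2⟩ := size_le_of_reachable hd hσ hN (Finset.insert_nonempty _ _) hKg hKL
      have h3 := T.size_le_mul_size (by omega) hσ hLc hFL
        (by rw [T.card_of_mem_faces (h𝓕 hF)]; omega)
      have hmem : F ∈ nearFaces (S ^ (N + 1)) 𝓕 K := by
        refine mem_nearFaces.2 ⟨hF, ⟨b, hgF (Finset.mem_insert_self _ _), hb⟩, ?_, ?_⟩
        · refine ((size_mono hFL).trans h1).trans (mul_le_mul_of_nonneg_right ?_ (size_nonneg K))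
          exact pow_le_pow_right₀ hS1 (Nat.le_succ N)
        · refine h2.trans ?_
          rw [pow_succ, mul_assoc]
          exact mul_le_mul_of_nonneg_left h3 (by positivity)
      have hαF : α ∈ bernIdx m F :=
        mem_bernIdx_of_support hα ((Finset.subset_insert _ _).trans hgF)
      refine Real.le_sqrt_of_sq_le ?_
      calc ‖T.jumpCoef cross c F α‖ ^ 2 ≤ ∑ β ∈ bernIdx m F, ‖T.jumpCoef cross c F β‖ ^ 2 :=
            Finset.single_le_sum (f := fun β => ‖T.jumpCoef cross c F β‖ ^ 2)
              (fun _ _ => sq_nonneg _) hαF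
        _ ≤ Q := Finset.single_le_sum
              (f := fun F => ∑ β ∈ bernIdx m F, ‖T.jumpCoef cross c F β‖ ^ 2)
              (fun _ _ => Finset.sum_nonneg fun _ _ => sq_nonneg _) hmem
    have hdof : ∀ b ∈ K, |ℓ (r α) b (c K α - c' K α)| ≤ (N + 1) * √Q := by
      intro b hb
      set g := insert b α.support with hg
      have hrg : r α ∈ g := Finset.mem_insert_of_mem (hr α (support_nonempty hm hα))
      have hbg : b ∈ g := Finset.mem_insert_self _ _
      have hKg : K ∈ T.cellsAt g :=
        T.mem_cellsAt.2 ⟨hK, Finset.insert_subset hb (mem_bernIdx.1 hα).2⟩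
      have hchain : ∀ L, (T.starGraph g).Reachable K L →
          |ℓ (r α) b (c K α) - ℓ (r α) b (c L α)| ≤ N * √Q := by
        intro L hKL
        refine (abs_sub_le_of_reachable (T.starGraph g) (fun _ _ => mem_cellsAt_of_adj) hKg hKL
          (fun M => ℓ (r α) b (c M α)) (Real.sqrt_nonneg Q) ?_).trans
          (mul_le_mul_of_nonneg_right (by exact_mod_cast hN g ⟨b, hbg⟩) (Real.sqrt_nonneg Q))
        rintro A B hKA ⟨hAB, F, hFc, hgF, hA, hB⟩
        have hA' := T.mem_cellsAt.1 hA
        have hFi : F ∈ T.interiorFaces := T.mem_interiorFaces.2 ⟨hFc, A, hA, B, hB, hAB⟩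
        refine le_trans ?_ (hnear b hb A hKA F (hi𝓕 hFi) hgF hA'.2)
        rw [jumpCoef_eq_of_ne (by omega) hx c hFc hA hB hAB, ← map_sub]
        exact hℓ.le_norm_cross (T.isSimplex A hA'.1) hA'.2 hFc (hgF hrg) (hgF hbg) _
      have hQs := Real.sqrt_nonneg Q
      rw [map_sub, hc' K α hK hα b hb]
      rcases hw2 α b K with ⟨⟨L, hKL, F, hF, hFi, hgF, hFL⟩, h⟩ | ⟨-, L, hKL, h⟩
      · have hLg := mem_cellsAt_of_reachable hKg hKL
        have hLc := (T.mem_cellsAt.1 hLg).1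
        have h1 := hnear b hb L hKL F hF hgF hFL
        rw [jumpCoef_eq_of_notMem c (h𝓕 hF) hFi (T.mem_cellsAt.2 ⟨hLc, hFL⟩)] at h1
        have h2 := hℓ.le_norm_cross (T.isSimplex L hLc) hFL (T.card_of_mem_faces (h𝓕 hF))
          (hgF hrg) (hgF hbg) (c L α)
        have h3 := hchain L hKL
        rw [h, map_zero, sub_zero]
        have h4 := abs_sub_abs_le_abs_sub (ℓ (r α) b (c K α)) (ℓ (r α) b (c L α))
        linarith
      · rw [h]
        have h3 := hchain L hKL
        linarith
    have hnorm : ‖c K α - c' K α‖ ≤ S * ((d + 1) * (N + 1)) * √Q := by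
      refine (hℓ.norm_le (T.isSimplex K hK) (hrmem hα) hS1
        (T.size_le_mul_inscribedDiam (by omega) hσ hK) _).trans ?_
      rw [mul_assoc]
      refine mul_le_mul_of_nonneg_left ((Finset.sum_le_sum hdof).trans_eq ?_) hS0.le
      rw [Finset.sum_const, (T.isSimplex K hK).1, nsmul_eq_mul]
      push_cast
      ring
    calc ‖c K α - c' K α‖ ^ 2 ≤ (S * ((d + 1) * (N + 1)) * √Q) ^ 2 :=
          pow_le_pow_left₀ (norm_nonneg _) hnorm 2
      _ = _ := by rw [mul_pow, Real.sq_sqrt hQ0]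

end Mesh

/-! ### Piecewise polynomials on a mesh -/

lemma continuous_curl {k l : ℕ} {cross : E d → E k → E l} {crossT : E d → E l → E k}
    (hx : IsCrossPair cross crossT) {φ : E d → E k} (hφ : ContDiff ℝ 1 φ) :
    Continuous (curl cross φ) := by
  unfold curl
  exact continuous_finsetSum _ fun j _ => (hx.continuous_right _).comp
    ((hφ.continuous_fderiv one_ne_zero).clm_apply continuous_const)


lemma memLp_hull {k : ℕ} {f : E d → E k} (hf : Continuous f) (K : Finset (E d)) (p : ENNReal) :
    MemLp f p (volume.restrict (hull K)) :=
  memLp_of_isCompact (isCompact_hull K) (measurableSet_hull K) (isCompact_hull K).measure_ne_top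
    hf p

lemma integrableOn_hull {M : Type*} [NormedAddCommGroup M] {f : E d → M} (hf : Continuous f)
    (K : Finset (E d)) : IntegrableOn f (hull K) :=
  hf.continuousOn.integrableOn_compact (isCompact_hull K)

lemma card_bernIdx (h : IsSimplex K) (m : ℕ) : (bernIdx m K).card = (refIdx d m).card := by
  have e := (K.equivFinOfCardEq h.1).symm
  have h1 := sum_bernIdx_eq (m := m) (b := fun i => (e i : E d)) (fun i => (e i).2)
    (Subtype.val_injective.comp e.injective) h.1 (fun _ => (1 : ℕ))
  simpa using h1

/-- The volume of a simplex is at most the volume of a ball with its diameter as radius. -/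
lemma volume_hull_le (h : IsSimplex K) :
    volume.real (hull K) ≤ size K ^ d * volume.real (Metric.ball (0 : E d) 1) := by
  obtain ⟨a, ha⟩ : K.Nonempty := by rw [← Finset.card_pos, h.1]; omega
  have h1 : hull K ⊆ Metric.closedBall a (size K) := fun x hx => by
    rw [mem_closedBall_iff_norm]
    exact dist_le_size hx (mem_hull_of_mem ha)
  refine (measureReal_mono h1 measure_closedBall_lt_top.ne).trans_eq ?_
  rw [measureReal_def, Measure.addHaar_closedBall _ _ (size_nonneg K), ENNReal.toReal_mul,
    ENNReal.toReal_ofReal (pow_nonneg (size_nonneg K) _), finrank_euclideanSpace_fin]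
  rfl

lemma setIntegral_sq_le (h : IsSimplex K) {k : ℕ} {f : E d → E k} (hf : Continuous f) {B : ℝ}
    (hB : ∀ x ∈ hull K, ‖f x‖ ^ 2 ≤ B) :
    ∫ x in hull K, ‖f x‖ ^ 2 ≤ size K ^ d * volume.real (Metric.ball (0 : E d) 1) * B := by
  have hB0 : 0 ≤ B := by
    obtain ⟨a, ha⟩ : K.Nonempty := by rw [← Finset.card_pos, h.1]; omega
    exact (sq_nonneg _).trans (hB a (mem_hull_of_mem ha))
  calc ∫ x in hull K, ‖f x‖ ^ 2 ≤ ∫ x in hull K, B :=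
        setIntegral_mono_on (integrableOn_hull (hf.norm.pow 2) K)
          (integrableOn_hull continuous_const K) (measurableSet_hull K) hB
    _ = volume.real (hull K) * B := by rw [setIntegral_const, smul_eq_mul]
    _ ≤ _ := mul_le_mul_of_nonneg_right (volume_hull_le h) hB0

namespace Mesh

variable {Ω : Set (E d)} (T : Mesh Ω)

/-- The function that agrees with `f K` almost everywhere on each element `K`. (On the intersections
of elements, which are null sets, the values add up.) -/
def glue {k : ℕ} (f : Finset (E d) → E d → E k) (x : E d) : E k :=
  ∑ K ∈ T.cells, (hull K).indicator (f K) x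

lemma glue_ae {k : ℕ} (f : Finset (E d) → E d → E k) (hK : K ∈ T.cells) :
    ∀ᵐ x ∂volume.restrict (hull K), T.glue f x = f K x := by
  have h1 : ∀ᵐ x ∂volume.restrict (hull K), ∀ L ∈ T.cells, L ≠ K → x ∉ hull L := by
    rw [Filter.eventually_all_finset]
    intro L hL
    by_cases hLK : L = K
    · exact Filter.Eventually.of_forall fun x h => absurd hLK h
    · have h2 := T.volume_inter_eq_zero hL hK hLK
      rw [← Measure.restrict_apply (measurableSet_hull L)] at h2
      filter_upwards [measure_eq_zero_iff_ae_notMem.1 h2] with x hx _ using hx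
  filter_upwards [h1, ae_restrict_mem (measurableSet_hull K)] with x hx hxK
  rw [glue, Finset.sum_eq_single K (fun L hL hLK => indicator_of_notMem (hx L hL hLK) _)
    (fun h => absurd hK h), indicator_of_mem hxK]

lemma memL2_glue {k : ℕ} {f : Finset (E d) → E d → E k} (hf : ∀ K ∈ T.cells, Continuous (f K)) :
    MemL2 Ω (T.glue f) := by
  refine MemLp.restrict Ω (memLp_finsetSum _ fun K hK => ?_)
  rw [memLp_indicator_iff_restrict (measurableSet_hull K)]
  exact memLp_hull (hf K hK) K 2

variable {T}

lemma integral_domain_ae (hΩ : IsPolyhedralDomain Ω) {f : E d → ℝ} {g : Finset (E d) → E d → ℝ}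
    (hg : ∀ K ∈ T.cells, Continuous (g K))
    (h : ∀ K ∈ T.cells, ∀ᵐ x ∂volume.restrict (hull K), f x = g K x) :
    ∫ x in Ω, f x = ∑ K ∈ T.cells, ∫ x in hull K, g K x := by
  rw [T.integral_domain hΩ fun K hK =>
    (integrableOn_hull (hg K hK) K).congr_fun_ae (Filter.EventuallyEq.symm (h K hK))]
  exact Finset.sum_congr rfl fun K hK => integral_congr_ae (h K hK)

variable {k l m : ℕ} {cross : E d → E k → E l} {crossT : E d → E l → E k}

/-- On a face, the polynomial with coefficients `c` has a tangential jump with Bernstein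
coefficients `jumpCoef`. -/
lemma sum_cross_bern (hx : IsCrossPair cross crossT) (c : Finset (E d) → (E d →₀ ℕ) → E k)
    (hK : K ∈ T.cellsAt F) {x : E d} (hxF : x ∈ hull F) :
    ∑ L ∈ T.cellsAt F, cross (outwardNormal L F) (bern m L (c L) x) =
      ∑ α ∈ bernIdx m F, (∏ a ∈ F, bary K a x ^ α a) • T.jumpCoef cross c F α := by
  have hK' := T.mem_cellsAt.1 hK
  simp only [jumpCoef, Finset.smul_sum]
  rw [Finset.sum_comm]
  refine Finset.sum_congr rfl fun L hL => ?_
  have hL' := T.mem_cellsAt.1 hL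
  rw [bern_face (T.isSimplex L hL'.1) hL'.2 _ hxF, hx.sum_right]
  refine Finset.sum_congr rfl fun α _ => ?_
  rw [hx.smul_right]
  congr 1
  refine Finset.prod_congr rfl fun a _ => ?_
  rw [bary_eq_of_mem_face (T.isSimplex L hL'.1) (T.isSimplex K hK'.1) hL'.2 hK'.2 hxF a]

lemma jumpSq_nonneg (u : E d → E k) (F : Finset (E d)) : 0 ≤ T.jumpSq cross u F :=
  integral_nonneg fun _ => sq_nonneg _

/-- A summation over the faces near the elements counts every face a bounded number of times. -/
lemma sum_nearFaces_le {N : ℕ} (hN : ∀ F : Finset (E d), F.Nonempty → (T.cellsAt F).card ≤ N)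
    {κ : ℝ} {𝓕 : Finset (Finset (E d))} (h𝓕 : 𝓕 ⊆ T.faces) {g : Finset (E d) → ℝ}
    (hg : ∀ F ∈ 𝓕, 0 ≤ g F) :
    ∑ K ∈ T.cells, ∑ F ∈ nearFaces κ 𝓕 K, g F ≤ (d * N) * ∑ F ∈ 𝓕, g F := by
  classical
  have h1 : ∀ K ∈ T.cells, ∑ F ∈ nearFaces κ 𝓕 K, g F ≤
      ∑ F ∈ 𝓕, if ∃ a ∈ F, a ∈ K then g F else 0 := by
    intro K _
    rw [← Finset.sum_filter]
    refine Finset.sum_le_sum_of_subset_of_nonneg (fun F hF => ?_) fun F hF _ =>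
      hg F (Finset.mem_filter.1 hF).1
    have := mem_nearFaces.1 hF
    exact Finset.mem_filter.2 ⟨this.1, this.2.1⟩
  refine (Finset.sum_le_sum h1).trans ?_
  rw [Finset.sum_comm, Finset.mul_sum]
  refine Finset.sum_le_sum fun F hF => ?_
  rw [← Finset.sum_filter, Finset.sum_const, nsmul_eq_mul]
  refine mul_le_mul_of_nonneg_right ?_ (hg F hF)
  have h2 : T.cells.filter (fun K => ∃ a ∈ F, a ∈ K) ⊆ F.biUnion fun a => T.cellsAt {a} := by
    intro K hK
    obtain ⟨hK, a, ha, haK⟩ := Finset.mem_filter.1 hK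
    exact Finset.mem_biUnion.2 ⟨a, ha, T.mem_cellsAt.2 ⟨hK, by simpa using haK⟩⟩
  have h3 := (Finset.card_le_card h2).trans
    (Finset.card_biUnion_le_card_mul F (fun a => T.cellsAt {a}) N fun a _ =>
      hN {a} (Finset.singleton_nonempty a))
  rw [T.card_of_mem_faces (h𝓕 hF)] at h3
  exact_mod_cast h3

end Mesh

/-! ### Scaling and the conforming approximation -/

namespace Mesh

variable {n k l m : ℕ} {Ω : Set (E (n + 1))} {T : Mesh Ω}
  {cross : E (n + 1) → E k → E l} {crossT : E (n + 1) → E l → E k}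

/-- The Bernstein coefficients of a jump are controlled by the `L²` norm of the jump. -/
lemma sum_sq_jumpCoef_le (hx : IsCrossPair cross crossT) {c₀ : ℝ} (hc₀ : 0 < c₀)
    (hlow : ∀ K F : Finset (E (n + 1)), IsSimplex K → F ⊆ K → F.card = n + 1 →
      ∀ q : (E (n + 1) →₀ ℕ) → E l, c₀ * inscribedDiam K ^ n * ∑ α ∈ bernIdx m F, ‖q α‖ ^ 2 ≤
        ∫ x in hull F, ‖∑ α ∈ bernIdx m F, (∏ a ∈ F, bary K a x ^ α a) • q α‖ ^ 2
          ∂(Measure.euclideanHausdorffMeasure n))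
    {σ : ℝ} (hσ : T.ShapeRegular σ) {u : E (n + 1) → E k}
    {c : Finset (E (n + 1)) → (E (n + 1) →₀ ℕ) → E k}
    (hu : ∀ K ∈ T.cells, ∀ x, polyFun (piece u K) x = bern m K (c K) x)
    {F : Finset (E (n + 1))} (hF : F ∈ T.faces) :
    size F ^ n * ∑ α ∈ bernIdx m F, ‖T.jumpCoef cross c F α‖ ^ 2 ≤
      σ ^ n / c₀ * T.jumpSq cross u F := by
  obtain ⟨K, hK, hFK, hFc⟩ := T.mem_faces.1 hF
  have h1 := hlow K F (T.isSimplex K hK) hFK hFc (T.jumpCoef cross c F)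
  have h2 : T.jumpSq cross u F =
      ∫ x in hull F, ‖∑ α ∈ bernIdx m F, (∏ a ∈ F, bary K a x ^ α a) •
        T.jumpCoef cross c F α‖ ^ 2 ∂(Measure.euclideanHausdorffMeasure n) := by
    refine setIntegral_congr_fun (measurableSet_hull F) fun x hxF => ?_
    rw [← sum_cross_bern hx c (T.mem_cellsAt.2 ⟨hK, hFK⟩) hxF, jump]
    congr 2
    exact Finset.sum_congr rfl fun L hL => by rw [hu L (T.mem_cellsAt.1 hL).1]
  rw [← h2] at h1
  have h3 : size F ≤ σ * inscribedDiam K :=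
    (size_mono hFK).trans (T.size_le_mul_inscribedDiam (by omega) hσ hK)
  have h4 : size F ^ n ≤ σ ^ n * inscribedDiam K ^ n := by
    rw [← mul_pow]
    exact pow_le_pow_left₀ (size_nonneg F) h3 n
  have hσ0 : 0 < σ := by linarith [T.one_le_of_shapeRegular (by omega) hσ hK]
  calc _ ≤ σ ^ n * inscribedDiam K ^ n * ∑ α ∈ bernIdx m F, ‖T.jumpCoef cross c F α‖ ^ 2 :=
        mul_le_mul_of_nonneg_right h4 (Finset.sum_nonneg fun _ _ => sq_nonneg _)
    _ = σ ^ n / c₀ * (c₀ * inscribedDiam K ^ n *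
          ∑ α ∈ bernIdx m F, ‖T.jumpCoef cross c F α‖ ^ 2) := by
        field_simp
    _ ≤ _ := mul_le_mul_of_nonneg_left h1 (by positivity)

lemma sum_norm_sq_le (h : IsSimplex K) {k m : ℕ} {e : (E d →₀ ℕ) → E k} {B : ℝ}
    (he : ∀ α ∈ bernIdx m K, ‖e α‖ ^ 2 ≤ B) :
    (∑ α ∈ bernIdx m K, ‖e α‖) ^ 2 ≤ (refIdx d m).card ^ 2 * B := by
  refine sq_sum_le_card_mul_sum_sq.trans ?_
  rw [sq ((refIdx d m).card : ℝ), mul_assoc, card_bernIdx h]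
  refine mul_le_mul_of_nonneg_left ((Finset.sum_le_sum he).trans_eq ?_) (Nat.cast_nonneg _)
  rw [Finset.sum_const, card_bernIdx h, nsmul_eq_mul]

/-- Inverse estimates on an element, in terms of the jumps over the nearby faces. -/
lemma exists_cell_bounds (hx : IsCrossPair cross crossT) (hcross : ∀ a v, ‖cross a v‖ ≤ ‖a‖ * ‖v‖)
    (hn : 1 ≤ n) (m : ℕ) {σ κ C₁ : ℝ} (hσ1 : 1 ≤ σ) (hκ : 0 < κ) (hC₁ : 0 < C₁) :
    ∃ A : ℝ, 0 < A ∧ ∀ (Ω : Set (E (n + 1))) (T : Mesh Ω), T.ShapeRegular σ →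
      ∀ 𝓕 ⊆ T.faces, ∀ (u : E (n + 1) → E k)
      (c : Finset (E (n + 1)) → (E (n + 1) →₀ ℕ) → E k),
      (∀ K ∈ T.cells, ∀ x, polyFun (piece u K) x = bern m K (c K) x) →
      ∀ K ∈ T.cells, ∀ e : (E (n + 1) →₀ ℕ) → E k,
      (∀ α ∈ bernIdx m K, ‖e α‖ ^ 2 ≤ C₁ * ∑ F ∈ nearFaces κ 𝓕 K,
        ∑ β ∈ bernIdx m F, ‖T.jumpCoef cross c F β‖ ^ 2) →
      (∫ x in hull K, ‖bern m K e x‖ ^ 2) ≤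
          A * ∑ F ∈ nearFaces κ 𝓕 K, size F * T.jumpSq cross u F ∧
      (∫ x in hull K, ‖curl cross (bern m K e) x‖ ^ 2) ≤
          A * ∑ F ∈ nearFaces κ 𝓕 K, (1 / size F) * T.jumpSq cross u F := by
  obtain ⟨c₀, hc₀, hlow⟩ := exists_face_lower n l m
  set b₀ := volume.real (Metric.ball (0 : E (n + 1)) 1) with hb₀d
  have hb₀ : 0 ≤ b₀ := measureReal_nonneg
  set M : ℝ := ((refIdx (n + 1) m).card : ℝ) with hM
  set X : ℝ := κ ^ (n + 1) * (σ ^ n / c₀) with hX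
  have hX0 : 0 < X := by positivity
  set D : ℝ := (n + 1) * m * σ with hD
  have hD0 : 0 ≤ D := by positivity
  refine ⟨b₀ * M ^ 2 * C₁ * X + D ^ 2 * b₀ * M ^ 2 * C₁ * X * κ ^ 2 + 1, by positivity,
    fun Ω T hσ 𝓕 h𝓕 u c hu K hK e he => ?_⟩
  have sK := T.isSimplex K hK
  have hh : 0 < size K := size_pos sK (by omega) subset_rfl (by rw [sK.1]; omega)
  have hρ : 0 < inscribedDiam K := inscribedDiam_pos sK (by omega)
  have hhρ := T.size_le_mul_inscribedDiam (by omega) hσ hK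
  set q : Finset (E (n + 1)) → ℝ := fun F => ∑ β ∈ bernIdx m F, ‖T.jumpCoef cross c F β‖ ^ 2 with hq
  have hq0 : ∀ F, 0 ≤ q F := fun F => Finset.sum_nonneg fun _ _ => sq_nonneg _
  set Q := ∑ F ∈ nearFaces κ 𝓕 K, q F with hQ
  have hsum := sum_norm_sq_le sK he
  -- the volume `h_K ^ (n + 1)` of `K` loses a factor `h` against the area `h_F ^ n` of `F`
  have hface : ∀ F ∈ nearFaces κ 𝓕 K,
      size K ^ (n + 1) * q F ≤ X * (size F * T.jumpSq cross u F) := by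
    intro F hF
    obtain ⟨hF, -, -, hKF⟩ := mem_nearFaces.1 hF
    have h1 := sum_sq_jumpCoef_le hx hc₀ hlow hσ hu (h𝓕 hF)
    have h2 : size K ^ (n + 1) ≤ κ ^ (n + 1) * size F ^ (n + 1) := by
      rw [← mul_pow]
      exact pow_le_pow_left₀ hh.le hKF _
    calc size K ^ (n + 1) * q F ≤ κ ^ (n + 1) * size F ^ (n + 1) * q F :=
          mul_le_mul_of_nonneg_right h2 (hq0 F)
      _ = κ ^ (n + 1) * size F * (size F ^ n * q F) := by ring
      _ ≤ κ ^ (n + 1) * size F * (σ ^ n / c₀ * T.jumpSq cross u F) :=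
          mul_le_mul_of_nonneg_left h1 (mul_nonneg (by positivity) (size_nonneg F))
      _ = _ := by rw [hX]; ring
  have hs1 : 0 ≤ ∑ F ∈ nearFaces κ 𝓕 K, size F * T.jumpSq cross u F :=
    Finset.sum_nonneg fun F _ => mul_nonneg (size_nonneg F) (jumpSq_nonneg u F)
  have hs2 : 0 ≤ ∑ F ∈ nearFaces κ 𝓕 K, (1 / size F) * T.jumpSq cross u F :=
    Finset.sum_nonneg fun F _ => mul_nonneg (one_div_nonneg.2 (size_nonneg F)) (jumpSq_nonneg u F)
  constructor
  · have h1 := setIntegral_sq_le sK (contDiff_bern e (K := K) (m := m) (n := 1)).continuous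
      fun x hxK => (pow_le_pow_left₀ (norm_nonneg _) (norm_bern_le sK e hxK) 2).trans hsum
    have h2 : size K ^ (n + 1) * Q ≤ X * ∑ F ∈ nearFaces κ 𝓕 K, size F * T.jumpSq cross u F := by
      rw [hQ, Finset.mul_sum, Finset.mul_sum]
      exact Finset.sum_le_sum hface
    calc _ ≤ size K ^ (n + 1) * b₀ * (M ^ 2 * (C₁ * Q)) := h1
      _ = b₀ * M ^ 2 * C₁ * (size K ^ (n + 1) * Q) := by ring
      _ ≤ b₀ * M ^ 2 * C₁ * (X * ∑ F ∈ nearFaces κ 𝓕 K, size F * T.jumpSq cross u F) :=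
          mul_le_mul_of_nonneg_left h2 (by positivity)
      _ = (b₀ * M ^ 2 * C₁ * X) * ∑ F ∈ nearFaces κ 𝓕 K, size F * T.jumpSq cross u F := by ring
      _ ≤ _ := mul_le_mul_of_nonneg_right (by
          have : 0 ≤ D ^ 2 * b₀ * M ^ 2 * C₁ * X * κ ^ 2 := by positivity
          linarith) hs1
  · have hDρ : ((n + 1 : ℕ) : ℝ) * (m / inscribedDiam K) ≤ D / size K := by
      rw [hD, ← mul_div_assoc, div_le_div_iff₀ hρ hh]
      push_cast
      calc ((n : ℝ) + 1) * m * size K ≤ (n + 1) * m * (σ * inscribedDiam K) :=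
            mul_le_mul_of_nonneg_left hhρ (by positivity)
        _ = _ := by ring
    have hpt : ∀ x ∈ hull K,
        ‖curl cross (bern m K e) x‖ ^ 2 ≤ (D / size K) ^ 2 * (M ^ 2 * (C₁ * Q)) := by
      intro x hxK
      have h := norm_curl_bern_le sK (by omega) hcross e (m := m) hxK
      refine (pow_le_pow_left₀ (norm_nonneg _) h 2).trans ?_
      rw [mul_pow]
      exact mul_le_mul (pow_le_pow_left₀ (by positivity) hDρ 2) hsum (sq_nonneg _) (sq_nonneg _)
    have h1 := setIntegral_sq_le sK (continuous_curl hx (contDiff_bern e (K := K) (m := m))) hpt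
    have h2 : size K ^ (n + 1) / size K ^ 2 * Q ≤
        X * κ ^ 2 * ∑ F ∈ nearFaces κ 𝓕 K, (1 / size F) * T.jumpSq cross u F := by
      rw [hQ, Finset.mul_sum, Finset.mul_sum]
      refine Finset.sum_le_sum fun F hF => ?_
      have h3 := hface F hF
      obtain ⟨hF, -, hFK, -⟩ := mem_nearFaces.1 hF
      obtain ⟨L, hL, hFL, hFc⟩ := T.mem_faces.1 (h𝓕 hF)
      have hF0 : 0 < size F := size_pos (T.isSimplex L hL) (by omega) hFL (by omega)
      have h4 : size F ^ 2 ≤ κ ^ 2 * size K ^ 2 := by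
        rw [← mul_pow]
        exact pow_le_pow_left₀ hF0.le hFK 2
      have hJ := jumpSq_nonneg (T := T) (cross := cross) u F
      rw [div_mul_eq_mul_div, div_le_iff₀ (by positivity)]
      calc size K ^ (n + 1) * q F ≤ X * (size F * T.jumpSq cross u F) := h3
        _ = X * (1 / size F) * T.jumpSq cross u F * size F ^ 2 := by field_simp
        _ ≤ X * (1 / size F) * T.jumpSq cross u F * (κ ^ 2 * size K ^ 2) :=
            mul_le_mul_of_nonneg_left h4 (by positivity)
        _ = _ := by ring
    calc _ ≤ size K ^ (n + 1) * b₀ * ((D / size K) ^ 2 * (M ^ 2 * (C₁ * Q))) := h1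
      _ = D ^ 2 * b₀ * M ^ 2 * C₁ * (size K ^ (n + 1) / size K ^ 2 * Q) := by
          rw [div_pow]; ring
      _ ≤ D ^ 2 * b₀ * M ^ 2 * C₁ * (X * κ ^ 2 *
            ∑ F ∈ nearFaces κ 𝓕 K, (1 / size F) * T.jumpSq cross u F) :=
          mul_le_mul_of_nonneg_left h2 (by positivity)
      _ = (D ^ 2 * b₀ * M ^ 2 * C₁ * X * κ ^ 2) *
            ∑ F ∈ nearFaces κ 𝓕 K, (1 / size F) * T.jumpSq cross u F := by ring
      _ ≤ _ := mul_le_mul_of_nonneg_right (by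
          have : 0 ≤ b₀ * M ^ 2 * C₁ * X := by positivity
          linarith) hs2

/-- The energy norm of the difference of two piecewise polynomials with coefficients `c` and `c'`,
when the second one has no tangential jumps over the faces in `𝓕`. -/
lemma energySq_sub (hx : IsCrossPair cross crossT) {𝓕 : Finset (Finset (E (n + 1)))}
    (h𝓕 : 𝓕 ⊆ T.faces) {u v : E (n + 1) → E k}
    {c c' : Finset (E (n + 1)) → (E (n + 1) →₀ ℕ) → E k}
    (hc : ∀ K ∈ T.cells, ∀ x, polyFun (piece u K) x = bern m K (c K) x)
    (huvae : ∀ K ∈ T.cells, ∀ᵐ x ∂volume.restrict (hull K), (u - v) x = bern m K (c K - c' K) x)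
    (huv : ∀ K ∈ T.cells, ∀ x, polyFun (piece (u - v) K) x = bern m K (c K - c' K) x)
    (hc' : ∀ F ∈ 𝓕, ∀ α ∈ bernIdx m F, T.jumpCoef cross c' F α = 0) :
    T.energySq cross 𝓕 (u - v) =
      (∑ K ∈ T.cells, ((∫ x in hull K, ‖bern m K (c K - c' K) x‖ ^ 2) +
        ∫ x in hull K, ‖curl cross (bern m K (c K - c' K)) x‖ ^ 2)) +
      ∑ F ∈ 𝓕, (1 / size F) * T.jumpSq cross u F := by
  have hjump : ∀ F ∈ 𝓕, T.jumpSq cross (u - v) F = T.jumpSq cross u F := by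
    intro F hF
    refine setIntegral_congr_fun (measurableSet_hull F) fun x hxF => ?_
    obtain ⟨K, hK, hFK, -⟩ := T.mem_faces.1 (h𝓕 hF)
    have h1 : ∑ L ∈ T.cellsAt F, cross (outwardNormal L F) (bern m L (c' L) x) = 0 := by
      rw [sum_cross_bern hx c' (T.mem_cellsAt.2 ⟨hK, hFK⟩) hxF]
      exact Finset.sum_eq_zero fun α hα => by rw [hc' F hF α hα, smul_zero]
    have h2 : T.jump cross (u - v) F x = T.jump cross u F x := by
      refine Eq.trans ?_ (sub_zero (T.jump cross u F x))
      rw [← h1, jump, jump, ← Finset.sum_sub_distrib]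
      refine Finset.sum_congr rfl fun L hL => ?_
      have hL' := (T.mem_cellsAt.1 hL).1
      rw [huv L hL', hc L hL', bern_sub, hx.sub_right]
    simp only [h2]
  have h1 : ∀ K ∈ T.cells, (∫ x in hull K, ‖(u - v) x‖ ^ 2) =
      ∫ x in hull K, ‖bern m K (c K - c' K) x‖ ^ 2 := fun K hK =>
    integral_congr_ae (by filter_upwards [huvae K hK] with x hx; rw [hx])
  have h2 : ∀ K ∈ T.cells, curl cross (polyFun (piece (u - v) K)) =
      curl cross (bern m K (c K - c' K)) := fun K hK => by rw [funext (huv K hK)]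
  have h3 : ∀ F ∈ 𝓕, (1 / size F) * T.jumpSq cross (u - v) F =
      (1 / size F) * T.jumpSq cross u F := fun F hF => by rw [hjump F hF]
  have h4 : ∀ K ∈ T.cells, ((∫ x in hull K, ‖(u - v) x‖ ^ 2) +
      ∫ x in hull K, ‖curl cross (polyFun (piece (u - v) K)) x‖ ^ 2) =
      (∫ x in hull K, ‖bern m K (c K - c' K) x‖ ^ 2) +
        ∫ x in hull K, ‖curl cross (bern m K (c K - c' K)) x‖ ^ 2 := fun K hK => by
    rw [h1 K hK, h2 K hK]
  rw [energySq, Finset.sum_congr rfl h3, Finset.sum_congr rfl h4]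

/-- The conforming approximation of a piecewise polynomial, for a general product. The
approximation has no tangential jumps over the faces in `𝓕`. -/
theorem exists_conforming {ℓ : E (n + 1) → E (n + 1) → E k →ₗ[ℝ] ℝ} (hn : 1 ≤ n)
    (hx : IsCrossPair cross crossT) (hxT : IsCrossPair crossT cross)
    (hcross : ∀ a v, ‖cross a v‖ ≤ ‖a‖ * ‖v‖)
    (hℓ : IsFrame cross ℓ) (hΩ : IsPolyhedralDomain Ω) (hm : 1 ≤ m) (σ : ℝ) :
    ∃ C : ℝ, 0 < C ∧ ∀ T : Mesh Ω, T.ShapeRegular σ →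
      ∀ 𝓕 : Finset (Finset (E (n + 1))), T.interiorFaces ⊆ 𝓕 → 𝓕 ⊆ T.faces →
      ∀ u ∈ T.brokenPoly m k, ∃ v ∈ T.brokenPoly m k, ∃ w : E (n + 1) → E l,
        MemL2 Ω w ∧
        (∀ φ : E (n + 1) → E l, ContDiff ℝ ∞ φ →
          (∀ F ∈ T.faces, F ∉ 𝓕 → ∀ x ∈ hull F, φ x = 0) →
          ∫ x in Ω, inner ℝ (v x) (curl crossT φ x) = ∫ x in Ω, inner ℝ (w x) (φ x)) ∧
        (∫ x in Ω, ‖u x - v x‖ ^ 2) ≤ C * ∑ f ∈ 𝓕, size f * T.jumpSq cross u f ∧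
        T.energySq cross 𝓕 (u - v) ≤ C * ∑ f ∈ 𝓕, (1 / size f) * T.jumpSq cross u f := by
  classical
  -- replacing `σ` by `max σ 1` makes the constants positive also when there are no elements
  obtain ⟨N, hN⟩ := exists_card_cellsAt_le (d := n + 1) (by omega) (max σ 1)
  obtain ⟨C₁, κ, hC₁, hκ, hcoef⟩ := exists_conforming_coef (by omega) hx hℓ hm (max σ 1)
  obtain ⟨A, hA, hcell⟩ := exists_cell_bounds hx hcross hn m (le_max_right σ 1) hκ hC₁
  set B : ℝ := A * ((n + 1 : ℕ) * N) with hB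
  set D : ℝ := Metric.diam (closure Ω) with hD
  refine ⟨B * (D ^ 2 + 1) + 1, by positivity, fun T hσ 𝓕 hi𝓕 h𝓕 u hu => ?_⟩
  replace hσ := hσ.mono (le_max_left σ 1)
  replace hN := hN Ω T hσ
  -- Bernstein coefficients of `u`
  have hc : ∀ K, ∃ c, K ∈ T.cells → ∀ x, polyFun (piece u K) x = bern m K c x := fun K => by
    by_cases hK : K ∈ T.cells
    · obtain ⟨p, hp, hup⟩ := hu.2 K hK
      rw [piece_eq (T.isSimplex K hK) hup]
      obtain ⟨c, hc⟩ := isBern_polyFun (T.isSimplex K hK) p hp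
      exact ⟨c, fun _ => hc⟩
    · exact ⟨0, fun h => absurd h hK⟩
  choose c hc using hc
  have huc : ∀ K ∈ T.cells, ∀ᵐ x ∂volume.restrict (hull K), u x = bern m K (c K) x := by
    intro K hK
    obtain ⟨p, -, hup⟩ := hu.2 K hK
    filter_upwards [hup] with x hx
    rw [hx, ← hc K hK, piece_eq (T.isSimplex K hK) hup]
  obtain ⟨c', hc'0, hcc'⟩ := hcoef Ω T hσ 𝓕 hi𝓕 h𝓕 c
  set v : E (n + 1) → E k := T.glue fun K => bern m K (c' K) with hv
  set w : E (n + 1) → E l := T.glue fun K => curl cross (bern m K (c' K)) with hw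
  have hbc : ∀ (e : Finset (E (n + 1)) → (E (n + 1) →₀ ℕ) → E k) (K : Finset (E (n + 1))),
      Continuous (bern m K (e K)) := fun e K => (contDiff_bern (e K) (n := 1)).continuous
  have hcc : ∀ (e : Finset (E (n + 1)) → (E (n + 1) →₀ ℕ) → E k) (K : Finset (E (n + 1))),
      Continuous (curl cross (bern m K (e K))) := fun e K =>
    continuous_curl hx (contDiff_bern (e K))
  have hvae := fun K (hK : K ∈ T.cells) => T.glue_ae (fun K => bern m K (c' K)) hK
  have huvae : ∀ K ∈ T.cells, ∀ᵐ x ∂volume.restrict (hull K),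
      (u - v) x = bern m K (c K - c' K) x := by
    intro K hK
    filter_upwards [huc K hK, hvae K hK] with x h1 h2
    rw [Pi.sub_apply, h1, hv, h2, bern_sub]
  have huv : ∀ K ∈ T.cells, ∀ x, polyFun (piece (u - v) K) x = bern m K (c K - c' K) x := by
    intro K hK x
    rw [piece_eq (T.isSimplex K hK) (p := bernPoly m K (c K - c' K)) (by
      filter_upwards [huvae K hK] with x hx
      rw [hx, polyFun_bernPoly]), polyFun_bernPoly]
  refine ⟨v, ⟨T.memL2_glue fun K _ => hbc c' K, fun K hK => ⟨bernPoly m K (c' K),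
    totalDegree_bernPoly _, ?_⟩⟩, w, T.memL2_glue fun K _ => hcc c' K, fun φ hφ hφ0 => ?_, ?_⟩
  · filter_upwards [hvae K hK] with x hx
    rw [hv, hx, polyFun_bernPoly]
  · have hφ1 : ContDiff ℝ 1 φ := hφ.of_le (by exact_mod_cast le_top)
    have hg1 : ∀ K, Continuous fun x => inner ℝ (curl cross (bern m K (c' K)) x) (φ x) :=
      fun K => (hcc c' K).inner hφ1.continuous
    have hg2 : ∀ K, Continuous fun x => inner ℝ (bern m K (c' K) x) (curl crossT φ x) :=
      fun K => (hbc c' K).inner (continuous_curl hxT hφ1)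
    rw [integral_domain_ae hΩ (fun K _ => hg2 K) (fun K hK => by
        filter_upwards [hvae K hK] with x hx
        rw [hv, hx]),
      integral_domain_ae hΩ (fun K _ => hg1 K) (fun K hK => by
        filter_upwards [T.glue_ae (fun K => curl cross (bern m K (c' K))) hK] with x hx
        rw [hw, hx])]
    have hgreen := green hx T (fun K => bern m K (c' K)) (fun K _ => contDiff_bern _) hφ1
      (fun F hF x hxF => by
        by_cases hF𝓕 : F ∈ 𝓕
        · obtain ⟨K, hK, hFK, -⟩ := T.mem_faces.1 hF
          rw [sum_cross_bern hx c' (T.mem_cellsAt.2 ⟨hK, hFK⟩) hxF,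
            Finset.sum_eq_zero fun α hα => by rw [hc'0 F hF𝓕 α hα, smul_zero], inner_zero_left]
        · rw [hφ0 F hF hF𝓕 x hxF, inner_zero_right])
    simp only [fun K => integral_sub (integrableOn_hull (hg1 K) K) (integrableOn_hull (hg2 K) K),
      Finset.sum_sub_distrib] at hgreen
    linarith
  · have hb := fun K hK => hcell Ω T hσ 𝓕 h𝓕 u c hc K hK (c K - c' K) (hcc' K hK)
    have hs1 : ∀ F ∈ 𝓕, 0 ≤ size F * T.jumpSq cross u F := fun F _ =>
      mul_nonneg (size_nonneg F) (jumpSq_nonneg u F)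
    have hs2 : ∀ F ∈ 𝓕, 0 ≤ (1 / size F) * T.jumpSq cross u F := fun F _ =>
      mul_nonneg (one_div_nonneg.2 (size_nonneg F)) (jumpSq_nonneg u F)
    set s1 := ∑ F ∈ 𝓕, size F * T.jumpSq cross u F with hs1d
    set s2 := ∑ F ∈ 𝓕, (1 / size F) * T.jumpSq cross u F with hs2d
    have hs1' : 0 ≤ s1 := Finset.sum_nonneg hs1
    have hs2' : 0 ≤ s2 := Finset.sum_nonneg hs2
    have hB0 : 0 ≤ B := by positivity
    have hL2 : ∑ K ∈ T.cells, ∫ x in hull K, ‖bern m K (c K - c' K) x‖ ^ 2 ≤ B * s1 := by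
      refine (Finset.sum_le_sum fun K hK => (hb K hK).1).trans ?_
      rw [← Finset.mul_sum, hB, mul_assoc A]
      exact mul_le_mul_of_nonneg_left (sum_nearFaces_le hN h𝓕 hs1) hA.le
    have hcurl : ∑ K ∈ T.cells, ∫ x in hull K, ‖curl cross (bern m K (c K - c' K)) x‖ ^ 2 ≤
        B * s2 := by
      refine (Finset.sum_le_sum fun K hK => (hb K hK).2).trans ?_
      rw [← Finset.mul_sum, hB, mul_assoc A]
      exact mul_le_mul_of_nonneg_left (sum_nearFaces_le hN h𝓕 hs2) hA.le
    have hs12 : s1 ≤ D ^ 2 * s2 := by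
      rw [hs1d, hs2d, Finset.mul_sum]
      refine Finset.sum_le_sum fun F hF => ?_
      obtain ⟨L, hL, hFL, hFc⟩ := T.mem_faces.1 (h𝓕 hF)
      have hF0 : 0 < size F := size_pos (T.isSimplex L hL) (by omega) hFL (by omega)
      have hFD : size F ≤ D := (size_mono hFL).trans (T.size_le_diam hL)
      rw [← mul_assoc]
      refine mul_le_mul_of_nonneg_right ?_ (jumpSq_nonneg u F)
      rw [mul_one_div, le_div_iff₀ hF0, ← sq]
      exact pow_le_pow_left₀ hF0.le hFD 2
    constructor
    · rw [integral_domain_ae hΩ (g := fun K x => ‖bern m K (c K - c' K) x‖ ^ 2)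
        (fun K _ => (hbc (c - c') K).norm.pow 2) (fun K hK => by
          filter_upwards [huvae K hK] with x hx
          rw [← hx, Pi.sub_apply])]
      refine hL2.trans (mul_le_mul_of_nonneg_right ?_ hs1')
      nlinarith [sq_nonneg D]
    · rw [energySq_sub hx h𝓕 hc huvae huv hc'0, Finset.sum_add_distrib]
      nlinarith [mul_le_mul_of_nonneg_left hs12 hB0]

end Mesh

/-! ### The products in dimensions two and three -/

lemma isCrossPair_two : IsCrossPair (crossVec 2) (crossDual 2) where
  add_left a b v := by ext i; fin_cases i; simp [crossVec]; ring
  smul_left c a v := by ext i; fin_cases i; simp [crossVec]; ring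
  add_right a v w := by ext i; fin_cases i; simp [crossVec]; ring
  smul_right c a v := by ext i; fin_cases i; simp [crossVec]; ring
  adjoint a v w := by simp [crossVec, crossDual, PiLp.inner_apply, Fin.sum_univ_two]; ring

lemma isCrossPair_two_dual : IsCrossPair (crossDual 2) (crossVec 2) where
  add_left a b v := by ext i; fin_cases i <;> simp [crossDual] <;> ring
  smul_left c a v := by ext i; fin_cases i <;> simp [crossDual] <;> ring
  add_right a v w := by ext i; fin_cases i <;> simp [crossDual] <;> ring
  smul_right c a v := by ext i; fin_cases i <;> simp [crossDual] <;> ring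
  adjoint a v w := by simp [crossVec, crossDual, PiLp.inner_apply, Fin.sum_univ_two]; ring

lemma isCrossPair_three : IsCrossPair (crossVec 3) (crossDual 3) where
  add_left a b v := by ext i; fin_cases i <;> simp [crossVec] <;> ring
  smul_left c a v := by ext i; fin_cases i <;> simp [crossVec] <;> ring
  add_right a v w := by ext i; fin_cases i <;> simp [crossVec] <;> ring
  smul_right c a v := by ext i; fin_cases i <;> simp [crossVec] <;> ring
  adjoint a v w := by simp [crossVec, crossDual, PiLp.inner_apply, Fin.sum_univ_three]; ring

lemma norm_sq_crossVec_two (a v : E 2) :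
    ‖crossVec 2 a v‖ ^ 2 = ‖a‖ ^ 2 * ‖v‖ ^ 2 - inner ℝ a v ^ 2 := by
  simp [crossVec, EuclideanSpace.norm_sq_eq, PiLp.inner_apply, Fin.sum_univ_two]
  ring

lemma norm_sq_crossVec_three (a v : E 3) :
    ‖crossVec 3 a v‖ ^ 2 = ‖a‖ ^ 2 * ‖v‖ ^ 2 - inner ℝ a v ^ 2 := by
  simp [crossVec, EuclideanSpace.norm_sq_eq, PiLp.inner_apply, Fin.sum_univ_three]
  ring

lemma norm_crossDual_two (a : E 2) (q : E 1) : ‖crossDual 2 a q‖ = ‖a‖ * ‖q‖ := by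
  rw [← sq_eq_sq₀ (norm_nonneg _) (by positivity), mul_pow]
  simp [crossDual, EuclideanSpace.norm_sq_eq, Fin.sum_univ_two]
  ring

lemma norm_cross_le {d l : ℕ} {cross : E d → E d → E l}
    (h : ∀ a v, ‖cross a v‖ ^ 2 = ‖a‖ ^ 2 * ‖v‖ ^ 2 - inner ℝ a v ^ 2) (a v : E d) :
    ‖cross a v‖ ≤ ‖a‖ * ‖v‖ := by
  refine le_of_sq_le_sq ?_ (by positivity)
  rw [h, mul_pow]
  exact sub_le_self _ (sq_nonneg _)

namespace Mesh

/-- For vector fields, all tangential jumps and traces can be removed; for dual fields, the jumps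
over the interior faces. -/
lemma exists_conforming_pair {n k : ℕ} (hn : 1 ≤ n) {cross : E (n + 1) → E (n + 1) → E k}
    {crossT : E (n + 1) → E k → E (n + 1)} {ℓ : E (n + 1) → E (n + 1) → E (n + 1) →ₗ[ℝ] ℝ}
    {ℓT : E (n + 1) → E (n + 1) → E k →ₗ[ℝ] ℝ}
    (hx : IsCrossPair cross crossT) (hxT : IsCrossPair crossT cross)
    (hcross : ∀ a v, ‖cross a v‖ ≤ ‖a‖ * ‖v‖) (hcrossT : ∀ a v, ‖crossT a v‖ ≤ ‖a‖ * ‖v‖)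
    (hℓ : IsFrame cross ℓ) (hℓT : IsFrame crossT ℓT) {Ω : Set (E (n + 1))}
    (hΩ : IsPolyhedralDomain Ω) {m : ℕ} (hm : 1 ≤ m) (σ : ℝ) :
    ∃ C : ℝ, 0 < C ∧ ∀ T : Mesh Ω, T.ShapeRegular σ →
      (∀ u ∈ T.brokenPoly m (n + 1), ∃ v ∈ T.brokenPoly m (n + 1),
        MemH0Curl crossT Ω v ∧
        (∫ x in Ω, ‖u x - v x‖ ^ 2) ≤ C * ∑ f ∈ T.faces, size f * T.jumpSq cross u f ∧
        T.energySq cross T.faces (u - v) ≤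
          C * ∑ f ∈ T.faces, (1 / size f) * T.jumpSq cross u f) ∧
      (∀ p ∈ T.brokenPoly m k, ∃ w ∈ T.brokenPoly m k,
        MemHCurl cross Ω w ∧
        (∫ x in Ω, ‖p x - w x‖ ^ 2) ≤ C * ∑ f ∈ T.interiorFaces, size f * T.jumpSq crossT p f ∧
        T.energySq crossT T.interiorFaces (p - w) ≤
          C * ∑ f ∈ T.interiorFaces, (1 / size f) * T.jumpSq crossT p f) := by
  obtain ⟨C₁, hC₁, h₁⟩ := exists_conforming hn hx hxT hcross hℓ hΩ hm σ
  obtain ⟨C₂, hC₂, h₂⟩ := exists_conforming hn hxT hx hcrossT hℓT hΩ hm σ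
  refine ⟨max C₁ C₂, lt_max_of_lt_left hC₁, fun T hσ => ⟨fun u hu => ?_, fun p hp => ?_⟩⟩
  · obtain ⟨v, hv, w, hw, hweak, hb1, hb2⟩ :=
      h₁ T hσ T.faces T.interiorFaces_subset subset_rfl u hu
    refine ⟨v, hv, ⟨hv.1, w, hw, fun φ hφ _ _ => hweak φ hφ fun F hF hF' => absurd hF hF',
      fun φ hφ _ => ?_⟩, hb1.trans ?_, hb2.trans ?_⟩
    · rw [hweak φ hφ fun F hF hF' => absurd hF hF', sub_self]
    · exact mul_le_mul_of_nonneg_right (le_max_left _ _) (Finset.sum_nonneg fun F _ =>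
        mul_nonneg (size_nonneg F) (jumpSq_nonneg u F))
    · exact mul_le_mul_of_nonneg_right (le_max_left _ _) (Finset.sum_nonneg fun F _ =>
        mul_nonneg (one_div_nonneg.2 (size_nonneg F)) (jumpSq_nonneg u F))
  · obtain ⟨v, hv, w, hw, hweak, hb1, hb2⟩ :=
      h₂ T hσ T.interiorFaces subset_rfl T.interiorFaces_subset p hp
    refine ⟨v, hv, ⟨hv.1, w, hw, fun φ hφ _ hsupp => hweak φ hφ fun F hF hFi x hxF => ?_⟩,
      hb1.trans ?_, hb2.trans ?_⟩
    -- boundary faces lie outside of the open set `Ω`, where test fields vanish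
    · by_contra hne
      exact (T.disjoint_boundaryFace (by omega) hΩ.isOpen hF hFi).le_bot
        ⟨hxF, hsupp (subset_tsupport φ hne)⟩
    · exact mul_le_mul_of_nonneg_right (le_max_right _ _) (Finset.sum_nonneg fun F _ =>
        mul_nonneg (size_nonneg F) (jumpSq_nonneg p F))
    · exact mul_le_mul_of_nonneg_right (le_max_right _ _) (Finset.sum_nonneg fun F _ =>
        mul_nonneg (one_div_nonneg.2 (size_nonneg F)) (jumpSq_nonneg p F))

end Mesh

end DLSMaxwell

end

open DLSMaxwell in
theorem lemma3p2 (d : ℕ) (hd : d = 2 ∨ d = 3) (Ω : Set (E d)) (hΩ : IsPolyhedralDomain Ω)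
    (m : ℕ) (hm : 1 ≤ m) (σ : ℝ) :
    ∃ C : ℝ, 0 < C ∧ ∀ T : Mesh Ω, T.ShapeRegular σ →
      (∀ u ∈ T.brokenPoly m d, ∃ v ∈ T.brokenPoly m d,
        MemH0Curl (crossDual d) Ω v ∧
        (∫ x in Ω, ‖u x - v x‖ ^ 2) ≤
          C * ∑ f ∈ T.faces, size f * T.jumpSq (crossVec d) u f ∧
        T.energySq (crossVec d) T.faces (u - v) ≤
          C * ∑ f ∈ T.faces, (1 / size f) * T.jumpSq (crossVec d) u f) ∧
      (∀ p ∈ T.brokenPoly m (2 * d - 3), ∃ w ∈ T.brokenPoly m (2 * d - 3),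
        MemHCurl (crossVec d) Ω w ∧
        (∫ x in Ω, ‖p x - w x‖ ^ 2) ≤
          C * ∑ f ∈ T.interiorFaces, size f * T.jumpSq (crossDual d) p f ∧
        T.energySq (crossDual d) T.interiorFaces (p - w) ≤
          C * ∑ f ∈ T.interiorFaces, (1 / size f) * T.jumpSq (crossDual d) p f) := by
  rcases hd with rfl | rfl
  · exact Mesh.exists_conforming_pair (n := 1) le_rfl isCrossPair_two isCrossPair_two_dual
      (norm_cross_le norm_sq_crossVec_two) (fun a q => (norm_crossDual_two a q).le)
      (isFrame_edgeDof (by norm_num) norm_sq_crossVec_two)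
      (isFrame_rootDof (by norm_num) norm_crossDual_two) hΩ hm σ
  · exact Mesh.exists_conforming_pair (n := 2) (by norm_num) isCrossPair_three isCrossPair_three
      (norm_cross_le norm_sq_crossVec_three) (norm_cross_le norm_sq_crossVec_three)
      (isFrame_edgeDof (by norm_num) norm_sq_crossVec_three)
      (isFrame_edgeDof (by norm_num) norm_sq_crossVec_three) hΩ hm σ
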